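/- Let $r\in C^\infty(\mathbb R)$ with $\inf r>0$ be conical at both ends: as $x\to\infty$ and as $x\to-\infty$, $r(x)=|x|(1+h(x))$ with $h^{(k)}(x)=O(|x|^{-2-k})$ for all $k\ge 0$. Let $\xi(x)=\int_0^x\sqrt{1+r'(y)^2}\,dy$ be arclength, write $r(\xi)$ for $r(x(\xi))$, and put $\rho=\frac{\dot r}{2r}$, $V=\rho^2+\dot\rho$, $\mathcal H=-\partial_\xi^2+V$ (the conjugated radial Laplacian on the surface of revolution with profile $r$). Then $V(\xi)=-\frac1{4\xi^2}+O(|\xi|^{-3})$ as $\xi\to\pm\infty$. For $\lambda>0$ there are unique Jost solutions $f_\pm(\cdot,\lambda)$, $\mathcal H f_\pm=\lambda^2f_\pm$, $f_\pm(\xi,\lambda)\sim e^{\pm i\lambda\xi}$ as $\xi\to\pm\infty$. Let $u_0=r^{1/2}$, $u_1=r^{1/2}\int_0^\xi r^{-1}\,d\eta$ be the zero-energy solutions, and for $\lambda\in\mathbb R$ let $u_j(\cdot,\lambda)$ be the unique solution of $\mathcal H u=\lambda^2u$ with the same value and derivative at $\xi=0$ as $u_j$. Then for $\lambda>0$ $$f_\pm(\xi,\lambda)=a_\pm(\lambda)u_0(\xi,\lambda)+b_\pm(\lambda)u_1(\xi,\lambda),$$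 and the Wronskian $W(\lambda)=f_-f_+'-f_-'f_+$ does not depend on $\xi$; $a_\pm,b_\pm,W$ are differentiable on $(0,\infty)$. With $c_0=\sqrt{\pi/2}\,e^{i\pi/4}$, $c_1=\frac2\pi$ there are real constants $c_3^+,c_3^-$ (equal if $r$ is even) such that for every $\varepsilon>0$, as $\lambda\to0+$, $$a_\pm(\lambda)=2^{1/4}c_0\sqrt\lambda\,(1+ic_1\log\lambda+ic_3^\pm)+O(\lambda^{1-\varepsilon}),\qquad b_\pm(\lambda)=\pm i2^{-1/4}c_0c_1\sqrt\lambda+O(\lambda^{1-\varepsilon}),$$ $$a_\pm'(\lambda)=\tfrac12 2^{1/4}c_0\lambda^{-1/2}(1+ic_3^\pm+2ic_1+ic_1\log\lambda)+O(\lambda^{-\varepsilon}),\qquad b_\pm'(\lambda)=\pm\tfrac i2 2^{-1/4}c_0c_1\lambda^{-1/2}+O(\lambda^{-\varepsilon}),$$ and, with $c_3=\frac12(c_3^++c_3^-)$, $$W(\lambda)=-2\lambda\Big(1+ic_3+i\tfrac2\pi\log\lambda\Big)+O(\lambda^{3/2-\varepsilon}),$$ $$W'(\lambda)=-2\Big(1+ic_3+i\tfrac2\pi+i\tfrac2\pi\log\lambda\Big)+O(\lambda^{1/2-\varepsilon}).$$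 -/

import Mathlib

open Filter Topology Asymptotics

noncomputable section

namespace ConicalJost

/-! ### The geometry: a profile `r` with conical ends -/

/-- `r` has a conical end along the filter `l` (`atTop`: on the right, `atBot`: on the left):
near that end `r x = |x| (1 + h x)`, where `h` and all its derivatives satisfy
`h^{(k)}(x) = O(|x|^{-2-k})`. -/
def HasConicalEnd (r : ℝ → ℝ) (l : Filter ℝ) : Prop :=
  ∃ h : ℝ → ℝ, (∀ᶠ x in l, r x = |x| * (1 + h x)) ∧
    ∀ k : ℕ, iteratedDeriv k h =O[l] fun x => |x| ^ (-(2 + k : ℤ))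

/-- A smooth profile, bounded below by a positive constant, that is conical at both ends. -/
structure IsConicalProfile (r : ℝ → ℝ) : Prop where
  smooth : ContDiff ℝ (⊤ : ℕ∞) r
  pos : ∃ δ > 0, ∀ x, δ ≤ r x
  right : HasConicalEnd r atTop
  left : HasConicalEnd r atBot

/-- The arclength `ξ(x) = ∫₀ˣ √(1 + r'(y)²) dy` along a generator. -/
def arcLength (r : ℝ → ℝ) (x : ℝ) : ℝ :=
  ∫ y in (0 : ℝ)..x, Real.sqrt (1 + deriv r y ^ 2)

/-- The inverse `x(ξ)` of the arclength, see `arcLength_bijective`. -/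
def arcInv (r : ℝ → ℝ) : ℝ → ℝ := Function.invFun (arcLength r)

/-- The profile as a function `r(ξ) = r(x(ξ))` of arclength. -/
def radius (r : ℝ → ℝ) (ξ : ℝ) : ℝ := r (arcInv r ξ)

/-- The arclength is a bijection of the line, so that `arcInv r` is its two-sided inverse. -/
theorem arcLength_bijective {r : ℝ → ℝ} (hr : IsConicalProfile r) :
    Function.Bijective (arcLength r) := by
  have hc : Continuous fun y => Real.sqrt (1 + deriv r y ^ 2) := by
    have : Continuous (deriv r) := hr.smooth.continuous_deriv (by simp)
    fun_prop
  have hd : ∀ x, HasDerivAt (arcLength r) (Real.sqrt (1 + deriv r x ^ 2)) x := fun x =>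
    intervalIntegral.integral_hasDerivAt_right (hc.intervalIntegrable _ _)
      (hc.stronglyMeasurableAtFilter _ _) hc.continuousAt
  have h1 : ∀ x, 1 ≤ Real.sqrt (1 + deriv r x ^ 2) := fun x => by
    rw [Real.one_le_sqrt]; nlinarith [sq_nonneg (deriv r x)]
  have hcont : Continuous (arcLength r) :=
    continuous_iff_continuousAt.2 fun x => (hd x).continuousAt
  have hmono : StrictMono (arcLength r) :=
    strictMono_of_deriv_pos fun x => by rw [(hd x).deriv]; linarith [h1 x]
  have hm : Monotone fun x => arcLength r x - x :=
    monotone_of_deriv_nonneg (fun x => ((hd x).sub (hasDerivAt_id x)).differentiableAt)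
      fun x => by
        have := ((hd x).sub (hasDerivAt_id x)).deriv
        have e : (arcLength r - id) = fun x => arcLength r x - x := rfl
        rw [e] at this
        rw [this]; linarith [h1 x]
  have h0 : arcLength r 0 = 0 := by simp [arcLength]
  refine ⟨hmono.injective, hcont.surjective ?_ ?_⟩
  · refine tendsto_atTop_mono' _ ?_ tendsto_id
    filter_upwards [eventually_ge_atTop 0] with x hx
    have := hm hx
    simp only [h0] at this
    simp only [id]; linarith
  · refine tendsto_atBot_mono' _ ?_ tendsto_id
    filter_upwards [eventually_le_atBot 0] with x hx
    have := hm hx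
    simp only [h0] at this
    simp only [id]; linarith

/-! ### The Schrödinger operator `𝓗 = -∂_ξ² + V` and its solutions -/

/-- `ρ = ṙ / (2 r)`, the dot being the derivative in arclength. -/
def rho (r : ℝ → ℝ) (ξ : ℝ) : ℝ := 1 / 2 * (deriv (radius r) ξ / radius r ξ)

/-- The potential `V = ρ² + ρ̇`. -/
def potential (r : ℝ → ℝ) (ξ : ℝ) : ℝ := rho r ξ ^ 2 + deriv (rho r) ξ

/-- `f` is a classical solution on the whole line of `𝓗 f = -f'' + V f = λ² f`
(`E = ℝ` or `E = ℂ`). -/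
def IsSolution {E : Type*} [NormedAddCommGroup E] [NormedSpace ℝ E]
    (V : ℝ → ℝ) (lam : ℝ) (f : ℝ → E) : Prop :=
  ContDiff ℝ 2 f ∧ ∀ ξ, -deriv (deriv f) ξ + V ξ • f ξ = lam ^ 2 • f ξ

/-- The Jost solution `f₊(·, λ)`: it solves `𝓗 f = λ² f` and `f(ξ) ~ e^{iλξ}` as `ξ → ∞`. -/
def IsJostPlus (V : ℝ → ℝ) (lam : ℝ) (f : ℝ → ℂ) : Prop :=
  IsSolution V lam f ∧
    IsEquivalent atTop f fun ξ : ℝ => Complex.exp (Complex.I * lam * ξ)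

/-- The Jost solution `f₋(·, λ)`: it solves `𝓗 f = λ² f` and `f(ξ) ~ e^{-iλξ}` as `ξ → -∞`. -/
def IsJostMinus (V : ℝ → ℝ) (lam : ℝ) (f : ℝ → ℂ) : Prop :=
  IsSolution V lam f ∧
    IsEquivalent atBot f fun ξ : ℝ => Complex.exp (-(Complex.I * lam * ξ))

/-- The zero energy solution `u₀ = r^{1/2}`. -/
def uZero (r : ℝ → ℝ) (ξ : ℝ) : ℝ := Real.sqrt (radius r ξ)

/-- The zero energy solution `u₁ = r^{1/2} ∫₀^ξ r^{-1}`. -/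
def uOne (r : ℝ → ℝ) (ξ : ℝ) : ℝ :=
  Real.sqrt (radius r ξ) * ∫ η in (0 : ℝ)..ξ, (radius r η)⁻¹

/-- The perturbation `u(·, λ)` to energy `λ²` of a zero energy solution `u`: the solution of
`𝓗 v = λ² v` with the Cauchy data of `u` at `ξ = 0`. -/
def IsPerturbation (V : ℝ → ℝ) (lam : ℝ) (u v : ℝ → ℝ) : Prop :=
  IsSolution V lam v ∧ v 0 = u 0 ∧ deriv v 0 = deriv u 0

/-- The Wronskian `W(f, g) = f g' - f' g`, as a function of `ξ`. -/
def wronskian (f g : ℝ → ℂ) (ξ : ℝ) : ℂ := f ξ * deriv g ξ - deriv f ξ * g ξ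

/-! ### The constants -/

/-- `c₀ = √(π/2) e^{iπ/4}`. -/
def c₀ : ℂ := (Real.sqrt (Real.pi / 2) : ℂ) * Complex.exp (Complex.I * (Real.pi / 4))

/-- `c₁ = 2/π`. -/
def c₁ : ℝ := 2 / Real.pi

/-- `2^{1/4}`. -/
def q : ℝ := (2 : ℝ) ^ (1 / 4 : ℝ)

end ConicalJost

end

/-! Write `ϱ` for the radius as a function of arclength and `k = 1/√2` for its limiting slope. Since
`V = (√ϱ)''/√ϱ`, the substitution `f = √ϱ g` turns `𝓗 f = λ² f` into `(ϱ ∂)² g = -λ² ϱ² g`, which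
contains no derivative of `ϱ`. In the coordinate `Z` defined by `ϱ Z' = k Z` and normalised by
`ϱ/(kZ) → 1`, this becomes, with `s = λ Z`, the perturbed Bessel equation of order zero `(s ∂_s)² g
= -s² (1 - e) g`, where `e = 1 - (ϱ/(kZ))² = O(Z⁻²)`. The transformation is exact and covers the
whole half line `ξ ≥ 0`, so no matching in an intermediate region is needed
(`IsConicalRadius.exists_isConeCoord`).

Let `H` be the Hankel function with `H ~ s^{-1/2} e^{is}`. Variation of constants `g = x H + y H̄`
gives a linear system for `(x, y)` with coefficients `e · s · (products of H, H̄)`. The bound `|H| ≤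
s^{-1/2}`, valid for every `s > 0`, makes these at most a multiple of `|e| ≤ C λ²/s²`, and the
integral of this over `s > λ Z(0)` is `O(λ)`. Hence the solution with limit `(1, 0)` at infinity
still equals `(1, 0) + O(λ)` at `ξ = 0`, with a `λ`-derivative that stays bounded as `λ → 0`
(`exists_jost_coeff`). The Volterra structure gives existence for all `λ > 0`.

The solutions `u₀(·, λ)`, `u₁(·, λ)` have data `(g, ϱ g') = (1, 0)` and `(0, 1)` at `ξ = 0`. So
`a₊`, `b₊` are the data of the Jost solution itself: up to `√λ`, `2^{±1/4}` and small errors they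
are `H(λ z₀)` and `s H'(s)` at `s = λ z₀`, with `z₀ = Z(0)`. All asymptotics then come from `H =
c₀(1 + iκ + i c₁ log s) + O(√s)` and `s H' = i c₀ c₁ + O(√s)`, which are read off a Laplace
integral; `κ` is real because the Wronskian of `H` and `H̄` is the same at `0` and at `∞`
(`exists_hankel_expansion`).

The left end follows by reflection, under which `u₁` changes sign. Finally the Wronskian of `u₀(·,
λ)` and `u₁(·, λ)` is `1`, so `W = a₋ b₊ - b₋ a₊`, and `c₀² i c₁ = -1` gives its leading term. -/

noncomputable section

namespace ConicalJost

open MeasureTheory Set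
open scoped BoundedContinuousFunction

set_option linter.unusedSectionVars false

/-! ### Volterra equations on a half line and their dependence on a parameter -/

section Volterra

variable {E : Type*} [NormedAddCommGroup E] [NormedSpace ℝ E]

/-- Integrability of a bounded continuous function against an integrable operator density. -/
theorem integrable_apply {N : ℝ → E →L[ℝ] E} (hN : Integrable N) (c : ℝ →ᵇ E) :
    Integrable fun t => N t (c t) := by
  refine (hN.norm.mul_const ‖c‖).mono' ?_ (ae_of_all _ fun t => ?_)
  · exact (ContinuousLinearMap.apply ℝ E).flip.aestronglyMeasurable_comp₂
      hN.aestronglyMeasurable c.continuous.aestronglyMeasurable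
  · exact (N t).le_of_opNorm_le_of_le le_rfl (c.norm_coe_le_norm t)

theorem tail_eq_sub {f : ℝ → E} (hf : Integrable f) (σ : ℝ) :
    ∫ t in Ioi σ, f t = (∫ t in Ioi 0, f t) - ∫ t in (0 : ℝ)..σ, f t := by
  rw [← intervalIntegral.integral_Ioi_sub_Ioi' hf.integrableOn hf.integrableOn]
  abel

theorem continuous_tail {f : ℝ → E} (hf : Integrable f) :
    Continuous fun σ => ∫ t in Ioi σ, f t := by
  rw [funext (tail_eq_sub hf)]
  exact continuous_const.sub
    (intervalIntegral.continuous_primitive (fun a b => hf.intervalIntegrable) 0)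

theorem hasDerivAt_tail [CompleteSpace E] {f : ℝ → E} (hf : Integrable f) {σ : ℝ} (hσ : 0 < σ)
    (hc : ContinuousOn f (Ioi 0)) : HasDerivAt (fun σ => ∫ t in Ioi σ, f t) (-f σ) σ := by
  rw [funext (tail_eq_sub hf)]
  have := intervalIntegral.integral_hasDerivAt_right (a := 0) (b := σ) hf.intervalIntegrable
    (hc.stronglyMeasurableAtFilter isOpen_Ioi _ hσ) (hc.continuousAt (Ioi_mem_nhds hσ))
  simpa using this.const_sub (∫ t in Ioi 0, f t)

theorem tendsto_tail (f : ℝ → E) :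
    Tendsto (fun σ => ∫ t in Ioi σ, f t) atTop (𝓝 0) :=
  tendsto_integral_Ioi_zero tendsto_id

theorem norm_tail_apply_le {N : ℝ → E →L[ℝ] E} (hN : Integrable N) (c : ℝ →ᵇ E) (σ : ℝ) :
    ‖∫ t in Ioi σ, N t (c t)‖ ≤ (∫ t, ‖N t‖) * ‖c‖ := by
  calc _ ≤ ∫ t in Ioi σ, ‖N t‖ * ‖c‖ :=
        norm_integral_le_of_norm_le (hN.norm.mul_const _).integrableOn
          (ae_of_all _ fun t => (N t).le_of_opNorm_le_of_le le_rfl (c.norm_coe_le_norm t))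
    _ ≤ ∫ t, ‖N t‖ * ‖c‖ :=
        setIntegral_le_integral (hN.norm.mul_const _) (ae_of_all _ fun t => by positivity)
    _ = _ := integral_mul_const _ _

open Classical in
/-- The Volterra operator `c ↦ ∫_σ^∞ N c` on bounded continuous functions. -/
def tailOp (N : ℝ → E →L[ℝ] E) : (ℝ →ᵇ E) →L[ℝ] (ℝ →ᵇ E) :=
  if hN : Integrable N then
    LinearMap.mkContinuous
      { toFun := fun c => BoundedContinuousFunction.ofNormedAddCommGroup
          (fun σ => ∫ t in Ioi σ, N t (c t)) (continuous_tail (integrable_apply hN c))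
          ((∫ t, ‖N t‖) * ‖c‖) (norm_tail_apply_le hN c)
        map_add' := fun c d => by
          ext σ
          simp only [BoundedContinuousFunction.coe_add, Pi.add_apply, map_add,
            BoundedContinuousFunction.coe_ofNormedAddCommGroup]
          exact integral_add (integrable_apply hN c).integrableOn
            (integrable_apply hN d).integrableOn
        map_smul' := fun x c => by
          ext σ
          simp only [BoundedContinuousFunction.coe_smul, map_smul, RingHom.id_apply,
            BoundedContinuousFunction.coe_ofNormedAddCommGroup]
          exact integral_smul _ _ }
      (∫ t, ‖N t‖) fun c => (BoundedContinuousFunction.norm_le (by positivity)).2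
        fun σ => norm_tail_apply_le hN c σ
  else 0

theorem tailOp_apply {N : ℝ → E →L[ℝ] E} (hN : Integrable N) (c : ℝ →ᵇ E) (σ : ℝ) :
    tailOp N c σ = ∫ t in Ioi σ, N t (c t) := by
  simp [tailOp, hN]

theorem norm_tailOp_le {N : ℝ → E →L[ℝ] E} (hN : Integrable N) :
    ‖tailOp N‖ ≤ ∫ t, ‖N t‖ := by
  refine ContinuousLinearMap.opNorm_le_bound _ (by positivity) fun c =>
    (BoundedContinuousFunction.norm_le (by positivity)).2 fun σ => ?_
  rw [tailOp_apply hN]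
  exact norm_tail_apply_le hN c σ

theorem tailOp_sub_sub {N₁ N₂ N₃ : ℝ → E →L[ℝ] E} (h₁ : Integrable N₁) (h₂ : Integrable N₂)
    (h₃ : Integrable N₃) (x : ℝ) :
    tailOp N₁ - tailOp N₂ - x • tailOp N₃ = tailOp fun t => N₁ t - N₂ t - x • N₃ t := by
  have h : Integrable fun t => N₁ t - N₂ t - x • N₃ t := (h₁.sub h₂).sub (h₃.smul x)
  ext c σ
  have i₁ := (integrable_apply h₁ c).integrableOn (s := Ioi σ)
  have i₂ := (integrable_apply h₂ c).integrableOn (s := Ioi σ)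
  have i₃ := (integrable_apply h₃ c).integrableOn (s := Ioi σ)
  simp only [sub_apply, smul_apply, BoundedContinuousFunction.coe_sub,
    BoundedContinuousFunction.coe_smul, Pi.sub_apply,
    tailOp_apply h₁, tailOp_apply h₂, tailOp_apply h₃, tailOp_apply h]
  rw [← integral_smul, ← integral_sub i₁ i₂]
  exact (integral_sub (i₁.sub i₂) (i₃.smul x)).symm

/-- The density is supported in `(0, ∞)` and bounded by `K / (t + a)²` there. -/
structure IsTailDensity (K a : ℝ) (N : ℝ → E →L[ℝ] E) : Prop where
  meas : AEStronglyMeasurable N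
  zero : ∀ t ≤ 0, N t = 0
  bound : ∀ t > 0, ‖N t‖ ≤ K / (t + a) ^ 2

/-- With `x = K / (t + a)` the weight `K / (t + a) ^ 2` is `-dx/dt`, so integrating `x ^ n / n!`
against it produces `x ^ (n + 1) / (n + 1)!`. This primitive supplies the factorials in the bounds
on iterates of the Volterra operator. -/
theorem hasDerivAt_inv_shift {K a t : ℝ} (h : t + a ≠ 0) (n : ℕ) :
    HasDerivAt (fun t => -((K / (t + a)) ^ (n + 1) / (n + 1).factorial))
      (K / (t + a) ^ 2 * ((K / (t + a)) ^ n / n.factorial)) t := by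
  have h1 : HasDerivAt (fun t => K / (t + a)) (-K / (t + a) ^ 2) t := by
    have := ((hasDerivAt_id t).add_const a).inv h |>.const_mul K
    simpa [div_eq_mul_inv] using this
  refine ((h1.pow (n + 1)).div_const ((n + 1).factorial : ℝ)).neg.congr_deriv ?_
  have : (n.factorial : ℝ) ≠ 0 := by positivity
  have : (n + 1 : ℝ) ≠ 0 := by positivity
  rw [Nat.factorial_succ]
  push_cast
  field_simp

theorem tendsto_inv_shift (K a : ℝ) (n : ℕ) :
    Tendsto (fun t => -((K / (t + a)) ^ (n + 1) / (n + 1).factorial)) atTop (𝓝 0) := by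
  have h : Tendsto (fun t => K / (t + a)) atTop (𝓝 0) :=
    tendsto_const_nhds.div_atTop (tendsto_atTop_add_const_right _ _ tendsto_id)
  simpa using ((h.pow (n + 1)).div_const ((n + 1).factorial : ℝ)).neg

theorem integrableOn_inv_shift {K a σ : ℝ} (hK : 0 ≤ K) (h : 0 < σ + a) (n : ℕ) :
    IntegrableOn (fun t => K / (t + a) ^ 2 * ((K / (t + a)) ^ n / n.factorial)) (Ioi σ) :=
  integrableOn_Ioi_deriv_of_nonneg' (fun t ht => hasDerivAt_inv_shift
    (by have : σ ≤ t := ht; linarith) n)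
    (fun t ht => by
      have : 0 < t + a := by have : σ < t := ht; linarith
      positivity) (tendsto_inv_shift K a n)

theorem integral_inv_shift {K a σ : ℝ} (hK : 0 ≤ K) (h : 0 < σ + a) (n : ℕ) :
    ∫ t in Ioi σ, K / (t + a) ^ 2 * ((K / (t + a)) ^ n / n.factorial) =
      (K / (σ + a)) ^ (n + 1) / (n + 1).factorial := by
  rw [integral_Ioi_of_hasDerivAt_of_tendsto' (fun t ht => hasDerivAt_inv_shift
    (by have : σ ≤ t := ht; linarith) n) (integrableOn_inv_shift hK h n) (tendsto_inv_shift K a n)]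
  simp

variable {K a : ℝ} {N : ℝ → E →L[ℝ] E}

theorem IsTailDensity.integrableOn (h : IsTailDensity K a N) (hK : 0 ≤ K) (ha : 0 < a) :
    IntegrableOn N (Ioi 0) := by
  refine Integrable.mono' (integrableOn_inv_shift (σ := 0) hK (by linarith) 0)
    h.meas.restrict ?_
  filter_upwards [ae_restrict_mem measurableSet_Ioi] with t ht
  simpa using h.bound t ht

theorem IsTailDensity.indicator (h : IsTailDensity K a N) : (Ioi 0).indicator N = N := by
  ext1 t
  by_cases ht : 0 < t
  · simp [ht]
  · simp [h.zero t (not_lt.1 ht)]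

theorem IsTailDensity.integrable (h : IsTailDensity K a N) (hK : 0 ≤ K) (ha : 0 < a) :
    Integrable N := by
  rw [← h.indicator]
  exact IntegrableOn.integrable_indicator (ε' := E →L[ℝ] E) (h.integrableOn hK ha) measurableSet_Ioi

theorem IsTailDensity.integral_norm_le (h : IsTailDensity K a N) (hK : 0 ≤ K) (ha : 0 < a) :
    ∫ t, ‖N t‖ ≤ K / a := by
  have e : ∫ t, ‖N t‖ = ∫ t in Ioi 0, ‖N t‖ := by
    conv_lhs => rw [← h.indicator]
    simp_rw [norm_indicator_eq_indicator_norm]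
    rw [integral_indicator measurableSet_Ioi]
  rw [e]
  have h2 := integral_inv_shift (σ := 0) hK (a := a) (by linarith) 0
  simp only [zero_add, pow_one, Nat.factorial_one, Nat.cast_one, div_one] at h2
  rw [← h2]
  refine setIntegral_mono_on (h.integrableOn hK ha).norm
    (integrableOn_inv_shift (σ := 0) hK (by linarith) 0) measurableSet_Ioi fun t ht => ?_
  simpa using h.bound t ht

theorem IsTailDensity.norm_tailOp_le (h : IsTailDensity K a N) (hK : 0 ≤ K) (ha : 0 < a) :
    ‖tailOp N‖ ≤ K / a :=
  (ConicalJost.norm_tailOp_le (h.integrable hK ha)).trans (h.integral_norm_le hK ha)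

/-- The density vanishes on the negative axis, so bounds proved for `σ ≥ 0` extend to the sup norm
over the whole line. -/
theorem IsTailDensity.tailOp_apply_of_nonpos (h : IsTailDensity K a N) (hK : 0 ≤ K) (ha : 0 < a)
    (c : ℝ →ᵇ E) {σ : ℝ} (hσ : σ ≤ 0) : tailOp N c σ = tailOp N c 0 := by
  have hi := h.integrable hK ha
  rw [tailOp_apply hi, tailOp_apply hi, tail_eq_sub (integrable_apply hi c) σ,
    sub_eq_self]
  refine intervalIntegral.integral_zero_ae (ae_of_all _ fun t ht => ?_)
  rw [uIoc_of_ge hσ] at ht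
  simp [h.zero t ht.2]

/-- The induction must keep the decay in `σ`: integrating the pointwise bound gains the factor `1 /
(n + 1)`, whereas the operator norm alone would only give powers of `K / a`. -/
theorem IsTailDensity.norm_pow_apply_le (h : IsTailDensity K a N) (hK : 0 ≤ K) (ha : 0 < a)
    (c : ℝ →ᵇ E) (n : ℕ) : ∀ σ, 0 ≤ σ →
    ‖(tailOp N ^ n) c σ‖ ≤ (K / (σ + a)) ^ n / n.factorial * ‖c‖ := by
  have hi := h.integrable hK ha
  induction n with
  | zero => intro σ _; simpa using c.norm_coe_le_norm σ
  | succ n ih =>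
    intro σ hσ
    rw [pow_succ', mul_apply_eq_comp, tailOp_apply hi,
      ← integral_inv_shift hK (by linarith : 0 < σ + a) n, ← integral_mul_const]
    refine norm_integral_le_of_norm_le
      ((integrableOn_inv_shift hK (by linarith : 0 < σ + a) n).mul_const ‖c‖) ?_
    filter_upwards [ae_restrict_mem measurableSet_Ioi] with t ht
    have ht : 0 < t := hσ.trans_lt ht
    rw [mul_assoc]
    exact (N t).le_of_opNorm_le_of_le (h.bound t ht) (ih t ht.le)

theorem IsTailDensity.norm_pow_le (h : IsTailDensity K a N) (hK : 0 ≤ K) (ha : 0 < a) (n : ℕ) :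
    ‖tailOp N ^ (n + 1)‖ ≤ (K / a) ^ (n + 1) / (n + 1).factorial := by
  refine ContinuousLinearMap.opNorm_le_bound _ (by positivity) fun c =>
    (BoundedContinuousFunction.norm_le (by positivity)).2 fun σ => ?_
  have key : ∀ σ, 0 ≤ σ → ‖(tailOp N ^ (n + 1)) c σ‖ ≤
      (K / a) ^ (n + 1) / (n + 1).factorial * ‖c‖ := fun σ hσ => by
    refine (h.norm_pow_apply_le hK ha c (n + 1) σ hσ).trans ?_
    gcongr
    linarith
  rcases le_total 0 σ with hσ | hσ
  · exact key σ hσ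
  · rw [pow_succ', mul_apply_eq_comp, h.tailOp_apply_of_nonpos hK ha _ hσ,
      ← mul_apply_eq_comp, ← pow_succ']
    exact key 0 le_rfl

/-- `1 - (-x) ^ n` is a unit and factors as `1 + x` times a geometric sum that commutes with it.
This inverts `1 + T` without `‖T‖ < 1`, hence at every energy and not only at low ones. -/
theorem isUnit_one_add_of_norm_pow_lt_one {R : Type*} [NormedRing R] [HasSummableGeomSeries R]
    {x : R} {n : ℕ} (h : ‖x ^ n‖ < 1) : IsUnit (1 + x) := by
  have h1 : ‖(-x) ^ n‖ < 1 := by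
    rw [neg_pow]
    rcases neg_one_pow_eq_or R n with h' | h' <;> simpa [h'] using h
  have h3 : IsUnit ((1 - -x) * ∑ i ∈ Finset.range n, (-x) ^ i) := by
    rw [mul_neg_geom_sum]
    exact isUnit_one_sub_of_norm_lt_one h1
  have hc : Commute (1 - -x) (∑ i ∈ Finset.range n, (-x) ^ i) :=
    (Commute.one_left _).sub_left (Commute.sum_right _ _ _ fun i _ => Commute.self_pow (-x) i)
  have h4 := (hc.isUnit_mul_iff.1 h3).1
  rwa [sub_neg_eq_add] at h4

/-- Differentiation under the integral sign, in the `L¹` sense. -/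
theorem tendsto_integral_slope {F : Type*} [NormedAddCommGroup F] [NormedSpace ℝ F]
    {M M' : ℝ → ℝ → F} {l₀ r : ℝ} {b : ℝ → ℝ} (hr : 0 < r) {s : Set ℝ} (hs : MeasurableSet s)
    (hM : ∀ l ∈ Metric.ball l₀ r, AEStronglyMeasurable (M l))
    (hM' : AEStronglyMeasurable (M' l₀)) (hb : IntegrableOn b s)
    (hM'b : ∀ l ∈ Metric.ball l₀ r, ∀ t ∈ s, ‖M' l t‖ ≤ b t)
    (hd : ∀ l ∈ Metric.ball l₀ r, ∀ t ∈ s, HasDerivAt (fun l => M l t) (M' l t) l) :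
    Tendsto (fun l => ∫ t in s, ‖l - l₀‖⁻¹ * ‖M l t - M l₀ t - (l - l₀) • M' l₀ t‖)
      (𝓝 l₀) (𝓝 0) := by
  have hl₀ : l₀ ∈ Metric.ball l₀ r := Metric.mem_ball_self hr
  have hball : Metric.ball l₀ r ∈ 𝓝 l₀ := Metric.ball_mem_nhds _ hr
  have hbd : ∀ l ∈ Metric.ball l₀ r, ∀ t ∈ s, ‖M l t - M l₀ t‖ ≤ b t * ‖l - l₀‖ :=
    fun l hl t ht => (convex_ball l₀ r).norm_image_sub_le_of_norm_hasDerivWithin_le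
      (fun x hx => (hd x hx t ht).hasDerivWithinAt) (fun x hx => hM'b x hx t ht) hl₀ hl
  have h0 : (0 : ℝ) = ∫ t in s, (0 : ℝ) := by simp
  rw [h0]
  refine tendsto_integral_filter_of_dominated_convergence (fun t => 2 * b t) ?_ ?_
    (hb.const_mul 2) ?_
  · filter_upwards [hball] with l hl
    exact (((((hM l hl).sub (hM l₀ hl₀)).sub (hM'.const_smul _)).norm).const_mul _).restrict
  · filter_upwards [hball] with l hl
    filter_upwards [ae_restrict_mem hs] with t ht
    have h1 := hbd l hl t ht
    have h2 : ‖(l - l₀) • M' l₀ t‖ ≤ b t * ‖l - l₀‖ := by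
      rw [norm_smul, mul_comm]
      gcongr
      exact hM'b l₀ hl₀ t ht
    have h3 := (norm_sub_le (M l t - M l₀ t) ((l - l₀) • M' l₀ t)).trans (add_le_add h1 h2)
    have h4 : 0 ≤ b t := (norm_nonneg _).trans (hM'b l₀ hl₀ t ht)
    rw [norm_mul, norm_inv, norm_norm, norm_norm]
    -- At `l = l₀` the quotient is `0` by the convention `0⁻¹ = 0`.
    rcases eq_or_lt_of_le (norm_nonneg (l - l₀)) with h0 | h0
    · rw [← h0]
      simpa using h4
    · rw [inv_mul_le_iff₀ h0]
      linarith
  · filter_upwards [ae_restrict_mem hs] with t ht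
    exact hasDerivAt_iff_tendsto.1 (hd l₀ hl₀ t ht)

variable [CompleteSpace E]

theorem IsTailDensity.isUnit (h : IsTailDensity K a N) (hK : 0 ≤ K) (ha : 0 < a) :
    IsUnit (1 + tailOp N) := by
  have h0 : Tendsto (fun n : ℕ => (K / a) ^ (n + 1) / (n + 1).factorial) atTop (𝓝 0) :=
    (FloorSemiring.tendsto_pow_div_factorial_atTop (K / a)).comp (tendsto_add_atTop_nat 1)
  obtain ⟨n, hn⟩ := (h0.eventually (gt_mem_nhds one_pos)).exists
  exact isUnit_one_add_of_norm_pow_lt_one ((h.norm_pow_le hK ha n).trans_lt hn)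

/-- The solution of `c' = N c` with limit `v` at infinity. -/
def tailSol (N : ℝ → E →L[ℝ] E) (v : E) : ℝ →ᵇ E :=
  Ring.inverse (1 + tailOp N) (BoundedContinuousFunction.const ℝ v)

theorem tailSol_add {N : ℝ → E →L[ℝ] E} (h : IsUnit (1 + tailOp N)) (v : E) :
    tailSol N v + tailOp N (tailSol N v) = BoundedContinuousFunction.const ℝ v := by
  have := congrArg (fun A : (ℝ →ᵇ E) →L[ℝ] (ℝ →ᵇ E) => A (BoundedContinuousFunction.const ℝ v))
    (Ring.mul_inverse_cancel _ h)
  simpa [tailSol, mul_apply_eq_comp] using this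

theorem tailSol_apply {N : ℝ → E →L[ℝ] E} (hN : Integrable N) (h : IsUnit (1 + tailOp N)) (v : E)
    (σ : ℝ) : tailSol N v σ = v - ∫ t in Ioi σ, N t (tailSol N v t) := by
  rw [← tailOp_apply hN, eq_sub_iff_add_eq]
  simpa using congrArg (fun c : ℝ →ᵇ E => c σ) (tailSol_add h v)

theorem IsTailDensity.tendsto_tailSol (h : IsTailDensity K a N) (hK : 0 ≤ K) (ha : 0 < a) (v : E) :
    Tendsto (tailSol N v) atTop (𝓝 v) := by
  have hi := h.integrable hK ha
  have h2 := (tendsto_tail fun t => N t (tailSol N v t)).const_sub v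
  rw [sub_zero] at h2
  exact h2.congr fun σ => (tailSol_apply hi (h.isUnit hK ha) v σ).symm

theorem IsTailDensity.hasDerivAt_tailSol (h : IsTailDensity K a N) (hK : 0 ≤ K) (ha : 0 < a)
    (hc : ContinuousOn N (Ioi 0)) (v : E) {σ : ℝ} (hσ : 0 < σ) :
    HasDerivAt (tailSol N v) (N σ (tailSol N v σ)) σ := by
  have hi := h.integrable hK ha
  have h2 := (hasDerivAt_tail (integrable_apply hi (tailSol N v)) hσ
    (hc.clm_apply (tailSol N v).continuous.continuousOn)).const_sub v
  rw [neg_neg] at h2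
  exact h2.congr_of_eventuallyEq
    (Eventually.of_forall fun σ => tailSol_apply hi (h.isUnit hK ha) v σ)

theorem norm_le_of_add_tailOp {T : (ℝ →ᵇ E) →L[ℝ] (ℝ →ᵇ E)} (hT : ‖T‖ ≤ 1 / 2) {c d : ℝ →ᵇ E}
    (h : c + T c = d) : ‖c‖ ≤ 2 * ‖d‖ := by
  have h1 : ‖T c‖ ≤ 1 / 2 * ‖c‖ := T.le_of_opNorm_le hT c
  have h2 : c = d - T c := by rw [← h]; abel
  have h3 : ‖c‖ ≤ ‖d‖ + ‖T c‖ := by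
    conv_lhs => rw [h2]
    exact norm_sub_le _ _
  linarith

theorem norm_tailSol_le (h : IsUnit (1 + tailOp N)) (hT : ‖tailOp N‖ ≤ 1 / 2) (v : E) :
    ‖tailSol N v‖ ≤ 2 * ‖v‖ :=
  (norm_le_of_add_tailOp hT (tailSol_add h v)).trans
    (by gcongr; exact BoundedContinuousFunction.norm_const_le v)

theorem norm_tailSol_sub_le (h : IsUnit (1 + tailOp N)) (hT : ‖tailOp N‖ ≤ 1 / 2) (v : E) (σ : ℝ) :
    ‖tailSol N v σ - v‖ ≤ 2 * ‖v‖ * ‖tailOp N‖ := by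
  have h1 : tailSol N v σ - v = -(tailOp N (tailSol N v) σ) := by
    have := congrArg (fun c : ℝ →ᵇ E => c σ) (tailSol_add h v)
    simp only [BoundedContinuousFunction.coe_add, Pi.add_apply,
      BoundedContinuousFunction.const_apply] at this
    rw [sub_eq_iff_eq_add]
    exact eq_neg_add_of_add_eq ((add_comm _ _).trans this)
  rw [h1, norm_neg, mul_comm]
  exact ((tailOp N (tailSol N v)).norm_coe_le_norm σ).trans
    ((tailOp N).le_of_opNorm_le_of_le le_rfl (norm_tailSol_le h hT v))

/-- Differentiability of the operator in a parameter. -/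
theorem hasDerivAt_tailOp {M M' : ℝ → ℝ → E →L[ℝ] E} {l₀ r : ℝ} (hr : 0 < r) (hK : 0 ≤ K)
    (ha : 0 < a) (hM : ∀ l ∈ Metric.ball l₀ r, IsTailDensity K a (M l))
    (hM' : ∀ l ∈ Metric.ball l₀ r, IsTailDensity K a (M' l))
    (hd : ∀ l ∈ Metric.ball l₀ r, ∀ t > 0, HasDerivAt (fun l => M l t) (M' l t) l) :
    HasDerivAt (fun l => tailOp (M l)) (tailOp (M' l₀)) l₀ := by
  have hl₀ : l₀ ∈ Metric.ball l₀ r := Metric.mem_ball_self hr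
  have hiM := fun l hl => (hM l hl).integrable hK ha
  have hi' := (hM' l₀ hl₀).integrable hK ha
  have hball : Metric.ball l₀ r ∈ 𝓝 l₀ := Metric.ball_mem_nhds _ hr
  have hd0 : ∀ t ≤ 0, ∀ l ∈ Metric.ball l₀ r, M l t = 0 := fun t ht l hl => (hM l hl).zero t ht
  have hlim := tendsto_integral_slope (M := M) (M' := M') hr measurableSet_Ioi
    (fun l hl => (hM l hl).meas) (hM' l₀ hl₀).meas
    (integrableOn_inv_shift (σ := 0) hK (by linarith : 0 < 0 + a) 0)
    (fun l hl t ht => by simpa using (hM' l hl).bound t ht) (fun l hl t ht => hd l hl t ht)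
  rw [hasDerivAt_iff_tendsto]
  -- The operator norm of the Taylor remainder is at most the `L¹` norm of the remainder of the
  -- density, so dominated convergence gives differentiability in operator norm.
  refine squeeze_zero' (Eventually.of_forall fun l => by positivity) ?_ hlim
  filter_upwards [hball] with l hl
  have hl₁ := (hM l hl).integrable hK ha
  have hl₂ := (hM l₀ hl₀).integrable hK ha
  have h1 := norm_tailOp_le ((hl₁.sub hl₂).sub (hi'.smul (l - l₀)))
  have h2 : ∫ t in Ioi 0, ‖M l t - M l₀ t - (l - l₀) • M' l₀ t‖ =
      ∫ t, ‖M l t - M l₀ t - (l - l₀) • M' l₀ t‖ := by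
    refine setIntegral_eq_integral_of_forall_compl_eq_zero fun t ht => ?_
    have ht : t ≤ 0 := not_lt.1 ht
    rw [(hM l hl).zero t ht, (hM l₀ hl₀).zero t ht, (hM' l₀ hl₀).zero t ht, sub_zero, smul_zero,
      sub_zero, norm_zero]
  rw [tailOp_sub_sub hl₁ hl₂ hi', integral_const_mul, h2]
  exact mul_le_mul_of_nonneg_left h1 (inv_nonneg.2 (norm_nonneg _))

/-- Differentiability of the solution in a parameter, with a bound for small operators. -/
theorem hasDerivAt_tailSol_param {M M' : ℝ → ℝ → E →L[ℝ] E} {l₀ r : ℝ} (hr : 0 < r) (hK : 0 ≤ K)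
    (ha : 0 < a) (hM : ∀ l ∈ Metric.ball l₀ r, IsTailDensity K a (M l))
    (hM' : ∀ l ∈ Metric.ball l₀ r, IsTailDensity K a (M' l))
    (hd : ∀ l ∈ Metric.ball l₀ r, ∀ t > 0, HasDerivAt (fun l => M l t) (M' l t) l) (v : E) :
    ∃ d : ℝ →ᵇ E, HasDerivAt (fun l => tailSol (M l) v) d l₀ ∧
      (‖tailOp (M l₀)‖ ≤ 1 / 2 → ‖d‖ ≤ 4 * ‖v‖ * ‖tailOp (M' l₀)‖) := by
  have hl₀ : l₀ ∈ Metric.ball l₀ r := Metric.mem_ball_self hr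
  have hball : Metric.ball l₀ r ∈ 𝓝 l₀ := Metric.ball_mem_nhds _ hr
  have hT := hasDerivAt_tailOp hr hK ha hM hM' hd
  have hu := (hM l₀ hl₀).isUnit hK ha
  have hdiff : DifferentiableAt ℝ (fun l => tailSol (M l) v) l₀ := by
    have h0 := differentiableAt_inverse (𝕜 := ℝ) (R := (ℝ →ᵇ E) →L[ℝ] (ℝ →ᵇ E)) hu
    have h1 : DifferentiableAt ℝ (fun l => Ring.inverse (1 + tailOp (M l))) l₀ :=
      DifferentiableAt.comp (g := Ring.inverse) (f := fun l => 1 + tailOp (M l)) l₀ h0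
        (hT.differentiableAt.const_add 1)
    exact h1.clm_apply (differentiableAt_const _)
  refine ⟨_, hdiff.hasDerivAt, fun hs => ?_⟩
  -- Differentiating `c + T c = v` gives `d + T d = -T' c`. For `‖T‖ ≤ 1/2` this costs a factor `2`
  -- for `d` and another `2` for `c`.
  have h2 := hdiff.hasDerivAt.add (hT.clm_apply hdiff.hasDerivAt)
  have h3 : HasDerivAt (fun l => tailSol (M l) v + tailOp (M l) (tailSol (M l) v)) 0 l₀ :=
    (hasDerivAt_const l₀ (BoundedContinuousFunction.const ℝ v)).congr_of_eventuallyEq (by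
      filter_upwards [hball] with l hl
      exact tailSol_add ((hM l hl).isUnit hK ha) v)
  have h4 := h2.unique h3
  have h5 := norm_le_of_add_tailOp hs (c := deriv (fun l => tailSol (M l) v) l₀)
    (d := -(tailOp (M' l₀) (tailSol (M l₀) v))) (by
      rw [eq_neg_iff_add_eq_zero, ← h4]; abel)
  refine h5.trans ?_
  rw [norm_neg]
  have := (tailOp (M' l₀)).le_of_opNorm_le_of_le le_rfl (norm_tailSol_le hu hs v)
  linarith

end Volterra

/-! ### Convergence at infinity from bounds on the derivative -/

section Limits

variable {E : Type*} [NormedAddCommGroup E] [NormedSpace ℝ E]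

/-- A function whose derivative is dominated by that of a vanishing function converges. -/
theorem exists_tendsto_of_norm_deriv_le [CompleteSpace E] {f f' : ℝ → E} {B B' : ℝ → ℝ} {x₀ : ℝ}
    (hf : ∀ x > x₀, HasDerivAt f (f' x) x) (hB : ∀ x > x₀, HasDerivAt B (B' x) x)
    (hb : ∀ x > x₀, ‖f' x‖ ≤ -B' x) (hB0 : Tendsto B atTop (𝓝 0)) :
    ∃ L, Tendsto f atTop (𝓝 L) ∧ ∀ x > x₀, ‖f x - L‖ ≤ B x := by
  have key : ∀ x > x₀, ∀ y ≥ x, ‖f y - f x‖ ≤ B x - B y := fun x hx y hy => by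
    refine image_norm_le_of_norm_deriv_right_le_deriv_boundary' (a := x) (b := y)
      (f := fun t => f t - f x) (f' := f') (B := fun t => B x - B t) (B' := fun t => -B' t)
      ?_ ?_ (by simp) ?_ ?_ ?_ (right_mem_Icc.2 hy)
    · exact fun t ht => ((hf t (hx.trans_le ht.1)).continuousAt.sub
        continuousAt_const).continuousWithinAt
    · exact fun t ht => ((hf t (hx.trans_le ht.1)).sub_const _).hasDerivWithinAt
    · exact fun t ht => (continuousAt_const.sub
        (hB t (hx.trans_le ht.1)).continuousAt).continuousWithinAt
    · exact fun t ht => ((hB t (hx.trans_le ht.1)).const_sub _).hasDerivWithinAt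
    · exact fun t ht => hb t (hx.trans_le ht.1)
  have hc : CauchySeq f := by
    rw [Metric.cauchySeq_iff']
    intro ε hε
    obtain ⟨M, hM⟩ := eventually_atTop.1 ((Metric.tendsto_nhds.1 hB0 (ε / 2) (by linarith)).and
      (eventually_gt_atTop x₀))
    refine ⟨M, fun n hn => ?_⟩
    have h1 := (hM M le_rfl).1
    have h2 := (hM n hn).1
    rw [Real.dist_0_eq_abs, abs_lt] at h1 h2
    rw [dist_eq_norm]
    linarith [key M (hM M le_rfl).2 n hn]
  obtain ⟨L, hL⟩ := cauchySeq_tendsto_of_complete hc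
  refine ⟨L, hL, fun x hx => ?_⟩
  have h1 : Tendsto (fun y => ‖f y - f x‖) atTop (𝓝 ‖L - f x‖) := (hL.sub_const _).norm
  have h2 : Tendsto (fun y => B x - B y) atTop (𝓝 (B x - 0)) := hB0.const_sub _
  rw [sub_zero] at h2
  rw [norm_sub_rev]
  refine le_of_tendsto_of_tendsto h1 h2 ?_
  filter_upwards [eventually_ge_atTop x] with y hy using key x hx y hy

theorem exists_tendsto_of_deriv_isBigO [CompleteSpace E] {f f' : ℝ → E} {x₀ C : ℝ} {n : ℕ}
    (hn : 0 < n) (hx₀ : 0 ≤ x₀) (hf : ∀ x > x₀, HasDerivAt f (f' x) x)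
    (hb : ∀ x > x₀, ‖f' x‖ ≤ C / x ^ (n + 1)) :
    ∃ L, Tendsto f atTop (𝓝 L) ∧ ∀ x > x₀, ‖f x - L‖ ≤ C / n / x ^ n := by
  have hn' : (n : ℝ) ≠ 0 := by positivity
  refine exists_tendsto_of_norm_deriv_le (B' := fun x => -(C / x ^ (n + 1))) hf
    (fun x hx => ?_) (fun x hx => by simpa using hb x hx) ?_
  · have hx : x ≠ 0 := (hx₀.trans_lt hx).ne'
    have h := ((hasDerivAt_pow n x).inv (pow_ne_zero n hx)).const_mul (C / n)
    refine (h.congr_of_eventuallyEq (Eventually.of_forall fun y => ?_)).congr_deriv ?_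
    · simp [div_eq_mul_inv]
    · obtain ⟨m, rfl⟩ : ∃ m, n = m + 1 := ⟨n - 1, by omega⟩
      simp only [Nat.add_sub_cancel]
      field_simp
      ring
  · exact tendsto_const_nhds.div_atTop (tendsto_pow_atTop hn.ne')

end Limits

/-! ### Global solvability of linear differential equations -/

section LinearODE

variable {E : Type*} [NormedAddCommGroup E] [NormedSpace ℝ E]

/-- Continuous linear differential equations are globally solvable. -/
theorem exists_linear_ode [CompleteSpace E] {N : ℝ → E →L[ℝ] E} (hN : Continuous N) (v : E) :
    ∃ c : ℝ → E, c 0 = v ∧ ∀ t, HasDerivAt c (N t (c t)) t := by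
  -- With the weight `w = cosh φ`, the integral of `‖N‖ w` from `0` to `t` is `sinh φ / 2`, of
  -- modulus at most `w / 2` on both sides of `0`. In terms of `b = c / w` the Picard operator is
  -- therefore a contraction by `1/2` on the whole line.
  set φ : ℝ → ℝ := fun t => ∫ x in (0 : ℝ)..t, 2 * ‖N x‖ with hφ
  have hνc : Continuous fun x => 2 * ‖N x‖ := by fun_prop
  have hφd : ∀ t, HasDerivAt φ (2 * ‖N t‖) t := fun t =>
    intervalIntegral.integral_hasDerivAt_right (hνc.intervalIntegrable _ _)
      (hνc.stronglyMeasurableAtFilter _ _) hνc.continuousAt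
  have hφ0 : φ 0 = 0 := by simp [hφ]
  have hφc : Continuous φ := continuous_iff_continuousAt.2 fun t => (hφd t).continuousAt
  set w : ℝ → ℝ := fun t => Real.cosh (φ t) with hw
  have hw1 : ∀ t, 1 ≤ w t := fun t => Real.one_le_cosh _
  have hw0 : ∀ t, 0 < w t := fun t => Real.cosh_pos _
  have hwc : Continuous w := Real.continuous_cosh.comp hφc
  have hint : ∀ t, ∫ x in (0 : ℝ)..t, ‖N x‖ * w x = 1 / 2 * Real.sinh (φ t) := fun t => by
    rw [intervalIntegral.integral_eq_sub_of_hasDerivAt (f := fun t => 1 / 2 * Real.sinh (φ t))]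
    · simp [hφ0]
    · exact fun x _ => ((hφd x).sinh.const_mul (1 / 2)).congr_deriv (by simp only [hw]; ring)
    · exact ((hN.norm.mul hwc).intervalIntegrable _ _)
  have hcont : ∀ b : ℝ →ᵇ E, Continuous fun x => N x (w x • b x) := fun b =>
    hN.clm_apply (hwc.smul b.continuous)
  have hest : ∀ (b : ℝ →ᵇ E) (t : ℝ),
      ‖(w t)⁻¹ • ∫ x in (0 : ℝ)..t, N x (w x • b x)‖ ≤ 1 / 2 * ‖b‖ := fun b t => by
    have h1 : ‖∫ x in (0 : ℝ)..t, N x (w x • b x)‖ ≤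
        |∫ x in (0 : ℝ)..t, ‖N x‖ * w x * ‖b‖| := by
      refine intervalIntegral.norm_integral_le_abs_of_norm_le (ae_of_all _ fun x => ?_)
        (((hN.norm.mul hwc).mul continuous_const).intervalIntegrable _ _)
      rw [mul_assoc]
      refine (N x).le_of_opNorm_le_of_le le_rfl ?_
      rw [norm_smul, Real.norm_of_nonneg (hw0 x).le]
      exact mul_le_mul_of_nonneg_left (b.norm_coe_le_norm x) (hw0 x).le
    rw [intervalIntegral.integral_mul_const, hint, abs_mul, abs_mul, abs_norm] at h1
    have h2 : |Real.sinh (φ t)| ≤ w t := by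
      rw [Real.abs_sinh, hw]
      simp only
      rw [← Real.cosh_abs]
      exact (Real.sinh_lt_cosh _).le
    rw [norm_smul, norm_inv, Real.norm_of_nonneg (hw0 t).le, inv_mul_le_iff₀ (hw0 t)]
    refine h1.trans ?_
    rw [abs_of_pos (by norm_num : (0 : ℝ) < 1 / 2)]
    nlinarith [norm_nonneg b]
  let T : (ℝ →ᵇ E) →L[ℝ] (ℝ →ᵇ E) := LinearMap.mkContinuous
    { toFun := fun b => BoundedContinuousFunction.ofNormedAddCommGroup
        (fun t => (w t)⁻¹ • ∫ x in (0 : ℝ)..t, N x (w x • b x))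
        ((hwc.inv₀ fun t => (hw0 t).ne').smul
          (intervalIntegral.continuous_primitive (fun a b' => (hcont b).intervalIntegrable a b') 0))
        (1 / 2 * ‖b‖) (hest b)
      map_add' := fun b d => by
        ext t
        simp only [BoundedContinuousFunction.coe_add, Pi.add_apply, smul_add, map_add,
          BoundedContinuousFunction.coe_ofNormedAddCommGroup]
        rw [← smul_add, intervalIntegral.integral_add ((hcont b).intervalIntegrable _ _)
          ((hcont d).intervalIntegrable _ _)]
      map_smul' := fun x b => by
        ext t
        simp only [BoundedContinuousFunction.coe_smul, RingHom.id_apply,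
          BoundedContinuousFunction.coe_ofNormedAddCommGroup]
        have : ∀ y, N y (w y • (x • b) y) = x • N y (w y • b y) := fun y => by
          rw [BoundedContinuousFunction.coe_smul, smul_comm, map_smul]
        simp only [BoundedContinuousFunction.coe_smul] at this
        simp only [this, intervalIntegral.integral_smul]
        rw [smul_comm] }
    (1 / 2) fun b => (BoundedContinuousFunction.norm_le (by positivity)).2 (hest b)
  have hT : ‖T‖ < 1 := (LinearMap.mkContinuous_norm_le _ (by norm_num) _).trans_lt (by norm_num)
  have hu : IsUnit (1 - T) := isUnit_one_sub_of_norm_lt_one hT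
  let b₀ : ℝ →ᵇ E := BoundedContinuousFunction.ofNormedAddCommGroup (fun t => (w t)⁻¹ • v)
    ((hwc.inv₀ fun t => (hw0 t).ne').smul continuous_const) ‖v‖ fun t => by
      rw [norm_smul, norm_inv, Real.norm_of_nonneg (hw0 t).le]
      exact mul_le_of_le_one_left (norm_nonneg _) (inv_le_one_of_one_le₀ (hw1 t))
  set b : ℝ →ᵇ E := Ring.inverse (1 - T) b₀ with hb
  have hbe : b - T b = b₀ := by
    have := congrArg (fun A : (ℝ →ᵇ E) →L[ℝ] (ℝ →ᵇ E) => A b₀) (Ring.mul_inverse_cancel _ hu)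
    simpa [mul_apply_eq_comp] using this
  have hbt : ∀ t, w t • b t = v + ∫ x in (0 : ℝ)..t, N x (w x • b x) := fun t => by
    have h1 : b t - (w t)⁻¹ • ∫ x in (0 : ℝ)..t, N x (w x • b x) = (w t)⁻¹ • v :=
      congrArg (fun c : ℝ →ᵇ E => c t) hbe
    rw [sub_eq_iff_eq_add, ← smul_add] at h1
    rw [h1, smul_inv_smul₀ (hw0 t).ne']
  refine ⟨fun t => w t • b t, by simp [hbt 0], fun t => ?_⟩
  have h2 := (intervalIntegral.integral_hasDerivAt_right ((hcont b).intervalIntegrable 0 t)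
      ((hcont b).stronglyMeasurableAtFilter _ _) (hcont b).continuousAt).const_add v
  exact h2.congr_of_eventuallyEq (Eventually.of_forall hbt)

end LinearODE

/-! ### Solutions of the Schrödinger equation: existence, uniqueness, Wronskians -/

section Solutions

variable {E : Type*} [NormedAddCommGroup E] [NormedSpace ℝ E] {V : ℝ → ℝ} {lam : ℝ}

theorem IsSolution.hasDerivAt {f : ℝ → E} (hf : IsSolution V lam f) (ξ : ℝ) :
    HasDerivAt f (deriv f ξ) ξ :=
  (hf.1.differentiable (by norm_num) ξ).hasDerivAt

theorem IsSolution.hasDerivAt_deriv {f : ℝ → E} (hf : IsSolution V lam f) (ξ : ℝ) :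
    HasDerivAt (deriv f) ((V ξ - lam ^ 2) • f ξ) ξ := by
  have h1 : ContDiff ℝ 1 (deriv f) := by
    have : ContDiff ℝ (1 + 1) f := by simpa [one_add_one_eq_two] using hf.1
    exact (contDiff_succ_iff_deriv.1 this).2.2
  have h2 := (h1.differentiable (by norm_num) ξ).hasDerivAt
  have h3 := hf.2 ξ
  have : deriv (deriv f) ξ = (V ξ - lam ^ 2) • f ξ := by
    rw [sub_smul, ← h3]; abel
  rwa [this] at h2

theorem isSolution_of_hasDerivAt {f g : ℝ → E} (hV : Continuous V)
    (hf : ∀ ξ, HasDerivAt f (g ξ) ξ) (hg : ∀ ξ, HasDerivAt g ((V ξ - lam ^ 2) • f ξ) ξ) :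
    IsSolution V lam f := by
  have e1 : deriv f = g := funext fun ξ => (hf ξ).deriv
  have e2 : deriv g = fun ξ => (V ξ - lam ^ 2) • f ξ := funext fun ξ => (hg ξ).deriv
  have hfc : Continuous f := continuous_iff_continuousAt.2 fun ξ => (hf ξ).continuousAt
  refine ⟨?_, fun ξ => ?_⟩
  · have h1 : ContDiff ℝ 1 g := contDiff_one_iff_deriv.2
      ⟨fun ξ => (hg ξ).differentiableAt, by rw [e2]; fun_prop⟩
    have : ContDiff ℝ (1 + 1) f := contDiff_succ_iff_deriv.2
      ⟨fun ξ => (hf ξ).differentiableAt, by simp, by rwa [e1]⟩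
    simpa [one_add_one_eq_two] using this
  · rw [e1, e2]
    simp only [sub_smul]; abel

theorem exists_isSolution [CompleteSpace E] (hV : Continuous V) (lam : ℝ) (x y : E) :
    ∃ f : ℝ → E, IsSolution V lam f ∧ f 0 = x ∧ deriv f 0 = y := by
  let N : ℝ → (E × E) →L[ℝ] (E × E) := fun t =>
    (ContinuousLinearMap.inl ℝ E E).comp (ContinuousLinearMap.snd ℝ E E) +
      (V t - lam ^ 2) • (ContinuousLinearMap.inr ℝ E E).comp (ContinuousLinearMap.fst ℝ E E)
  have hN : Continuous N := by
    have : Continuous fun t => V t - lam ^ 2 := by fun_prop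
    exact continuous_const.add (this.smul continuous_const)
  obtain ⟨c, hc0, hc⟩ := exists_linear_ode hN (x, y)
  have h1 : ∀ t, HasDerivAt (fun t => (c t).1) (c t).2 t := fun t => by
    have := (ContinuousLinearMap.fst ℝ E E).hasFDerivAt.comp_hasDerivAt t (hc t)
    simpa [N, Function.comp_def] using this
  have h2 : ∀ t, HasDerivAt (fun t => (c t).2) ((V t - lam ^ 2) • (c t).1) t := fun t => by
    have := (ContinuousLinearMap.snd ℝ E E).hasFDerivAt.comp_hasDerivAt t (hc t)
    simpa [N, Function.comp_def] using this
  exact ⟨fun t => (c t).1, isSolution_of_hasDerivAt hV h1 h2, by simp [hc0],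
    by rw [(h1 0).deriv, hc0]⟩

theorem IsSolution.smul_add_smul {𝕜 : Type*} [NormedField 𝕜] [NormedAlgebra ℝ 𝕜]
    [NormedSpace 𝕜 E] [IsScalarTower ℝ 𝕜 E] {f g : ℝ → E} (hf : IsSolution V lam f)
    (hg : IsSolution V lam g) (a b : 𝕜) : IsSolution V lam fun ξ => a • f ξ + b • g ξ := by
  have e1 : deriv (fun ξ => a • f ξ + b • g ξ) = fun ξ => a • deriv f ξ + b • deriv g ξ :=
    funext fun ξ => (((hf.hasDerivAt ξ).const_smul a).add ((hg.hasDerivAt ξ).const_smul b)).deriv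
  have e2 : ∀ ξ, deriv (fun ξ => a • deriv f ξ + b • deriv g ξ) ξ =
      a • (V ξ - lam ^ 2) • f ξ + b • (V ξ - lam ^ 2) • g ξ := fun ξ =>
    (((hf.hasDerivAt_deriv ξ).const_smul a).add ((hg.hasDerivAt_deriv ξ).const_smul b)).deriv
  refine ⟨(hf.1.const_smul a).add (hg.1.const_smul b), fun ξ => ?_⟩
  rw [e1, e2]
  have sc : ∀ (a : 𝕜) (x : ℝ) (e : E), a • x • e = x • a • e := fun a x e => by
    rw [← algebraMap_smul 𝕜 x e, ← algebraMap_smul 𝕜 x (a • e), smul_smul, smul_smul, mul_comm]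
  rw [sc a (V ξ - lam ^ 2), sc b (V ξ - lam ^ 2)]
  simp only [smul_add, sub_smul]
  abel

theorem IsSolution.ofReal {f : ℝ → ℝ} (hf : IsSolution V lam f) :
    IsSolution V lam fun ξ => (f ξ : ℂ) := by
  have e1 : deriv (fun ξ => (f ξ : ℂ)) = fun ξ => ((deriv f ξ : ℝ) : ℂ) :=
    funext fun ξ => (hf.hasDerivAt ξ).ofReal_comp.deriv
  have e2 : ∀ ξ, deriv (fun ξ => ((deriv f ξ : ℝ) : ℂ)) ξ = (((V ξ - lam ^ 2) • f ξ : ℝ) : ℂ) :=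
    fun ξ => (hf.hasDerivAt_deriv ξ).ofReal_comp.deriv
  refine ⟨Complex.ofRealCLM.contDiff.comp hf.1, fun ξ => ?_⟩
  rw [e1, e2]
  simp only [smul_eq_mul, Complex.real_smul]
  push_cast
  ring

theorem IsSolution.wronskian_eq {f g : ℝ → ℂ} (hf : IsSolution V lam f) (hg : IsSolution V lam g)
    (ξ : ℝ) : wronskian f g ξ = wronskian f g 0 := by
  refine is_const_of_deriv_eq_zero (f := wronskian f g) (fun ξ => ?_) (fun ξ => ?_) ξ 0
  · exact (((hf.hasDerivAt ξ).mul (hg.hasDerivAt_deriv ξ)).sub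
      ((hf.hasDerivAt_deriv ξ).mul (hg.hasDerivAt ξ))).differentiableAt
  · refine ((((hf.hasDerivAt ξ).mul (hg.hasDerivAt_deriv ξ)).sub
      ((hf.hasDerivAt_deriv ξ).mul (hg.hasDerivAt ξ))).deriv).trans ?_
    simp only [Complex.real_smul]
    ring

/-- Solutions with the same Cauchy data at `0` agree. -/
theorem IsSolution.eq_of_cauchy {f g : ℝ → E} (hV : Continuous V) (hf : IsSolution V lam f)
    (hg : IsSolution V lam g) (h0 : f 0 = g 0) (h1 : deriv f 0 = deriv g 0) : f = g := by
  have hd : IsSolution V lam fun ξ => (1 : ℝ) • f ξ + (-1 : ℝ) • g ξ := hf.smul_add_smul hg 1 (-1)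
  obtain ⟨u, hu, hu0, hu1⟩ := exists_isSolution (E := ℝ) hV lam 1 0
  obtain ⟨v, hv, hv0, hv1⟩ := exists_isSolution (E := ℝ) hV lam 0 1
  set d := fun ξ => (1 : ℝ) • f ξ + (-1 : ℝ) • g ξ with hd_def
  have hd0 : d 0 = 0 := by simp [hd_def, h0]
  have hd1 : deriv d 0 = 0 := by
    have := (((hf.hasDerivAt 0).const_smul (1 : ℝ)).add
      ((hg.hasDerivAt 0).const_smul (-1 : ℝ))).deriv
    rw [hd_def]
    refine this.trans ?_
    simp [h1]
  -- The Wronskian of the difference `d` with any scalar solution is constant and zero at `0`. Using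
  -- two scalar solutions whose Wronskian is `1`, Cramer's rule forces `d = 0`.
  have key : ∀ y : ℝ → ℝ, IsSolution V lam y → ∀ ξ, deriv y ξ • d ξ - y ξ • deriv d ξ = 0 := by
    intro y hy ξ
    have hD : ∀ ξ, HasDerivAt (fun ξ => deriv y ξ • d ξ - y ξ • deriv d ξ) 0 ξ := fun ξ => by
      refine (((hy.hasDerivAt_deriv ξ).smul (hd.hasDerivAt ξ)).sub
        ((hy.hasDerivAt ξ).smul (hd.hasDerivAt_deriv ξ))).congr_deriv ?_
      simp only [smul_smul, smul_eq_mul, mul_comm]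
      abel
    have := is_const_of_deriv_eq_zero (fun ξ => (hD ξ).differentiableAt) (fun ξ => (hD ξ).deriv) ξ 0
    simpa [hd0, hd1] using this
  have hW : ∀ ξ, u ξ * deriv v ξ - deriv u ξ * v ξ = 1 := fun ξ => by
    have := hu.ofReal.wronskian_eq hv.ofReal ξ
    simp only [wronskian, (hu.hasDerivAt _).ofReal_comp.deriv,
      (hv.hasDerivAt _).ofReal_comp.deriv, hu0, hu1, hv0, hv1] at this
    have h' : ((u ξ * deriv v ξ - deriv u ξ * v ξ : ℝ) : ℂ) = ((1 : ℝ) : ℂ) := by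
      push_cast
      rw [this]
      simp
    exact_mod_cast h'
  ext1 ξ
  have k1 := key u hu ξ
  have k2 := key v hv ξ
  have : d ξ = u ξ • (deriv v ξ • d ξ - v ξ • deriv d ξ) -
      v ξ • (deriv u ξ • d ξ - u ξ • deriv d ξ) := by
    conv_lhs => rw [← one_smul ℝ (d ξ), ← hW ξ]
    simp only [smul_sub, sub_smul, smul_smul, mul_comm (v ξ)]
    abel
  rw [k1, k2, smul_zero, smul_zero, sub_zero] at this
  simpa [hd_def, ← sub_eq_add_neg, sub_eq_zero] using this

end Solutions

/-! ### The Hankel function of order zero as a Laplace integral -/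

section Hankel

/-- The principal square root of `1 + iτ/2`. -/
def hankelRoot (τ : ℝ) : ℂ := (1 + Complex.I * τ / 2) ^ (2⁻¹ : ℂ)

theorem hankelRoot_sq (τ : ℝ) : hankelRoot τ ^ 2 = 1 + Complex.I * τ / 2 := by
  simp [hankelRoot]

theorem one_le_re_hankelRoot (τ : ℝ) : 1 ≤ (hankelRoot τ).re := by
  have h1 : (1 + Complex.I * τ / 2 : ℂ).re = 1 := by simp
  have h2 := Complex.re_le_norm (1 + Complex.I * τ / 2)
  rw [h1] at h2
  rw [hankelRoot, Complex.cpow_inv_two_re, Real.one_le_sqrt, h1]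
  linarith

theorem im_hankelRoot_nonneg {τ : ℝ} (h : 0 ≤ τ) : 0 ≤ (hankelRoot τ).im := by
  rw [hankelRoot, Complex.cpow_inv_two_im_eq_sqrt (by simpa using by linarith)]
  exact Real.sqrt_nonneg _

theorem one_le_norm_hankelRoot (τ : ℝ) : 1 ≤ ‖hankelRoot τ‖ :=
  (one_le_re_hankelRoot τ).trans (Complex.re_le_norm _)

theorem hankelRoot_ne_zero (τ : ℝ) : hankelRoot τ ≠ 0 :=
  norm_pos_iff.1 (one_pos.trans_le (one_le_norm_hankelRoot τ))

theorem le_norm_hankelRoot_sq (τ : ℝ) : τ / 2 ≤ ‖hankelRoot τ‖ ^ 2 := by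
  rw [← norm_pow, hankelRoot_sq]
  refine le_trans ?_ (Complex.abs_im_le_norm _)
  simpa using le_abs_self (τ / 2)

theorem norm_hankelRoot_sq_le {τ : ℝ} (h : 0 ≤ τ) : ‖hankelRoot τ‖ ^ 2 ≤ 1 + τ := by
  rw [← norm_pow, hankelRoot_sq]
  refine (norm_add_le _ _).trans ?_
  simp only [norm_one, Complex.norm_div, Complex.norm_mul, Complex.norm_I, one_mul,
    Complex.norm_real, Real.norm_of_nonneg h, Complex.norm_ofNat]
  linarith

theorem sqrt_le_norm_hankelRoot (τ : ℝ) : √τ ≤ √2 * ‖hankelRoot τ‖ := by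
  rw [Real.sqrt_le_left (by positivity), mul_pow, Real.sq_sqrt (by norm_num)]
  linarith [le_norm_hankelRoot_sq τ]

theorem hasDerivAt_hankelRoot (τ : ℝ) :
    HasDerivAt hankelRoot (Complex.I / 4 / hankelRoot τ) τ := by
  have h0 : (1 + Complex.I * τ / 2 : ℂ) ∈ Complex.slitPlane := by
    rw [Complex.mem_slitPlane_iff]; left; simp
  have h1 : HasDerivAt (fun z : ℂ => 1 + Complex.I * z / 2) (Complex.I / 2) (τ : ℂ) := by
    simpa using (((hasDerivAt_id (τ : ℂ)).const_mul Complex.I).div_const 2).const_add 1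
  have h2 := (h1.cpow_const (c := 2⁻¹) h0).comp_ofReal
  refine h2.congr_deriv ?_
  have h3 : (1 + Complex.I * τ / 2 : ℂ) ^ ((2 : ℂ)⁻¹ - 1) = (hankelRoot τ)⁻¹ := by
    rw [hankelRoot, ← Complex.cpow_neg]
    norm_num
  rw [h3]
  ring

theorem continuous_hankelRoot : Continuous hankelRoot :=
  continuous_iff_continuousAt.2 fun τ => (hasDerivAt_hankelRoot τ).continuousAt

theorem norm_hankelRoot_inv_le (τ : ℝ) : ‖(hankelRoot τ)⁻¹‖ ≤ 1 := by
  rw [norm_inv]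
  exact inv_le_one_of_one_le₀ (one_le_norm_hankelRoot τ)

theorem norm_hankelRoot_inv_sub_one_le {τ : ℝ} (h : 0 ≤ τ) :
    ‖(hankelRoot τ)⁻¹ - 1‖ ≤ τ / 2 := by
  have h0 := hankelRoot_ne_zero τ
  have h1 : ((hankelRoot τ)⁻¹ - 1) * (hankelRoot τ * (hankelRoot τ + 1)) =
      -(Complex.I * τ / 2) := by
    have := hankelRoot_sq τ
    field_simp
    linear_combination -2 * this
  have h2 : 1 ≤ ‖hankelRoot τ * (hankelRoot τ + 1)‖ := by
    rw [norm_mul]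
    have h3 : 1 ≤ ‖hankelRoot τ + 1‖ := by
      refine le_trans ?_ (Complex.re_le_norm _)
      simp only [Complex.add_re, Complex.one_re]
      linarith [one_le_re_hankelRoot τ]
    exact one_le_mul_of_one_le_of_one_le (one_le_norm_hankelRoot τ) h3
  have h3 := congrArg norm h1
  rw [norm_mul, norm_neg] at h3
  have h4 : ‖Complex.I * τ / 2‖ = τ / 2 := by simp [abs_of_nonneg h]
  rw [h4] at h3
  rw [← h3]
  exact le_mul_of_one_le_right (norm_nonneg _) h2

/-- The limit of `√τ / hankelRoot τ` is `1 - i`, the inverse square root of `i / 2`. -/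
theorem norm_sqrt_div_hankelRoot_sub_le {τ : ℝ} (h : 0 < τ) :
    ‖√τ / hankelRoot τ - (1 - Complex.I)‖ ≤ 2 / √τ := by
  have h0 := hankelRoot_ne_zero τ
  have hs : 0 < √τ := Real.sqrt_pos.2 h
  set A := hankelRoot τ with hA
  have h1 : (A - (1 + Complex.I) / 2 * √τ) * (A + (1 + Complex.I) / 2 * √τ) = 1 := by
    have e1 := hankelRoot_sq τ
    have e2 : (√τ : ℂ) ^ 2 = τ := by exact_mod_cast Real.sq_sqrt h.le
    have e3 := Complex.I_sq
    linear_combination e1 - (1 + 2 * Complex.I + Complex.I ^ 2) / 4 * e2 - τ / 4 * e3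
  have h2 : ‖A - (1 + Complex.I) / 2 * √τ‖ ≤ ‖A + (1 + Complex.I) / 2 * √τ‖ := by
    have hre := one_le_re_hankelRoot τ
    have him := im_hankelRoot_nonneg h.le
    rw [← hA] at hre him
    rw [Complex.norm_def, Complex.norm_def]
    refine Real.sqrt_le_sqrt ?_
    simp only [Complex.normSq_apply, Complex.sub_re, Complex.sub_im, Complex.add_re,
      Complex.add_im, Complex.mul_re, Complex.mul_im, Complex.ofReal_re, Complex.ofReal_im,
      Complex.div_ofNat_re, Complex.div_ofNat_im, Complex.one_re, Complex.one_im, Complex.I_re,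
      Complex.I_im]
    nlinarith [mul_nonneg hs.le him, mul_nonneg hs.le (zero_le_one.trans hre)]
  have h3 : ‖A - (1 + Complex.I) / 2 * √τ‖ ≤ 1 := by
    have h4 := congrArg norm h1
    rw [norm_mul, norm_one] at h4
    nlinarith [norm_nonneg (A - (1 + Complex.I) / 2 * √τ)]
  have h4 : √τ / A - (1 - Complex.I) =
      -((1 - Complex.I) * (A - (1 + Complex.I) / 2 * √τ) / A) := by
    field_simp
    linear_combination (√τ : ℂ) * Complex.I_sq
  have h5 : ‖1 - Complex.I‖ = √2 := by
    rw [Complex.norm_def, Complex.normSq_apply]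
    norm_num
  rw [h4, norm_neg, norm_div, norm_mul, h5, div_le_div_iff₀ (norm_pos_iff.2 h0) hs]
  have h6 := sqrt_le_norm_hankelRoot τ
  have h7 : √2 * √2 = 2 := Real.mul_self_sqrt (by norm_num)
  calc _ ≤ √2 * 1 * (√2 * ‖A‖) := by gcongr
    _ = 2 * ‖A‖ := by linear_combination ‖A‖ * h7

/-! Laplace integrals -/

theorem integrableOn_gamma_kernel {a s : ℝ} (ha : 0 < a) (hs : 0 < s) :
    IntegrableOn (fun τ : ℝ => τ ^ (a - 1) * Real.exp (-(s * τ))) (Ioi 0) := by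
  have := integrableOn_rpow_mul_exp_neg_mul_rpow (p := 1) (s := a - 1) (b := s) (by linarith)
    one_pos hs
  simpa using this

/-- The integrand of the `n`-th derivative of the Hankel function. -/
def hankelKernel (n : ℕ) (s τ : ℝ) : ℂ :=
  (Complex.I - τ) ^ n * Complex.exp (s * (Complex.I - τ)) * ((√τ : ℂ) * hankelRoot τ)⁻¹

/-- The `n`-th derivative of the Hankel function of order zero, normalised to be asymptotic to
`s^{-1/2} e^{is}` at infinity. -/
def hankel (n : ℕ) (s : ℝ) : ℂ := (√Real.pi : ℂ)⁻¹ * ∫ τ in Ioi (0 : ℝ), hankelKernel n s τ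

theorem norm_exp_kernel (s τ : ℝ) :
    ‖Complex.exp (s * (Complex.I - τ))‖ = Real.exp (-(s * τ)) := by
  rw [Complex.norm_exp]
  simp

theorem measurable_hankelKernel (n : ℕ) (s : ℝ) : Measurable (hankelKernel n s) := by
  have h1 : Measurable fun τ : ℝ => (√τ : ℂ) :=
    (Complex.continuous_ofReal.comp Real.continuous_sqrt).measurable
  have h2 := continuous_hankelRoot.measurable
  have h3 : Measurable fun τ : ℝ =>
      (Complex.I - τ) ^ n * Complex.exp (s * (Complex.I - τ)) := by
    apply Continuous.measurable
    fun_prop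
  exact h3.mul (h1.mul h2).inv

theorem inv_sqrt_eq_rpow {τ : ℝ} (h : 0 < τ) : (√τ)⁻¹ = τ ^ ((1 / 2 : ℝ) - 1) := by
  rw [Real.sqrt_eq_rpow, ← Real.rpow_neg h.le]
  norm_num

theorem norm_root_inv_le {τ : ℝ} (h : 0 < τ) :
    ‖((√τ : ℂ) * hankelRoot τ)⁻¹‖ ≤ τ ^ ((1 / 2 : ℝ) - 1) := by
  rw [mul_inv, norm_mul, ← inv_sqrt_eq_rpow h]
  have : ‖((√τ : ℝ) : ℂ)⁻¹‖ = (√τ)⁻¹ := by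
    rw [norm_inv, Complex.norm_real, Real.norm_of_nonneg (Real.sqrt_nonneg _)]
  rw [this]
  exact mul_le_of_le_one_right (by positivity) (norm_hankelRoot_inv_le τ)

theorem norm_hankelKernel_le (n : ℕ) {s τ : ℝ} (h : 0 < τ) :
    ‖hankelKernel n s τ‖ ≤ (1 + τ) ^ n * (τ ^ ((1 / 2 : ℝ) - 1) * Real.exp (-(s * τ))) := by
  rw [hankelKernel, norm_mul, norm_mul, norm_pow, norm_exp_kernel, mul_assoc,
    mul_comm (Real.exp _)]
  have h1 : ‖Complex.I - τ‖ ≤ 1 + τ := by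
    refine (norm_sub_le _ _).trans ?_
    simp [abs_of_pos h]
  gcongr
  exact norm_root_inv_le h

theorem integrableOn_kernel_bound (n : ℕ) {s : ℝ} (hs : 0 < s) :
    IntegrableOn (fun τ : ℝ => (1 + τ) ^ n * (τ ^ ((1 / 2 : ℝ) - 1) * Real.exp (-(s * τ))))
      (Ioi 0) := by
  have h : IntegrableOn (fun τ : ℝ => ∑ m ∈ Finset.range (n + 1), (n.choose m : ℝ) *
      (τ ^ ((m + 1 / 2 : ℝ) - 1) * Real.exp (-(s * τ)))) (Ioi 0) :=
    integrable_finsetSum _ fun m _ =>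
      (integrableOn_gamma_kernel (by positivity) hs).const_mul _
  refine h.congr_fun (fun τ hτ => ?_) measurableSet_Ioi
  have hτ : 0 < τ := hτ
  simp only
  rw [add_comm 1 τ, add_pow, Finset.sum_mul]
  refine Finset.sum_congr rfl fun m _ => ?_
  rw [add_sub_assoc, Real.rpow_add hτ, Real.rpow_natCast]
  ring

theorem integrableOn_hankelKernel (n : ℕ) {s : ℝ} (hs : 0 < s) :
    IntegrableOn (hankelKernel n s) (Ioi 0) := by
  refine (integrableOn_kernel_bound n hs).mono'
    (measurable_hankelKernel n s).aestronglyMeasurable ?_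
  filter_upwards [ae_restrict_mem measurableSet_Ioi] with τ hτ using norm_hankelKernel_le n hτ

theorem hasDerivAt_hankel (n : ℕ) {s : ℝ} (hs : 0 < s) :
    HasDerivAt (hankel n) (hankel (n + 1) s) s := by
  refine HasDerivAt.const_mul _ (hasDerivAt_integral_of_dominated_loc_of_deriv_le
    (F' := fun s τ => hankelKernel (n + 1) s τ)
    (bound := fun τ : ℝ => (1 + τ) ^ (n + 1) *
      (τ ^ ((1 / 2 : ℝ) - 1) * Real.exp (-(s / 2 * τ))))
    (Ioi_mem_nhds (half_lt_self hs)) ?_ (integrableOn_hankelKernel n hs) ?_ ?_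
    (integrableOn_kernel_bound (n + 1) (half_pos hs)) ?_).2
  · exact Eventually.of_forall fun s => (measurable_hankelKernel n s).aestronglyMeasurable
  · exact (measurable_hankelKernel (n + 1) s).aestronglyMeasurable
  · filter_upwards [ae_restrict_mem measurableSet_Ioi] with τ hτ x hx
    have hτ : 0 < τ := hτ
    have hx : s / 2 < x := hx
    refine (norm_hankelKernel_le (n + 1) hτ).trans ?_
    gcongr
  · refine ae_of_all _ fun τ x _ => ?_
    have h1 : HasDerivAt (fun x : ℝ => (x : ℂ) * (Complex.I - τ)) (Complex.I - τ) x := by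
      simpa using (Complex.ofRealCLM.hasDerivAt (x := x)).mul_const (Complex.I - (τ : ℂ))
    refine ((h1.cexp.const_mul ((Complex.I - τ) ^ n)).mul_const
      ((√τ : ℂ) * hankelRoot τ)⁻¹).congr_deriv ?_
    rw [hankelKernel]
    ring

/-- Bessel's operator applied to the kernel is an exact `τ`-derivative because `(i - τ)² + 1 =
-2iτ(1 + iτ/2)` is `-2i` times the square of `√τ · hankelRoot τ`. The primitive vanishes at `τ = 0`
and, for `s > 0`, as `τ → ∞`, which yields the Bessel equation for the integral. -/
theorem hasDerivAt_hankel_primitive (s : ℝ) {τ : ℝ} (h : 0 < τ) :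
    HasDerivAt (fun τ : ℝ => 2 * Complex.I * (Complex.exp (s * (Complex.I - τ)) *
      ((√τ : ℂ) * hankelRoot τ)))
      (s * hankelKernel 2 s τ + hankelKernel 1 s τ + s * hankelKernel 0 s τ) τ := by
  have hs : √τ ≠ 0 := (Real.sqrt_pos.2 h).ne'
  have hs' : (√τ : ℂ) ≠ 0 := by exact_mod_cast hs
  have h1 : HasDerivAt (fun τ : ℝ => (√τ : ℂ)) ((1 / (2 * √τ) : ℝ) : ℂ) τ :=
    (Real.hasDerivAt_sqrt h.ne').ofReal_comp
  have h2 : HasDerivAt (fun τ : ℝ => (s : ℂ) * (Complex.I - τ)) (-s) τ := by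
    simpa using ((Complex.ofRealCLM.hasDerivAt (x := τ)).const_sub Complex.I).const_mul (s : ℂ)
  refine ((h2.cexp.mul (h1.mul (hasDerivAt_hankelRoot τ))).const_mul
    (2 * Complex.I)).congr_deriv ?_
  have h0 := hankelRoot_ne_zero τ
  have e1 := hankelRoot_sq τ
  have e2 : (√τ : ℂ) ^ 2 = τ := by exact_mod_cast Real.sq_sqrt h.le
  have e3 := Complex.I_sq
  have k1 : (1 : ℂ) / (2 * √τ) * hankelRoot τ * (√τ * hankelRoot τ) = hankelRoot τ ^ 2 / 2 := by
    field_simp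
  have k2 : √τ * (Complex.I / 4 / hankelRoot τ) * (√τ * hankelRoot τ) =
      (√τ : ℂ) ^ 2 * (Complex.I / 4) := by
    field_simp
  rw [e1] at k1
  rw [e2] at k2
  have k3 : (s * hankelKernel 2 s τ + hankelKernel 1 s τ + s * hankelKernel 0 s τ) =
      (Complex.exp (s * (Complex.I - τ)) * (s * ((Complex.I - τ) ^ 2 + 1) + (Complex.I - τ))) *
        ((√τ : ℂ) * hankelRoot τ)⁻¹ := by
    simp only [hankelKernel]
    ring
  rw [k3, eq_mul_inv_iff_mul_eq₀ (mul_ne_zero hs' h0)]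
  simp only [Pi.mul_apply]
  push_cast
  linear_combination Complex.exp (s * (Complex.I - τ)) * (2 * Complex.I * k1 + 2 * Complex.I * k2
    - 2 * Complex.I * s * (√τ : ℂ) ^ 2 * e1 - 2 * Complex.I * s * (1 + Complex.I * τ / 2) * e2
    + (τ - s * τ ^ 2 - s) * e3)

theorem hankel_ode {s : ℝ} (hs : 0 < s) :
    s * hankel 2 s + hankel 1 s + s * hankel 0 s = 0 := by
  have hi := fun n => integrableOn_hankelKernel n hs
  have h1 : ∫ τ in Ioi (0 : ℝ),
      (s * hankelKernel 2 s τ + hankelKernel 1 s τ + s * hankelKernel 0 s τ) = 0 := by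
    rw [integral_Ioi_of_hasDerivAt_of_tendsto (m := 0) (f := fun τ : ℝ =>
      2 * Complex.I * (Complex.exp (s * (Complex.I - τ)) * ((√τ : ℂ) * hankelRoot τ)))]
    · simp
    · have h1 : Continuous fun τ : ℝ => (√τ : ℂ) :=
        Complex.continuous_ofReal.comp Real.continuous_sqrt
      have h2 := continuous_hankelRoot
      exact Continuous.continuousWithinAt (by fun_prop)
    · exact fun τ hτ => hasDerivAt_hankel_primitive s hτ
    · exact (((hi 2).const_mul _).add (hi 1)).add ((hi 0).const_mul _)
    · have h3 : Tendsto (fun τ : ℝ => 2 * (Real.exp (-s * τ) + τ * Real.exp (-s * τ))) atTop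
          (𝓝 (2 * (0 + 0))) := by
        have a1 := tendsto_rpow_mul_exp_neg_mul_atTop_nhds_zero 0 s hs
        have a2 := tendsto_rpow_mul_exp_neg_mul_atTop_nhds_zero 1 s hs
        simp only [Real.rpow_zero, one_mul, Real.rpow_one] at a1 a2
        exact (a1.add a2).const_mul 2
      rw [add_zero, mul_zero] at h3
      refine squeeze_zero_norm' ?_ h3
      filter_upwards [eventually_ge_atTop 0] with τ hτ
      rw [norm_mul, norm_mul, norm_mul, norm_exp_kernel, norm_mul, Complex.norm_I,
        Complex.norm_real, Real.norm_of_nonneg (Real.sqrt_nonneg τ), Complex.norm_ofNat, neg_mul]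
      have h4 : √τ * ‖hankelRoot τ‖ ≤ 1 + τ := by
        refine abs_le_of_sq_le_sq' ?_ (by linarith) |>.2
        rw [mul_pow, Real.sq_sqrt hτ]
        nlinarith [norm_hankelRoot_sq_le hτ]
      nlinarith [Real.exp_pos (-(s * τ))]
  have i2 : IntegrableOn (fun τ => s * hankelKernel 2 s τ) (Ioi 0) := (hi 2).const_mul _
  have i0 : IntegrableOn (fun τ => s * hankelKernel 0 s τ) (Ioi 0) := (hi 0).const_mul _
  have i21 : IntegrableOn (fun τ => s * hankelKernel 2 s τ + hankelKernel 1 s τ) (Ioi 0) :=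
    i2.add (hi 1)
  rw [integral_add i21 i0, integral_add i2 (hi 1), integral_const_mul, integral_const_mul] at h1
  simp only [hankel]
  linear_combination (√Real.pi : ℂ)⁻¹ * h1

end Hankel

/-! ### The Hankel function near infinity and near zero -/

section HankelAsymptotics

/-- The logarithmic derivative coefficient at the origin. -/
def hankelBeta : ℂ := (Complex.I - 1) / √Real.pi

theorem sqrt_pi_pos : 0 < √Real.pi := Real.sqrt_pos.2 Real.pi_pos

theorem sqrt_pi_ne_zero : (√Real.pi : ℂ) ≠ 0 := by exact_mod_cast sqrt_pi_pos.ne'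

theorem integral_gamma_half {s : ℝ} (hs : 0 < s) :
    ∫ τ in Ioi (0 : ℝ), τ ^ ((1 / 2 : ℝ) - 1) * Real.exp (-(s * τ)) = √Real.pi / √s := by
  rw [Real.integral_rpow_mul_exp_neg_mul_Ioi (by norm_num) hs, Real.Gamma_one_half_eq,
    ← Real.sqrt_eq_rpow, Real.sqrt_div zero_le_one, Real.sqrt_one]
  ring

theorem integral_gamma_one {s : ℝ} (hs : 0 < s) :
    ∫ τ in Ioi (0 : ℝ), τ ^ ((1 : ℝ) - 1) * Real.exp (-(s * τ)) = 1 / s := by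
  rw [Real.integral_rpow_mul_exp_neg_mul_Ioi (by norm_num) hs]
  simp

theorem integral_gamma_three_half {s : ℝ} (hs : 0 < s) :
    ∫ τ in Ioi (0 : ℝ), τ ^ ((3 / 2 : ℝ) - 1) * Real.exp (-(s * τ)) =
      √Real.pi / (2 * (s * √s)) := by
  have h : (3 / 2 : ℝ) = 1 / 2 + 1 := by norm_num
  rw [Real.integral_rpow_mul_exp_neg_mul_Ioi (by norm_num) hs, h,
    Real.Gamma_add_one (by norm_num), Real.Gamma_one_half_eq, Real.rpow_add (by positivity),
    ← Real.sqrt_eq_rpow, Real.sqrt_div zero_le_one, Real.sqrt_one, Real.rpow_one]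
  field_simp

theorem norm_setIntegral_le_of_le {F : ℝ → ℂ} {b : ℝ → ℝ} (hb : IntegrableOn b (Ioi 0))
    (h : ∀ τ > 0, ‖F τ‖ ≤ b τ) : ‖∫ τ in Ioi (0 : ℝ), F τ‖ ≤ ∫ τ in Ioi (0 : ℝ), b τ := by
  refine norm_integral_le_of_norm_le hb ?_
  filter_upwards [ae_restrict_mem measurableSet_Ioi] with τ hτ using h τ hτ

theorem norm_inv_sqrt_pi_mul {z : ℂ} {x : ℝ} (h : ‖z‖ ≤ √Real.pi * x) :
    ‖(√Real.pi : ℂ)⁻¹ * z‖ ≤ x := by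
  rw [norm_mul, norm_inv, Complex.norm_real, Real.norm_of_nonneg sqrt_pi_pos.le,
    inv_mul_le_iff₀ sqrt_pi_pos]
  exact h

/-- The root in the kernel has modulus at least `1`, so the integral is at most `Γ(1/2)/√s`. That
this holds for all `s > 0`, including small `s`, makes the perturbation argument uniform down to
zero energy. -/
theorem norm_hankel_zero_le {s : ℝ} (hs : 0 < s) : ‖hankel 0 s‖ ≤ 1 / √s := by
  refine norm_inv_sqrt_pi_mul ?_
  refine (norm_setIntegral_le_of_le (integrableOn_gamma_kernel (by norm_num) hs)
    fun τ hτ => ?_).trans_eq ((integral_gamma_half hs).trans (by ring))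
  simpa using norm_hankelKernel_le 0 hτ

/-- The kernel after removing the oscillating factor `e^{is}`. -/
def hankelAmp (s τ : ℝ) : ℂ := Real.exp (-(s * τ)) * ((√τ : ℂ) * hankelRoot τ)⁻¹

theorem hankelKernel_eq (n : ℕ) (s τ : ℝ) :
    hankelKernel n s τ = Complex.exp (Complex.I * s) * ((Complex.I - τ) ^ n * hankelAmp s τ) := by
  rw [hankelKernel, hankelAmp]
  have : Complex.exp (s * (Complex.I - τ)) =
      Complex.exp (Complex.I * s) * (Real.exp (-(s * τ)) : ℂ) := by
    rw [Complex.ofReal_exp, ← Complex.exp_add]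
    push_cast
    ring_nf
  rw [this]
  ring

theorem norm_hankelAmp_le {s τ : ℝ} (h : 0 < τ) :
    ‖hankelAmp s τ‖ ≤ τ ^ ((1 / 2 : ℝ) - 1) * Real.exp (-(s * τ)) := by
  rw [hankelAmp, norm_mul, Complex.norm_real, Real.norm_of_nonneg (Real.exp_pos _).le, mul_comm]
  gcongr
  exact norm_root_inv_le h

theorem measurable_hankelAmp (s : ℝ) : Measurable (hankelAmp s) := by
  have h := measurable_hankelKernel 0 s
  have h2 : hankelAmp s = fun τ => (Complex.exp (Complex.I * s))⁻¹ * hankelKernel 0 s τ := by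
    ext1 τ
    rw [hankelKernel_eq]
    field_simp [Complex.exp_ne_zero]
  rw [h2]
  exact h.const_mul _

theorem integrableOn_hankelAmp {s : ℝ} (hs : 0 < s) : IntegrableOn (hankelAmp s) (Ioi 0) := by
  refine (integrableOn_gamma_kernel (a := 1 / 2) (by norm_num) hs).mono'
    (measurable_hankelAmp s).aestronglyMeasurable ?_
  filter_upwards [ae_restrict_mem measurableSet_Ioi] with τ hτ using norm_hankelAmp_le hτ

theorem mul_rpow_three_half {τ : ℝ} (h : 0 < τ) :
    τ * τ ^ ((1 / 2 : ℝ) - 1) = τ ^ ((3 / 2 : ℝ) - 1) := by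
  rw [← Real.rpow_one_add' h.le (by norm_num)]
  norm_num

theorem norm_mul_hankelAmp_le {s τ : ℝ} (h : 0 < τ) :
    ‖(τ : ℂ) * hankelAmp s τ‖ ≤ τ ^ ((3 / 2 : ℝ) - 1) * Real.exp (-(s * τ)) := by
  rw [norm_mul, Complex.norm_real, Real.norm_of_nonneg h.le, ← mul_rpow_three_half h, mul_assoc]
  gcongr
  exact norm_hankelAmp_le h

theorem mul_hankelAmp_eq {s τ : ℝ} (h : 0 < τ) :
    (τ : ℂ) * hankelAmp s τ = Real.exp (-(s * τ)) * (√τ / hankelRoot τ) := by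
  have h0 := hankelRoot_ne_zero τ
  have hs' : (√τ : ℂ) ≠ 0 := by exact_mod_cast (Real.sqrt_pos.2 h).ne'
  have e2 : (√τ : ℂ) ^ 2 = τ := by exact_mod_cast Real.sq_sqrt h.le
  rw [hankelAmp, ← e2]
  field_simp

theorem integrableOn_mul_hankelAmp {s : ℝ} (hs : 0 < s) :
    IntegrableOn (fun τ : ℝ => (τ : ℂ) * hankelAmp s τ) (Ioi 0) := by
  refine (integrableOn_gamma_kernel (a := 3 / 2) (by norm_num) hs).mono'
    (Complex.measurable_ofReal.mul (measurable_hankelAmp s)).aestronglyMeasurable ?_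
  filter_upwards [ae_restrict_mem measurableSet_Ioi] with τ hτ using norm_mul_hankelAmp_le hτ

theorem hankel_zero_eq (s : ℝ) :
    hankel 0 s = Complex.exp (Complex.I * s) *
      ((√Real.pi : ℂ)⁻¹ * ∫ τ in Ioi (0 : ℝ), hankelAmp s τ) := by
  simp only [hankel, hankelKernel_eq, pow_zero, one_mul, integral_const_mul]
  ring

theorem hankel_one_eq {s : ℝ} (hs : 0 < s) :
    hankel 1 s = Complex.exp (Complex.I * s) * ((√Real.pi : ℂ)⁻¹ *
      (Complex.I * (∫ τ in Ioi (0 : ℝ), hankelAmp s τ) -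
        ∫ τ in Ioi (0 : ℝ), (τ : ℂ) * hankelAmp s τ)) := by
  have i1 : IntegrableOn (fun τ => Complex.I * hankelAmp s τ) (Ioi 0) :=
    (integrableOn_hankelAmp hs).const_mul _
  rw [← integral_const_mul, ← integral_sub i1 (integrableOn_mul_hankelAmp hs)]
  simp only [hankel, hankelKernel_eq, pow_one, integral_const_mul, sub_mul]
  ring

theorem norm_exp_I_mul (s : ℝ) : ‖Complex.exp (Complex.I * s)‖ = 1 := by
  rw [mul_comm, Complex.norm_exp_ofReal_mul_I]

/-- The factor `i - τ` splits the derivative in two. The `τ` part is bounded through `√τ /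
|hankelRoot τ| ≤ √2 ≤ √π`, giving `1/s`; the other part is bounded as for the function itself. -/
theorem norm_mul_hankel_one_le {s : ℝ} (hs : 0 < s) : ‖s * hankel 1 s‖ ≤ √s + 1 := by
  have h1 := norm_setIntegral_le_of_le (integrableOn_gamma_kernel (a := 1 / 2) (by norm_num) hs)
    fun τ hτ => norm_hankelAmp_le hτ
  rw [integral_gamma_half hs] at h1
  have h2 := norm_setIntegral_le_of_le (F := fun τ => (τ : ℂ) * hankelAmp s τ)
    ((integrableOn_gamma_kernel (a := 1) (by norm_num) hs).const_mul (√2))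
    fun τ hτ => by
      have hτ : 0 < τ := hτ
      rw [mul_hankelAmp_eq hτ, norm_mul, Complex.norm_real, Real.norm_of_nonneg (Real.exp_pos _).le,
        norm_div, Complex.norm_real, Real.norm_of_nonneg (Real.sqrt_nonneg _), sub_self,
        Real.rpow_zero, one_mul, mul_comm]
      gcongr
      rw [div_le_iff₀ (norm_pos_iff.2 (hankelRoot_ne_zero τ))]
      exact sqrt_le_norm_hankelRoot τ
  rw [integral_const_mul, integral_gamma_one hs] at h2
  have h3 : √2 ≤ √Real.pi := Real.sqrt_le_sqrt Real.two_le_pi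
  have h5 : ‖hankel 1 s‖ ≤ 1 / √s + 1 / s := by
    rw [hankel_one_eq hs, norm_mul, norm_exp_I_mul, one_mul]
    refine norm_inv_sqrt_pi_mul ((norm_sub_le _ _).trans ?_)
    rw [norm_mul, Complex.norm_I, one_mul]
    calc _ ≤ √Real.pi / √s + √2 * (1 / s) := add_le_add h1 h2
      _ ≤ √Real.pi / √s + √Real.pi * (1 / s) := by gcongr
      _ = _ := by ring
  rw [norm_mul, Complex.norm_real, Real.norm_of_nonneg hs.le]
  calc _ ≤ s * (1 / √s + 1 / s) := by gcongr
    _ = √s + 1 := by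
      rw [mul_add, mul_one_div, mul_one_div, div_self hs.ne', Real.div_sqrt]

/-- For large `s` only small `τ` matters. Replacing the inverse root by `1` leaves the `Γ(1/2)`
integral, and the error `τ/2` is a `Γ(3/2)` integral, smaller by a factor `1/s`. -/
theorem norm_hankel_zero_sub_le {s : ℝ} (hs : 0 < s) :
    ‖√s * (Complex.exp (-(Complex.I * s)) * hankel 0 s) - 1‖ ≤ 1 / (4 * s) := by
  have hs' : 0 < √s := Real.sqrt_pos.2 hs
  have hsc : (√s : ℂ) ≠ 0 := by exact_mod_cast hs'.ne'
  have i0 := (integrableOn_gamma_kernel (a := 1 / 2) (by norm_num) hs)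
  have i1 : IntegrableOn (fun τ : ℝ =>
      ((τ ^ ((1 / 2 : ℝ) - 1) * Real.exp (-(s * τ)) : ℝ) : ℂ)) (Ioi 0) := i0.ofReal
  have e1 : ∫ τ in Ioi (0 : ℝ), ((τ ^ ((1 / 2 : ℝ) - 1) * Real.exp (-(s * τ)) : ℝ) : ℂ) =
      √Real.pi / √s := by
    rw [integral_complex_ofReal, integral_gamma_half hs]
    push_cast
    rfl
  have e2 : √s * (Complex.exp (-(Complex.I * s)) * hankel 0 s) - 1 = √s * ((√Real.pi : ℂ)⁻¹ *
      ∫ τ in Ioi (0 : ℝ), (hankelAmp s τ -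
        ((τ ^ ((1 / 2 : ℝ) - 1) * Real.exp (-(s * τ)) : ℝ) : ℂ))) := by
    rw [integral_sub (integrableOn_hankelAmp hs) i1, e1, hankel_zero_eq,
      ← mul_assoc (Complex.exp _),
      ← Complex.exp_add, neg_add_cancel, Complex.exp_zero, one_mul, mul_sub, mul_sub]
    have := sqrt_pi_ne_zero
    field_simp
  have h1 := norm_setIntegral_le_of_le (F := fun τ => hankelAmp s τ -
      ((τ ^ ((1 / 2 : ℝ) - 1) * Real.exp (-(s * τ)) : ℝ) : ℂ))
    ((integrableOn_gamma_kernel (a := 3 / 2) (by norm_num) hs).const_mul (1 / 2))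
    fun τ hτ => by
      have hτ : 0 < τ := hτ
      have e3 : hankelAmp s τ - ((τ ^ ((1 / 2 : ℝ) - 1) * Real.exp (-(s * τ)) : ℝ) : ℂ) =
          ((τ ^ ((1 / 2 : ℝ) - 1) * Real.exp (-(s * τ)) : ℝ) : ℂ) * ((hankelRoot τ)⁻¹ - 1) := by
        rw [hankelAmp, ← inv_sqrt_eq_rpow hτ, mul_inv]
        push_cast
        ring
      rw [e3, norm_mul, Complex.norm_real, Real.norm_of_nonneg (by positivity),
        ← mul_rpow_three_half hτ]
      calc _ ≤ τ ^ ((1 / 2 : ℝ) - 1) * Real.exp (-(s * τ)) * (τ / 2) := by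
            gcongr
            exact norm_hankelRoot_inv_sub_one_le hτ.le
        _ = _ := by ring
  rw [integral_const_mul, integral_gamma_three_half hs] at h1
  rw [e2, norm_mul, Complex.norm_real, Real.norm_of_nonneg hs'.le]
  have h2 := norm_inv_sqrt_pi_mul (x := 1 / (4 * (s * √s))) (h1.trans_eq (by ring))
  calc _ ≤ √s * (1 / (4 * (s * √s))) := by gcongr
    _ = _ := by field_simp

theorem norm_hankel_one_sub_le {s : ℝ} (hs : 0 < s) :
    ‖√s * (Complex.exp (-(Complex.I * s)) * hankel 1 s) - Complex.I‖ ≤ 1 / s := by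
  have hs' : 0 < √s := Real.sqrt_pos.2 hs
  have h0 := norm_hankel_zero_sub_le hs
  have h1 := norm_setIntegral_le_of_le (F := fun τ => (τ : ℂ) * hankelAmp s τ)
    (integrableOn_gamma_kernel (a := 3 / 2) (by norm_num) hs) fun τ hτ => norm_mul_hankelAmp_le hτ
  rw [integral_gamma_three_half hs] at h1
  have h2 := norm_inv_sqrt_pi_mul (x := 1 / (2 * (s * √s))) (h1.trans_eq (by ring))
  have e : √s * (Complex.exp (-(Complex.I * s)) * hankel 1 s) - Complex.I =
      Complex.I * (√s * (Complex.exp (-(Complex.I * s)) * hankel 0 s) - 1) -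
        √s * ((√Real.pi : ℂ)⁻¹ * ∫ τ in Ioi (0 : ℝ), (τ : ℂ) * hankelAmp s τ) := by
    rw [hankel_one_eq hs, hankel_zero_eq, ← mul_assoc (Complex.exp (-(Complex.I * s))),
      ← mul_assoc (Complex.exp (-(Complex.I * s))), ← Complex.exp_add, neg_add_cancel,
      Complex.exp_zero]
    ring
  rw [e]
  refine (norm_sub_le _ _).trans ?_
  rw [norm_mul, Complex.norm_I, one_mul, norm_mul, Complex.norm_real, Real.norm_of_nonneg hs'.le]
  calc _ ≤ 1 / (4 * s) + √s * (1 / (2 * (s * √s))) := by gcongr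
    _ = 3 / 4 * (1 / s) := by field_simp; norm_num
    _ ≤ 1 / s := by
      have : 0 < 1 / s := by positivity
      linarith

theorem norm_hankelBeta_le : ‖hankelBeta‖ ≤ 1 := by
  rw [hankelBeta, norm_div, Complex.norm_real, Real.norm_of_nonneg sqrt_pi_pos.le,
    div_le_one sqrt_pi_pos, Complex.norm_def]
  refine Real.sqrt_le_sqrt ?_
  simp only [Complex.normSq_apply, Complex.sub_re, Complex.I_re, Complex.one_re, Complex.sub_im,
    Complex.I_im, Complex.one_im]
  linarith [Real.two_le_pi]

/-- For small `s` the integral is governed by large `τ`, where `√τ / hankelRoot τ → 1 - i` and the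
kernel integrates to `(1 - i)/s`. The error `2/√τ` integrates to `O(1/√s)`, which the factor `s`
turns into `O(√s)`. -/
theorem norm_mul_hankel_one_sub_le {s : ℝ} (hs : 0 < s) (hs1 : s ≤ 1) :
    ‖s * hankel 1 s - hankelBeta‖ ≤ 4 * √s := by
  have hs' : 0 < √s := Real.sqrt_pos.2 hs
  have h4 : √s * √s = s := Real.mul_self_sqrt hs.le
  have hle : s ≤ √s := by
    have : √s ≤ 1 := Real.sqrt_le_one.2 hs1
    nlinarith
  have i1 := integrableOn_gamma_kernel (a := 1) one_pos hs
  have i1' : IntegrableOn (fun τ : ℝ => (1 - Complex.I) *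
      ((τ ^ ((1 : ℝ) - 1) * Real.exp (-(s * τ)) : ℝ) : ℂ)) (Ioi 0) := i1.ofReal.const_mul _
  have h1 := norm_setIntegral_le_of_le (integrableOn_gamma_kernel (a := 1 / 2) (by norm_num) hs)
    fun τ hτ => norm_hankelAmp_le hτ
  rw [integral_gamma_half hs] at h1
  have h2 := norm_setIntegral_le_of_le (F := fun τ : ℝ => (τ : ℂ) * hankelAmp s τ -
      (1 - Complex.I) * ((τ ^ ((1 : ℝ) - 1) * Real.exp (-(s * τ)) : ℝ) : ℂ))
    ((integrableOn_gamma_kernel (a := 1 / 2) (by norm_num) hs).const_mul 2)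
    fun τ hτ => by
      have hτ : 0 < τ := hτ
      rw [mul_hankelAmp_eq hτ, sub_self, Real.rpow_zero, one_mul, mul_comm (1 - Complex.I),
        ← mul_sub, norm_mul, Complex.norm_real, Real.norm_of_nonneg (Real.exp_pos _).le,
        ← inv_sqrt_eq_rpow hτ]
      calc _ ≤ Real.exp (-(s * τ)) * (2 / √τ) := by
            gcongr
            exact norm_sqrt_div_hankelRoot_sub_le hτ
        _ = _ := by ring
  rw [integral_const_mul, integral_gamma_half hs,
    integral_sub (integrableOn_mul_hankelAmp hs) i1', integral_const_mul, integral_complex_ofReal,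
    integral_gamma_one hs] at h2
  set J₀ := ∫ τ in Ioi (0 : ℝ), hankelAmp s τ
  set J₁ := ∫ τ in Ioi (0 : ℝ), (τ : ℂ) * hankelAmp s τ
  have e : s * hankel 1 s - hankelBeta = s * (Complex.exp (Complex.I * s) * ((√Real.pi : ℂ)⁻¹ *
      (Complex.I * J₀ - (J₁ - (1 - Complex.I) * ((1 / s : ℝ) : ℂ))))) +
      (Complex.exp (Complex.I * s) - 1) * hankelBeta := by
    have : (s : ℂ) ≠ 0 := by exact_mod_cast hs.ne'
    have := sqrt_pi_ne_zero
    rw [hankel_one_eq hs, hankelBeta]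
    push_cast
    field_simp
    ring
  rw [e]
  refine (norm_add_le _ _).trans ?_
  have h3 : ‖(√Real.pi : ℂ)⁻¹ * (Complex.I * J₀ - (J₁ - (1 - Complex.I) * ((1 / s : ℝ) : ℂ)))‖ ≤
      3 / √s := by
    refine norm_inv_sqrt_pi_mul ((norm_sub_le _ _).trans ?_)
    rw [norm_mul, Complex.norm_I, one_mul]
    calc _ ≤ √Real.pi / √s + 2 * (√Real.pi / √s) := add_le_add h1 h2
      _ = _ := by ring
  have h5 : ‖(Complex.exp (Complex.I * s) - 1) * hankelBeta‖ ≤ s * 1 := by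
    rw [norm_mul]
    gcongr
    · exact Real.norm_exp_I_mul_ofReal_sub_one_le.trans_eq (Real.norm_of_nonneg hs.le)
    · exact norm_hankelBeta_le
  rw [norm_mul, norm_mul, norm_exp_I_mul, one_mul, Complex.norm_real, Real.norm_of_nonneg hs.le]
  calc _ ≤ s * (3 / √s) + s * 1 := by gcongr
    _ = 3 * √s + s := by
      rw [mul_div_left_comm, Real.div_sqrt, mul_one]
    _ ≤ 4 * √s := by linarith

/-- The logarithmic behaviour of the Hankel function at the origin. -/
theorem exists_hankelAlpha : ∃ α : ℂ, ∀ s : ℝ, 0 < s → s < 1 →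
    ‖hankel 0 s - α - hankelBeta * Real.log s‖ ≤ 8 * √s := by
  -- In the variable `t = 1/s` the origin moves to infinity. The derivative there is `O(t^{-3/2})`
  -- by the preceding bound, so the limit exists with error `8/√t`.
  have key : ∃ L, Tendsto (fun t : ℝ => hankel 0 t⁻¹ + hankelBeta * (Real.log t : ℂ)) atTop (𝓝 L) ∧
      ∀ t > 1, ‖hankel 0 t⁻¹ + hankelBeta * (Real.log t : ℂ) - L‖ ≤ 8 * (√t)⁻¹ := by
    refine exists_tendsto_of_norm_deriv_le (x₀ := 1)
      (f' := fun t => hankel 1 t⁻¹ * ((-(t ^ 2)⁻¹ : ℝ) : ℂ) + hankelBeta * ((t⁻¹ : ℝ) : ℂ))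
      (B' := fun t => 8 * (-(1 / (2 * √t)) / √t ^ 2)) ?_ ?_ ?_ ?_
    · intro t ht
      have ht0 : 0 < t := one_pos.trans ht
      have h1 := (hasDerivAt_hankel 0 (inv_pos.2 ht0)).scomp t (hasDerivAt_inv ht0.ne')
      have h2 := ((Real.hasDerivAt_log ht0.ne').ofReal_comp).const_mul hankelBeta
      refine (h1.add h2).congr_deriv ?_
      rw [Complex.real_smul, mul_comm]
    · intro t ht
      have ht0 : 0 < t := one_pos.trans ht
      exact (((Real.hasDerivAt_sqrt ht0.ne').inv (Real.sqrt_pos.2 ht0).ne')).const_mul 8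
    · intro t ht
      have ht0 : 0 < t := one_pos.trans ht
      have h1 := norm_mul_hankel_one_sub_le (inv_pos.2 ht0) (inv_le_one_of_one_le₀ (le_of_lt ht))
      have e : hankel 1 t⁻¹ * ((-(t ^ 2)⁻¹ : ℝ) : ℂ) + hankelBeta * ((t⁻¹ : ℝ) : ℂ) =
          -((t⁻¹ : ℝ) : ℂ) * (((t⁻¹ : ℝ) : ℂ) * hankel 1 t⁻¹ - hankelBeta) := by
        push_cast
        ring
      rw [e, norm_mul, norm_neg, Complex.norm_real, Real.norm_of_nonneg (by positivity)]
      rw [Real.sqrt_inv] at h1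
      have hq : 0 < √t := Real.sqrt_pos.2 ht0
      calc _ ≤ t⁻¹ * (4 * (√t)⁻¹) := by gcongr
        _ = _ := by
          nth_rw 1 [← Real.sq_sqrt ht0.le]
          field_simp
          norm_num
    · have : Tendsto (fun t : ℝ => 8 * (√t)⁻¹) atTop (𝓝 (8 * 0)) :=
        (tendsto_inv_atTop_zero.comp Real.tendsto_sqrt_atTop).const_mul 8
      simpa using this
  obtain ⟨α, -, hα⟩ := key
  refine ⟨α, fun s hs hs1 => ?_⟩
  have := hα s⁻¹ ((one_lt_inv₀ hs).2 hs1)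
  rw [inv_inv, Real.log_inv, Real.sqrt_inv, inv_inv] at this
  have e : hankel 0 s - α - hankelBeta * Real.log s =
      hankel 0 s + hankelBeta * ((-Real.log s : ℝ) : ℂ) - α := by
    push_cast
    ring
  rw [e]
  exact this

theorem hasDerivAt_conj {f : ℝ → ℂ} {f' : ℂ} {s : ℝ} (h : HasDerivAt f f' s) :
    HasDerivAt (fun s => (starRingEnd ℂ) (f s)) ((starRingEnd ℂ) f') s := h.star

theorem hasDerivAt_mul_hankel_one {s : ℝ} (hs : 0 < s) :
    HasDerivAt (fun s : ℝ => (s : ℂ) * hankel 1 s) (-(s * hankel 0 s)) s := by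
  refine ((Complex.ofRealCLM.hasDerivAt (x := s)).mul (hasDerivAt_hankel 1 hs)).congr_deriv ?_
  have := hankel_ode hs
  simp only [Complex.ofRealCLM_apply, Complex.ofReal_one]
  linear_combination this

/-- Constant by Bessel's equation. As `s → ∞`, `√s e^{-is} H → 1` and `√s e^{-is} H' → i`, so the
value is `conj i - i = -2i`. -/
theorem hankel_wronskian {s : ℝ} (hs : 0 < s) :
    hankel 0 s * (starRingEnd ℂ) (s * hankel 1 s) -
      s * hankel 1 s * (starRingEnd ℂ) (hankel 0 s) = -2 * Complex.I := by
  set w : ℝ → ℂ := fun s => hankel 0 s * (starRingEnd ℂ) (s * hankel 1 s) -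
      s * hankel 1 s * (starRingEnd ℂ) (hankel 0 s) with hw
  have hd : ∀ s ∈ Ioi (0 : ℝ), HasDerivAt w 0 s := fun s hs => by
    refine (((hasDerivAt_hankel 0 hs).mul (hasDerivAt_conj (hasDerivAt_mul_hankel_one hs))).sub
      ((hasDerivAt_mul_hankel_one hs).mul (hasDerivAt_conj (hasDerivAt_hankel 0 hs)))).congr_deriv ?_
    simp only [map_neg, map_mul, Complex.conj_ofReal]
    ring
  have hconst : ∀ t ∈ Ioi (0 : ℝ), w t = w s := fun t ht =>
    isOpen_Ioi.is_const_of_deriv_eq_zero isPreconnected_Ioi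
      (fun x hx => (hd x hx).differentiableAt.differentiableWithinAt)
      (fun x hx => (hd x hx).deriv) ht hs
  have hX : Tendsto (fun s : ℝ => √s * (Complex.exp (-(Complex.I * s)) * hankel 0 s)) atTop
      (𝓝 1) := by
    rw [tendsto_iff_norm_sub_tendsto_zero]
    refine squeeze_zero' (Eventually.of_forall fun _ => norm_nonneg _) ?_
      (tendsto_const_nhds.div_atTop (tendsto_id.const_mul_atTop (by norm_num : (0 : ℝ) < 4)) :
        Tendsto (fun s : ℝ => 1 / (4 * s)) atTop (𝓝 0))
    filter_upwards [eventually_gt_atTop 0] with s hs using norm_hankel_zero_sub_le hs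
  have hY : Tendsto (fun s : ℝ => √s * (Complex.exp (-(Complex.I * s)) * hankel 1 s)) atTop
      (𝓝 Complex.I) := by
    rw [tendsto_iff_norm_sub_tendsto_zero]
    refine squeeze_zero' (Eventually.of_forall fun _ => norm_nonneg _) ?_
      (tendsto_const_nhds.div_atTop tendsto_id : Tendsto (fun s : ℝ => 1 / s) atTop (𝓝 0))
    filter_upwards [eventually_gt_atTop 0] with s hs using norm_hankel_one_sub_le hs
  have hlim := (hX.mul (Complex.continuous_conj.continuousAt.tendsto.comp hY)).sub
    (hY.mul (Complex.continuous_conj.continuousAt.tendsto.comp hX))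
  have hlim2 : Tendsto (fun _ : ℝ => w s) atTop
      (𝓝 (1 * (starRingEnd ℂ) Complex.I - Complex.I * (starRingEnd ℂ) 1)) := by
    refine hlim.congr' ?_
    filter_upwards [eventually_gt_atTop 0] with t ht
    rw [← hconst t ht, hw]
    have e1 : Complex.exp (-(Complex.I * t)) *
        (starRingEnd ℂ) (Complex.exp (-(Complex.I * t))) = 1 := by
      rw [← Complex.exp_conj, ← Complex.exp_add]
      simp
    have e2 : (√t : ℂ) * √t = t := by exact_mod_cast Real.mul_self_sqrt ht.le
    simp only [Function.comp, map_mul, Complex.conj_ofReal]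
    linear_combination (hankel 0 t * (starRingEnd ℂ) (hankel 1 t) -
      hankel 1 t * (starRingEnd ℂ) (hankel 0 t)) * (√t * √t * e1 + e2)
  have := tendsto_nhds_unique tendsto_const_nhds hlim2
  rw [hw] at this
  simp only at this
  rw [this]
  simp
  ring

theorem c₀_eq : c₀ = √Real.pi * (1 + Complex.I) / 2 := by
  have h1 : Complex.exp (Complex.I * (Real.pi / 4)) = (1 + Complex.I) / √2 := by
    have : Complex.I * (Real.pi / 4) = ((Real.pi / 4 : ℝ) : ℂ) * Complex.I := by
      push_cast; ring
    rw [this, Complex.exp_mul_I, ← Complex.ofReal_cos, ← Complex.ofReal_sin, Real.cos_pi_div_four,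
      Real.sin_pi_div_four]
    have h2 : (√2 : ℂ) ^ 2 = 2 := by exact_mod_cast Real.sq_sqrt (by norm_num : (0 : ℝ) ≤ 2)
    have h0 : (√2 : ℂ) ≠ 0 := by
      intro h; rw [h] at h2; norm_num at h2
    push_cast
    field_simp
    linear_combination (1 + Complex.I) * h2
  have h2 : (√2 : ℂ) ^ 2 = 2 := by exact_mod_cast Real.sq_sqrt (by norm_num : (0 : ℝ) ≤ 2)
  have h0 : (√2 : ℂ) ≠ 0 := by
    intro h; rw [h] at h2; norm_num at h2
  rw [c₀, h1, Real.sqrt_div Real.pi_pos.le]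
  push_cast
  field_simp
  linear_combination (-(1 + Complex.I)) * h2

theorem hankelBeta_eq : hankelBeta = Complex.I * c₀ * c₁ := by
  have h2 : (√Real.pi : ℂ) ^ 2 = Real.pi := by exact_mod_cast Real.sq_sqrt Real.pi_pos.le
  have h0 := sqrt_pi_ne_zero
  have h1 : (Real.pi : ℂ) ≠ 0 := by exact_mod_cast Real.pi_pos.ne'
  rw [hankelBeta, c₀_eq, c₁]
  push_cast
  rw [← h2]
  field_simp
  linear_combination -Complex.I_sq

/-- The Hankel function at the origin: `H = c₀ (1 + iκ + i c₁ log s) + O(√s)` with `κ` real. -/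
theorem exists_hankel_expansion : ∃ κ : ℝ, ∀ s : ℝ, 0 < s → s < 1 →
    ‖hankel 0 s - c₀ * (1 + Complex.I * κ + Complex.I * c₁ * Real.log s)‖ ≤ 8 * √s := by
  obtain ⟨α, hα⟩ := exists_hankelAlpha
  have hlog : Tendsto (fun s : ℝ => Real.log s * √s) (𝓝[>] 0) (𝓝 0) := by
    simpa [Real.sqrt_eq_rpow] using tendsto_log_mul_rpow_nhdsGT_zero (by norm_num : (0 : ℝ) < 1 / 2)
  have hsq : Tendsto (fun s : ℝ => √s) (𝓝[>] 0) (𝓝 0) := by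
    have := (Real.continuous_sqrt.tendsto 0).mono_left (nhdsWithin_le_nhds (s := Ioi 0))
    simpa using this
  have hev : ∀ᶠ s : ℝ in 𝓝[>] 0, 0 < s ∧ s < 1 := Ioo_mem_nhdsGT one_pos
  have h1 : Tendsto (fun s : ℝ => hankel 0 s - α - hankelBeta * Real.log s) (𝓝[>] 0) (𝓝 0) := by
    refine squeeze_zero_norm' (a := fun s => 8 * √s) ?_ (by simpa using hsq.const_mul 8)
    filter_upwards [hev] with s hs using hα s hs.1 hs.2
  have h2 : Tendsto (fun s : ℝ => s * hankel 1 s - hankelBeta) (𝓝[>] 0) (𝓝 0) := by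
    refine squeeze_zero_norm' (a := fun s => 4 * √s) ?_ (by simpa using hsq.const_mul 4)
    filter_upwards [hev] with s hs using norm_mul_hankel_one_sub_le hs.1 hs.2.le
  have h3 : Tendsto (fun s : ℝ => Real.log s * (s * hankel 1 s - hankelBeta)) (𝓝[>] 0) (𝓝 0) := by
    refine squeeze_zero_norm' (a := fun s => 4 * |Real.log s * √s|) ?_
      (by simpa using hlog.abs.const_mul 4)
    filter_upwards [hev] with s hs
    rw [norm_mul, Complex.norm_real, Real.norm_eq_abs, abs_mul, abs_of_nonneg (Real.sqrt_nonneg s)]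
    nlinarith [norm_mul_hankel_one_sub_le hs.1 hs.2.le, abs_nonneg (Real.log s)]
  have cj := fun {f : ℝ → ℂ} {z : ℂ} (h : Tendsto f (𝓝[>] 0) (𝓝 z)) =>
    (Complex.continuous_conj.continuousAt.tendsto (x := z)).comp h
  -- The Wronskian expanded at the origin with `H ≈ α + β log s` and `s H' ≈ β`. The terms `|β|² log
  -- s` cancel and the logarithm times the error of `s H'` tends to zero, leaving `α β̄ - β ᾱ =
  -- -2i`.
  have h4 := ((((cj h2).const_mul α).add ((cj h3).const_mul hankelBeta)).add
    (h1.mul (cj (h2.add_const hankelBeta)))).sub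
    (((h2.mul_const ((starRingEnd ℂ) α)).add (h3.mul_const ((starRingEnd ℂ) hankelBeta))).add
    ((h2.add_const hankelBeta).mul (cj h1)))
  have h5 : -2 * Complex.I - (α * (starRingEnd ℂ) hankelBeta - hankelBeta * (starRingEnd ℂ) α) =
      0 := by
    simp only [map_zero, mul_zero, zero_mul, add_zero, sub_zero, zero_add] at h4
    refine tendsto_nhds_unique (tendsto_const_nhds.congr' ?_) h4
    filter_upwards [hev] with s hs
    rw [← hankel_wronskian hs.1]
    simp only [Function.comp, map_sub, map_add, map_mul, Complex.conj_ofReal]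
    ring
  rw [hankelBeta_eq] at h5
  have hπ : (√Real.pi : ℂ) ^ 2 = Real.pi := by exact_mod_cast Real.sq_sqrt Real.pi_pos.le
  have hcc : c₀ * (starRingEnd ℂ) c₀ = Real.pi / 2 := by
    rw [c₀_eq]
    simp only [map_mul, map_add, map_one, Complex.conj_I, Complex.conj_ofReal, map_div₀,
      Complex.conj_ofNat]
    linear_combination (1 - Complex.I ^ 2) / 4 * hπ - Real.pi / 4 * Complex.I_sq
  have hπ0 : (Real.pi : ℂ) ≠ 0 := by exact_mod_cast Real.pi_pos.ne'
  have hc0 : c₀ ≠ 0 := by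
    intro h
    rw [h, zero_mul] at hcc
    exact hπ0 (by linear_combination -2 * hcc)
  -- Inserting `β = i c₀ c₁` and `|c₀|² = π/2`, the Wronskian relation says exactly that `α / c₀`
  -- has real part `1`. Its imaginary part is the real constant sought.
  have hre : (α / c₀).re = 1 := by
    have e1 : α = c₀ * (α / c₀) := by field_simp
    set m := α / c₀
    rw [e1] at h5
    simp only [map_mul, Complex.conj_I, Complex.conj_ofReal] at h5
    have e2 : m + (starRingEnd ℂ) m = 2 := by
      have hc1 : (c₁ : ℂ) * (Real.pi / 2) = 1 := by
        rw [c₁]; push_cast; field_simp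
      have e3 : Complex.I * (m + (starRingEnd ℂ) m) = 2 * Complex.I := by
        linear_combination h5 + Complex.I * (c₁ : ℂ) * (m + (starRingEnd ℂ) m) * (-hcc)
          - Complex.I * (m + (starRingEnd ℂ) m) * hc1
      exact mul_left_cancel₀ Complex.I_ne_zero (e3.trans (mul_comm _ _))
    have := congrArg Complex.re e2
    simp at this
    linarith
  refine ⟨(α / c₀).im, fun s hs hs1 => ?_⟩
  have e : c₀ * (1 + Complex.I * (α / c₀).im + Complex.I * c₁ * Real.log s) =
      α + hankelBeta * Real.log s := by
    have e1 : (1 + Complex.I * (α / c₀).im : ℂ) = α / c₀ := by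
      conv_rhs => rw [← Complex.re_add_im (α / c₀), hre]
      push_cast
      ring
    rw [e1, hankelBeta_eq]
    field_simp
  rw [e, ← sub_sub]
  exact hα s hs hs1

end HankelAsymptotics

/-! ### Variation of constants for the perturbed Bessel equation -/

section PerturbedBessel

/-- `c ↦ (x₁ c₁ + x₂ c₂, -(x₃ c₁) - x₁ c₂)`, as a real-linear map. -/
def coeffMap (x : ℂ × ℂ × ℂ) : (ℂ × ℂ) →L[ℝ] (ℂ × ℂ) :=
  let p := ContinuousLinearMap.fst ℝ ℂ ℂ
  let q := ContinuousLinearMap.snd ℝ ℂ ℂ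
  (x.1 • p + x.2.1 • q).prod (-(x.2.2 • p) - x.1 • q)

theorem coeffMap_apply (x : ℂ × ℂ × ℂ) (c : ℂ × ℂ) :
    coeffMap x c = (x.1 * c.1 + x.2.1 * c.2, -(x.2.2 * c.1) - x.1 * c.2) := rfl

theorem norm_coeffMap_le {x : ℂ × ℂ × ℂ} {b : ℝ} (h : ‖x‖ ≤ b) :
    ‖coeffMap x‖ ≤ 2 * b := by
  have hx := (norm_prod_le_iff.1 h)
  have hx2 := norm_prod_le_iff.1 hx.2
  have hb : 0 ≤ b := (norm_nonneg _).trans h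
  refine ContinuousLinearMap.opNorm_le_bound _ (by positivity) fun c => ?_
  have h1 := norm_fst_le c
  have h2 := norm_snd_le c
  rw [coeffMap_apply, norm_prod_le_iff]
  have key : ∀ y z : ℂ, ‖y‖ ≤ b → ‖z‖ ≤ b → ‖y‖ * ‖c.1‖ + ‖z‖ * ‖c.2‖ ≤ 2 * b * ‖c‖ :=
    fun y z hy hz => by
      calc _ ≤ b * ‖c‖ + b * ‖c‖ := by gcongr
        _ = _ := by ring
  constructor
  · exact (norm_add_le _ _).trans (by rw [norm_mul, norm_mul]; exact key _ _ hx.1 hx2.1)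
  · exact (norm_sub_le _ _).trans (by
      rw [norm_neg, norm_mul, norm_mul]; exact key _ _ hx2.2 hx.1)

/-- `coeffMap` as a continuous linear map. -/
def coeffMapL : (ℂ × ℂ × ℂ) →L[ℝ] ((ℂ × ℂ) →L[ℝ] (ℂ × ℂ)) :=
  LinearMap.mkContinuous
    { toFun := coeffMap
      map_add' := fun x y => by
        ext c <;> simp [coeffMap_apply] <;> ring
      map_smul' := fun a x => by
        ext c <;> simp [coeffMap_apply] <;> ring }
    2 fun x => norm_coeffMap_le le_rfl

theorem coeffMapL_apply (x : ℂ × ℂ × ℂ) : coeffMapL x = coeffMap x := rfl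

/-- Products of Hankel functions governing the variation of constants. -/
def hankelQuad (s : ℝ) : ℂ × ℂ × ℂ :=
  (s * hankel 0 s * (starRingEnd ℂ) (hankel 0 s) / (2 * Complex.I),
    s * (starRingEnd ℂ) (hankel 0 s) * (starRingEnd ℂ) (hankel 0 s) / (2 * Complex.I),
    s * hankel 0 s * hankel 0 s / (2 * Complex.I))

/-- The derivative of `hankelQuad`. -/
def hankelQuadDeriv (s : ℝ) : ℂ × ℂ × ℂ :=
  ((hankel 0 s * (starRingEnd ℂ) (hankel 0 s) + s * hankel 1 s * (starRingEnd ℂ) (hankel 0 s) +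
      s * hankel 0 s * (starRingEnd ℂ) (hankel 1 s)) / (2 * Complex.I),
    ((starRingEnd ℂ) (hankel 0 s) * (starRingEnd ℂ) (hankel 0 s) +
      s * (starRingEnd ℂ) (hankel 1 s) * (starRingEnd ℂ) (hankel 0 s) +
      s * (starRingEnd ℂ) (hankel 0 s) * (starRingEnd ℂ) (hankel 1 s)) / (2 * Complex.I),
    (hankel 0 s * hankel 0 s + s * hankel 1 s * hankel 0 s + s * hankel 0 s * hankel 1 s) /
      (2 * Complex.I))

theorem hasDerivAt_hankelQuad {s : ℝ} (hs : 0 < s) :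
    HasDerivAt hankelQuad (hankelQuadDeriv s) s := by
  have hi := Complex.ofRealCLM.hasDerivAt (x := s)
  have h0 := hasDerivAt_hankel 0 hs
  have h1 := hasDerivAt_conj h0
  refine (((hi.mul h0).mul h1).div_const (2 * Complex.I)).prodMk
    ((((hi.mul h1).mul h1).div_const (2 * Complex.I)).prodMk
      (((hi.mul h0).mul h0).div_const (2 * Complex.I))) |>.congr_deriv ?_
  simp only [hankelQuadDeriv, Complex.ofRealCLM_apply, Complex.ofReal_one, Pi.mul_apply, zero_add]
  refine Prod.ext ?_ (Prod.ext ?_ ?_) <;> ring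

/-- The bound `s |H|² ≤ 1` is uniform in `s`, so no logarithm enters the size of the perturbation.
-/
theorem norm_hankelQuad_le {s : ℝ} (hs : 0 < s) : ‖hankelQuad s‖ ≤ 1 / 2 := by
  have h0 := norm_hankel_zero_le hs
  have hs' : 0 < √s := Real.sqrt_pos.2 hs
  have key : s * ‖hankel 0 s‖ * ‖hankel 0 s‖ / 2 ≤ 1 / 2 := by
    have : s * ‖hankel 0 s‖ * ‖hankel 0 s‖ ≤ s * (1 / √s) * (1 / √s) := by gcongr
    have e : s * (1 / √s) * (1 / √s) = 1 := by
      field_simp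
      rw [Real.sq_sqrt hs.le]
    linarith
  simp only [hankelQuad, norm_prod_le_iff, norm_div, norm_mul, Complex.norm_real, Complex.norm_I,
    RCLike.norm_conj, Complex.norm_ofNat, mul_one, Real.norm_of_nonneg hs.le]
  exact ⟨key, key, key⟩

/-- The growth `1/s` at the origin is harmless because only arguments above `l z₀` occur, where it
costs `1/(l z₀)`. -/
theorem norm_hankelQuadDeriv_le {s : ℝ} (hs : 0 < s) :
    ‖hankelQuadDeriv s‖ ≤ 2 * (1 + 1 / s) := by
  have h0 := norm_hankel_zero_le hs
  have h1 := norm_mul_hankel_one_le hs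
  rw [norm_mul, Complex.norm_real, Real.norm_of_nonneg hs.le] at h1
  have hs' : 0 < √s := Real.sqrt_pos.2 hs
  have hss : √s * √s = s := Real.mul_self_sqrt hs.le
  have k0 : ‖hankel 0 s‖ * ‖hankel 0 s‖ ≤ 1 / s := by
    calc _ ≤ 1 / √s * (1 / √s) := by gcongr
      _ = 1 / s := by rw [div_mul_div_comm, hss, one_mul]
  have k1 : s * ‖hankel 1 s‖ * ‖hankel 0 s‖ ≤ 1 + 1 / √s := by
    calc _ ≤ (√s + 1) * (1 / √s) := by gcongr
      _ = _ := by field_simp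
  have k2 : 1 / √s ≤ 1 / 2 + 1 / 2 * (1 / s) := by
    have := sq_nonneg (1 / √s - 1)
    have e : 1 / s = (1 / √s) ^ 2 := by rw [div_pow, Real.sq_sqrt hs.le, one_pow]
    rw [e]
    linarith
  have k3 : 0 < 1 / s := by positivity
  have key : ∀ x y z : ℂ, ‖x‖ ≤ 1 / s → ‖y‖ ≤ 1 + 1 / √s → ‖z‖ ≤ 1 + 1 / √s →
      ‖(x + y + z) / (2 * Complex.I)‖ ≤ 2 * (1 + 1 / s) := fun x y z hx hy hz => by
    have := norm_add₃_le (a := x) (b := y) (c := z)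
    rw [norm_div, norm_mul, Complex.norm_I, Complex.norm_ofNat, mul_one]
    linarith
  have k4 : s * ‖hankel 0 s‖ * ‖hankel 1 s‖ ≤ 1 + 1 / √s := by linarith
  simp only [hankelQuadDeriv, norm_prod_le_iff]
  refine ⟨key _ _ _ ?_ ?_ ?_, key _ _ _ ?_ ?_ ?_, key _ _ _ ?_ ?_ ?_⟩ <;>
    simpa only [norm_mul, Complex.norm_real, RCLike.norm_conj, Real.norm_of_nonneg hs.le]

theorem continuousOn_hankel (n : ℕ) : ContinuousOn (hankel n) (Ioi 0) := fun _ hs =>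
  (hasDerivAt_hankel n hs).continuousAt.continuousWithinAt

theorem continuousOn_hankelQuadDeriv : ContinuousOn hankelQuadDeriv (Ioi 0) := by
  have h0 := continuousOn_hankel 0
  have h1 := continuousOn_hankel 1
  have h2 := Complex.continuous_conj.comp_continuousOn h0
  have h3 := Complex.continuous_conj.comp_continuousOn h1
  have hi : ContinuousOn (fun s : ℝ => (s : ℂ)) (Ioi 0) := Complex.continuous_ofReal.continuousOn
  exact ((((h0.mul h2).add ((hi.mul h1).mul h2)).add ((hi.mul h0).mul h3)).div_const _).prodMk
    (((((h2.mul h2).add ((hi.mul h3).mul h2)).add ((hi.mul h2).mul h3)).div_const _).prodMk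
      ((((h0.mul h0).add ((hi.mul h1).mul h0)).add ((hi.mul h0).mul h1)).div_const _))

/-- The density of the system for the coefficients. -/
def besselDensity (e : ℝ → ℝ) (z₀ l t : ℝ) : (ℂ × ℂ) →L[ℝ] (ℂ × ℂ) :=
  (Ioi (0 : ℝ)).indicator (fun t => coeffMapL (e (z₀ + t / l) • hankelQuad (t + l * z₀))) t

/-- The derivative of `besselDensity` in the energy parameter. -/
def besselDensityDeriv (e e' : ℝ → ℝ) (z₀ l t : ℝ) : (ℂ × ℂ) →L[ℝ] (ℂ × ℂ) :=
  (Ioi (0 : ℝ)).indicator (fun t => coeffMapL (e (z₀ + t / l) • z₀ • hankelQuadDeriv (t + l * z₀) +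
    (e' (z₀ + t / l) * (-t / l ^ 2)) • hankelQuad (t + l * z₀))) t

variable {e e' : ℝ → ℝ} {z₀ C l : ℝ}

theorem besselDensity_of_pos {t : ℝ} (ht : 0 < t) :
    besselDensity e z₀ l t = coeffMapL (e (z₀ + t / l) • hankelQuad (t + l * z₀)) :=
  indicator_of_mem (mem_Ioi.2 ht) _

theorem besselDensityDeriv_of_pos {t : ℝ} (ht : 0 < t) :
    besselDensityDeriv e e' z₀ l t =
      coeffMapL (e (z₀ + t / l) • z₀ • hankelQuadDeriv (t + l * z₀) +
        (e' (z₀ + t / l) * (-t / l ^ 2)) • hankelQuad (t + l * z₀)) :=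
  indicator_of_mem (mem_Ioi.2 ht) _

theorem besselDensity_of_nonpos {t : ℝ} (ht : t ≤ 0) : besselDensity e z₀ l t = 0 :=
  indicator_of_notMem (not_lt.2 ht) _

theorem besselDensityDeriv_of_nonpos {t : ℝ} (ht : t ≤ 0) : besselDensityDeriv e e' z₀ l t = 0 :=
  indicator_of_notMem (not_lt.2 ht) _

/-- The variable `t = s - l z₀` keeps the half line of integration independent of `l`. In exchange
`e` is evaluated at `z₀ + t / l`, and the growing factor `-t / l ^ 2` must be absorbed by the decay
of `e'`. -/
theorem hasDerivAt_besselDensity (hz₀ : 0 < z₀) (hl : 0 < l)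
    (he : ∀ z > z₀, HasDerivAt e (e' z) z) {t : ℝ} (ht : 0 < t) :
    HasDerivAt (fun l => besselDensity e z₀ l t) (besselDensityDeriv e e' z₀ l t) l := by
  simp only [besselDensity_of_pos ht, besselDensityDeriv_of_pos ht]
  have h1 : HasDerivAt (fun l => z₀ + t / l) (-t / l ^ 2) l := by
    refine (((hasDerivAt_inv hl.ne').const_mul t).const_add z₀).congr_deriv ?_
    ring
  have h2 : HasDerivAt (fun l => t + l * z₀) z₀ l := by
    simpa using ((hasDerivAt_id l).mul_const z₀).const_add t
  have h3 := (he (z₀ + t / l) (lt_add_of_pos_right _ (by positivity))).comp l h1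
  have h4 := (hasDerivAt_hankelQuad (by positivity : 0 < t + l * z₀)).scomp l h2
  exact coeffMapL.hasFDerivAt.comp_hasDerivAt l (h3.smul h4)

theorem besselDensity_shift_mem (hl : 0 < l) {t : ℝ} (ht : 0 < t) : z₀ < z₀ + t / l :=
  lt_add_of_pos_right _ (by positivity)

theorem continuousOn_besselDensity (hz₀ : 0 < z₀) (hl : 0 < l)
    (he : ∀ z > z₀, HasDerivAt e (e' z) z) : ContinuousOn (besselDensity e z₀ l) (Ioi 0) := by
  have h1 : ContinuousOn (fun t => e (z₀ + t / l)) (Ioi 0) :=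
    ContinuousOn.comp (t := Ioi z₀) (g := e)
      (fun z hz => (he z hz).continuousAt.continuousWithinAt) (by fun_prop)
      fun t ht => besselDensity_shift_mem hl ht
  have h2 : ContinuousOn (fun t => hankelQuad (t + l * z₀)) (Ioi 0) :=
    ContinuousOn.comp (t := Ioi 0) (g := hankelQuad)
      (fun s hs => (hasDerivAt_hankelQuad hs).continuousAt.continuousWithinAt) (by fun_prop)
      fun t ht => by have : 0 < t := ht; exact mem_Ioi.2 (by positivity)
  exact (coeffMapL.continuous.comp_continuousOn (h1.smul h2)).congr
    fun t ht => besselDensity_of_pos ht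

theorem aestronglyMeasurable_of_continuousOn {F : Type*} [NormedAddCommGroup F] {f : ℝ → F}
    (hf : ContinuousOn f (Ioi 0)) (h0 : ∀ t ≤ 0, f t = 0) : AEStronglyMeasurable f := by
  have h1 := (aestronglyMeasurable_indicator_iff measurableSet_Ioi).2
    (hf.aestronglyMeasurable (μ := volume) measurableSet_Ioi)
  have e : (Ioi 0).indicator f = f := by
    ext1 t
    by_cases ht : 0 < t
    · simp [ht]
    · simp [h0 t (not_lt.1 ht)]
  rwa [e] at h1

theorem aestronglyMeasurable_besselDensityDeriv (hz₀ : 0 < z₀) (hl : 0 < l)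
    (he : ∀ z > z₀, HasDerivAt e (e' z) z) (hc : ContinuousOn e' (Ioi z₀)) :
    AEStronglyMeasurable (besselDensityDeriv e e' z₀ l) := by
  refine aestronglyMeasurable_of_continuousOn ?_ fun t ht => besselDensityDeriv_of_nonpos ht
  have h1 : ContinuousOn (fun t => e (z₀ + t / l)) (Ioi 0) :=
    ContinuousOn.comp (t := Ioi z₀) (g := e)
      (fun z hz => (he z hz).continuousAt.continuousWithinAt) (by fun_prop)
      fun t ht => besselDensity_shift_mem hl ht
  have h2 : ContinuousOn (fun t => hankelQuad (t + l * z₀)) (Ioi 0) :=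
    ContinuousOn.comp (t := Ioi 0) (g := hankelQuad)
      (fun s hs => (hasDerivAt_hankelQuad hs).continuousAt.continuousWithinAt) (by fun_prop)
      fun t ht => by have : 0 < t := ht; exact mem_Ioi.2 (by positivity)
  have h3 : ContinuousOn (fun t => hankelQuadDeriv (t + l * z₀)) (Ioi 0) :=
    ContinuousOn.comp (t := Ioi 0) (g := hankelQuadDeriv) continuousOn_hankelQuadDeriv
      (by fun_prop) fun t ht => by have : 0 < t := ht; exact mem_Ioi.2 (by positivity)
  have h4 : ContinuousOn (fun t => e' (z₀ + t / l)) (Ioi 0) :=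
    ContinuousOn.comp (t := Ioi z₀) (g := e') hc (by fun_prop)
      fun t ht => besselDensity_shift_mem hl ht
  have h5 : ContinuousOn (fun t : ℝ => -t / l ^ 2) (Ioi 0) := by fun_prop
  exact (coeffMapL.continuous.comp_continuousOn
    ((h1.smul (h3.const_smul z₀)).add ((h4.mul h5).smul h2))).congr
    fun t ht => besselDensityDeriv_of_pos ht

/-- As `z = s / l`, the bound `C / z²` reads `C l² / s²` with `s = t + l z₀`. The operator norm is
then at most `C l² / (l z₀) = (C / z₀) l`, the source of the `O(l)` corrections. -/
theorem isTailDensity_besselDensity (hz₀ : 0 < z₀) (hl : 0 < l)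
    (he : ∀ z > z₀, HasDerivAt e (e' z) z) (hb : ∀ z > z₀, |e z| ≤ C / z ^ 2) :
    IsTailDensity (C * l ^ 2) (l * z₀) (besselDensity e z₀ l) where
  meas := aestronglyMeasurable_of_continuousOn (continuousOn_besselDensity hz₀ hl he)
    fun t ht => besselDensity_of_nonpos ht
  zero := fun t ht => besselDensity_of_nonpos ht
  bound := fun t ht => by
    rw [besselDensity_of_pos ht, coeffMapL_apply]
    have h1 := hb _ (besselDensity_shift_mem (z₀ := z₀) hl ht)
    have h2 := norm_hankelQuad_le (by positivity : 0 < t + l * z₀)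
    have e1 : z₀ + t / l = (t + l * z₀) / l := by field_simp; ring
    refine (norm_coeffMap_le (b := C / (z₀ + t / l) ^ 2 * (1 / 2)) ?_).trans_eq ?_
    · rw [norm_smul, Real.norm_eq_abs]
      gcongr
      exact (abs_nonneg _).trans h1
    · rw [e1]
      field_simp

/-- Dividing the constant by `l z₀` leaves `4 C l + 5 C / z₀`, which is bounded as `l → 0`. The
terms `4 l² z₀ + 4 l` come from the derivative of the Hankel products and `l` from that of `e`. -/
theorem isTailDensity_besselDensityDeriv (hz₀ : 0 < z₀) (hl : 0 < l) (hC : 0 ≤ C)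
    (he : ∀ z > z₀, HasDerivAt e (e' z) z) (hc : ContinuousOn e' (Ioi z₀))
    (hb : ∀ z > z₀, |e z| ≤ C / z ^ 2) (hb' : ∀ z > z₀, |e' z| ≤ C / z ^ 3) :
    IsTailDensity (C * (4 * l ^ 2 * z₀ + 5 * l)) (l * z₀) (besselDensityDeriv e e' z₀ l) where
  meas := aestronglyMeasurable_besselDensityDeriv hz₀ hl he hc
  zero := fun t ht => besselDensityDeriv_of_nonpos ht
  bound := fun t ht => by
    rw [besselDensityDeriv_of_pos ht, coeffMapL_apply]
    have ha : 0 < l * z₀ := by positivity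
    have hs : 0 < t + l * z₀ := by positivity
    have h1 := hb _ (besselDensity_shift_mem (z₀ := z₀) hl ht)
    have h1' := hb' _ (besselDensity_shift_mem (z₀ := z₀) hl ht)
    have h2 := norm_hankelQuad_le hs
    have h2' := norm_hankelQuadDeriv_le hs
    have e1 : z₀ + t / l = (t + l * z₀) / l := by field_simp; ring
    rw [e1] at h1 h1' ⊢
    set s := t + l * z₀ with hs_def
    have k1 : ‖e (s / l) • z₀ • hankelQuadDeriv s‖ ≤
        C * (2 * l ^ 2 * z₀ + 2 * l) / s ^ 2 := by
      rw [norm_smul, norm_smul, Real.norm_eq_abs, Real.norm_of_nonneg hz₀.le]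
      have h3 : 1 / s ≤ 1 / (l * z₀) := by gcongr; linarith
      calc _ ≤ C / (s / l) ^ 2 * (z₀ * (2 * (1 + 1 / (l * z₀)))) := by
            gcongr
            exact h2'.trans (by gcongr)
        _ = _ := by field_simp
    have k2 : ‖(e' (s / l) * (-t / l ^ 2)) • hankelQuad s‖ ≤ C * (l / 2) / s ^ 2 := by
      rw [norm_smul, norm_mul, Real.norm_eq_abs, norm_div, norm_neg, Real.norm_of_nonneg ht.le,
        norm_pow, Real.norm_of_nonneg hl.le]
      calc _ ≤ C / (s / l) ^ 3 * (s / l ^ 2) * (1 / 2) := by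
            gcongr
            linarith
        _ = _ := by field_simp
    refine (norm_coeffMap_le ((norm_add_le _ _).trans (add_le_add k1 k2))).trans_eq ?_
    ring

theorem IsTailDensity.mono {K K' a a' : ℝ} {N : ℝ → (ℂ × ℂ) →L[ℝ] (ℂ × ℂ)}
    (h : IsTailDensity K a N) (hK : 0 ≤ K) (hK' : K ≤ K') (ha' : 0 < a') (ha : a' ≤ a) :
    IsTailDensity K' a' N where
  meas := h.meas
  zero := h.zero
  bound := fun t ht => (h.bound t ht).trans (by have := hK.trans hK'; gcongr)

/-- The coefficients of the Jost solution of the perturbed Bessel equation. -/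
theorem exists_jost_coeff (hz₀ : 0 < z₀) (hC : 0 ≤ C)
    (he : ∀ z > z₀, HasDerivAt e (e' z) z) (hc : ContinuousOn e' (Ioi z₀))
    (hb : ∀ z > z₀, |e z| ≤ C / z ^ 2) (hb' : ∀ z > z₀, |e' z| ≤ C / z ^ 3) :
    ∃ (c : ℝ → ℝ → ℂ × ℂ) (d : ℝ → ℂ × ℂ),
      (∀ l > 0, Continuous (c l) ∧ Tendsto (c l) atTop (𝓝 (1, 0)) ∧ ∀ t > 0, HasDerivAt (c l)
        (coeffMap (e (z₀ + t / l) • hankelQuad (t + l * z₀)) (c l t)) t) ∧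
      (∀ l > 0, HasDerivAt (fun l => c l 0) (d l) l) ∧
      ∃ K l₁, 0 < l₁ ∧ ∀ l, 0 < l → l < l₁ → ‖c l 0 - (1, 0)‖ ≤ K * l ∧ ‖d l‖ ≤ K := by
  have hN := fun (l : ℝ) (hl : 0 < l) => isTailDensity_besselDensity hz₀ hl he hb
  have hN' := fun (l : ℝ) (hl : 0 < l) => isTailDensity_besselDensityDeriv hz₀ hl hC he hc hb hb'
  have hd : ∀ l > 0, ∃ d : ℝ →ᵇ (ℂ × ℂ),
      HasDerivAt (fun l => tailSol (besselDensity e z₀ l) ((1, 0) : ℂ × ℂ)) d l ∧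
      (‖tailOp (besselDensity e z₀ l)‖ ≤ 1 / 2 →
        ‖d‖ ≤ 4 * ‖((1, 0) : ℂ × ℂ)‖ * ‖tailOp (besselDensityDeriv e e' z₀ l)‖) := by
    intro l₀ hl₀
    have hball : ∀ l ∈ Metric.ball l₀ (l₀ / 2), l₀ / 2 < l ∧ l < 2 * l₀ := fun l hl => by
      rw [Metric.mem_ball, Real.dist_eq, abs_lt] at hl
      constructor <;> linarith [hl.1, hl.2]
    -- One pair of constants must serve the density and its derivative on the whole ball: both
    -- numerators are added at `2 l₀`, an upper bound for `l`, and the shift is taken at the lower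
    -- bound `l₀ / 2`.
    refine hasDerivAt_tailSol_param (K := C * (4 * (2 * l₀) ^ 2 * z₀ + 5 * (2 * l₀)) +
      C * (2 * l₀) ^ 2) (a := l₀ / 2 * z₀) (half_pos hl₀) (by positivity) (by positivity) ?_ ?_ ?_ _
    · intro l hl
      obtain ⟨h1, h2⟩ := hball l hl
      have hl0 : 0 < l := by linarith
      refine (hN l hl0).mono (by positivity) ?_ (by positivity) (by gcongr)
      refine le_trans ?_ (le_add_of_nonneg_left (by positivity))
      gcongr
    · intro l hl
      obtain ⟨h1, h2⟩ := hball l hl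
      have hl0 : 0 < l := by linarith
      refine (hN' l hl0).mono (by positivity) ?_ (by positivity) (by gcongr)
      refine le_trans ?_ (le_add_of_nonneg_right (by positivity))
      gcongr
    · intro l hl t ht
      obtain ⟨h1, h2⟩ := hball l hl
      exact hasDerivAt_besselDensity hz₀ (by linarith) he ht
  choose! d hd1 hd2 using hd
  have hv : ‖((1, 0) : ℂ × ℂ)‖ = 1 := by simp
  refine ⟨fun l => tailSol (besselDensity e z₀ l) (1, 0), fun l => d l 0, fun l hl => ⟨?_, ?_, ?_⟩,
    fun l hl => ?_, ?_⟩
  · exact (tailSol _ _).continuous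
  · exact (hN l hl).tendsto_tailSol (by positivity) (by positivity) _
  · intro t ht
    have := (hN l hl).hasDerivAt_tailSol (by positivity) (by positivity)
      (continuousOn_besselDensity hz₀ hl he) (1, 0) ht
    rwa [besselDensity_of_pos ht] at this
  · exact (BoundedContinuousFunction.evalCLM ℝ (0 : ℝ)).hasFDerivAt.comp_hasDerivAt l (hd1 l hl)
  -- The threshold makes `C l / z₀ ≤ 1/2`, with `C + 1` avoiding a division by zero. The bounds
  -- needed are `2 (C / z₀) l` for the value and `4 (4 C l + 5 C / z₀)` for the derivative.
  · refine ⟨C / z₀ * 36 + 16 * C, min 1 (z₀ / (2 * (C + 1))),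
      lt_min one_pos (by positivity), fun l hl hl1 => ?_⟩
    have hl2 : l < 1 := hl1.trans_le (min_le_left _ _)
    have hl3 : l < z₀ / (2 * (C + 1)) := hl1.trans_le (min_le_right _ _)
    have hT := (hN l hl).norm_tailOp_le (by positivity) (by positivity)
    have hT' := (hN' l hl).norm_tailOp_le (by positivity) (by positivity)
    have e1 : C * l ^ 2 / (l * z₀) = C / z₀ * l := by field_simp
    have e2 : C * (4 * l ^ 2 * z₀ + 5 * l) / (l * z₀) = 4 * C * l + 5 * (C / z₀) := by
      field_simp
    rw [e1] at hT
    rw [e2] at hT'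
    have hhalf : C / z₀ * l ≤ 1 / 2 := by
      rw [lt_div_iff₀ (by positivity)] at hl3
      rw [div_mul_eq_mul_div, div_le_iff₀ hz₀]
      nlinarith
    have hu := (hN l hl).isUnit (by positivity) (by positivity)
    have hCz : 0 ≤ C / z₀ := by positivity
    constructor
    · refine (norm_tailSol_sub_le hu (hT.trans hhalf) _ _).trans ?_
      rw [hv]
      nlinarith
    · refine ((d l).norm_coe_le_norm 0).trans ((hd2 l hl (hT.trans hhalf)).trans ?_)
      rw [hv]
      nlinarith

end PerturbedBessel

/-! ### Orders of vanishing up to an arbitrarily small power -/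

section SubPow

/-- `f(l) = O(l^{p - ε})` as `l → 0+`, for every `ε > 0`. -/
def SubPow (p : ℝ) (f : ℝ → ℂ) : Prop :=
  ∀ ε : ℝ, 0 < ε → f =O[𝓝[>] 0] fun l : ℝ => l ^ (p - ε)

variable {f g : ℝ → ℂ} {p q' : ℝ}

theorem SubPow.add (hf : SubPow p f) (hg : SubPow p g) : SubPow p fun l => f l + g l :=
  fun ε hε => (hf ε hε).add (hg ε hε)

theorem SubPow.neg (hf : SubPow p f) : SubPow p fun l => -f l := fun ε hε => (hf ε hε).neg_left

theorem SubPow.const_mul (hf : SubPow p f) (z : ℂ) : SubPow p fun l => z * f l :=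
  fun ε hε => (hf ε hε).const_mul_left z

theorem SubPow.mul (hf : SubPow p f) (hg : SubPow q' g) : SubPow (p + q') fun l => f l * g l :=
  fun ε hε => by
    refine ((hf (ε / 2) (half_pos hε)).mul (hg (ε / 2) (half_pos hε))).congr' EventuallyEq.rfl ?_
    filter_upwards [self_mem_nhdsWithin] with l hl
    rw [← Real.rpow_add hl]
    ring_nf

theorem SubPow.congr (hf : SubPow p f) (h : ∀ l > 0, f l = g l) : SubPow p g := fun ε hε =>
  (hf ε hε).congr' (by filter_upwards [self_mem_nhdsWithin] with l hl using h l hl) EventuallyEq.rfl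

theorem isBigO_rpow_of_le (h : q' ≤ p) :
    (fun l : ℝ => l ^ p) =O[𝓝[>] 0] fun l : ℝ => l ^ q' := by
  refine IsBigO.of_bound 1 ?_
  filter_upwards [Ioo_mem_nhdsGT one_pos] with l hl
  rw [one_mul, Real.norm_of_nonneg (Real.rpow_nonneg hl.1.le _),
    Real.norm_of_nonneg (Real.rpow_nonneg hl.1.le _)]
  exact Real.rpow_le_rpow_of_exponent_ge hl.1 hl.2.le h

theorem SubPow.mono (hf : SubPow p f) (h : q' ≤ p) : SubPow q' f := fun ε hε =>
  (hf ε hε).trans (isBigO_rpow_of_le (by linarith))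

theorem subPow_of_isBigO (h : f =O[𝓝[>] 0] fun l : ℝ => l ^ p) : SubPow p f := fun _ hε =>
  h.trans (isBigO_rpow_of_le (by linarith))

theorem subPow_of_norm_le {K l₁ : ℝ} (hl₁ : 0 < l₁)
    (h : ∀ l, 0 < l → l < l₁ → ‖f l‖ ≤ K * l ^ p) : SubPow p f := by
  refine subPow_of_isBigO (IsBigO.of_bound K ?_)
  filter_upwards [Ioo_mem_nhdsGT hl₁] with l hl
  rw [Real.norm_of_nonneg (Real.rpow_nonneg hl.1.le _)]
  exact h l hl.1 hl.2

theorem subPow_rpow (p : ℝ) : SubPow p fun l : ℝ => ((l ^ p : ℝ) : ℂ) := by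
  refine subPow_of_norm_le (K := 1) one_pos fun l hl _ => ?_
  rw [Complex.norm_real, Real.norm_of_nonneg (Real.rpow_nonneg hl.le _), one_mul]

theorem subPow_const (z : ℂ) : SubPow 0 fun _ => z := by
  refine subPow_of_norm_le (K := ‖z‖) one_pos fun l hl _ => ?_
  simp

theorem subPow_sqrt : SubPow (1 / 2) fun l : ℝ => (√l : ℂ) := by
  simpa only [Real.sqrt_eq_rpow] using subPow_rpow (1 / 2)

theorem subPow_inv_sqrt : SubPow (-(1 / 2)) fun l : ℝ => (√l : ℂ)⁻¹ :=
  (subPow_rpow (-(1 / 2))).congr fun l hl => by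
    rw [Real.rpow_neg hl.le, ← Real.sqrt_eq_rpow, Complex.ofReal_inv]

theorem subPow_inv : SubPow (-1) fun l : ℝ => (l : ℂ)⁻¹ :=
  (subPow_rpow (-1)).congr fun l hl => by rw [Real.rpow_neg_one, Complex.ofReal_inv]

/-- Logarithms cost nothing on this scale, which is why remainders are measured up to `ε`. -/
theorem subPow_log : SubPow 0 fun l : ℝ => (Real.log l : ℂ) := fun ε hε => by
  have h := (isLittleO_log_rpow_nhdsGT_zero (r := 0 - ε) (by linarith)).isBigO
  refine (IsBigO.of_bound 1 (Eventually.of_forall fun l => ?_)).trans h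
  rw [Complex.norm_real, one_mul]

theorem SubPow.conj (hf : SubPow p f) : SubPow p fun l => (starRingEnd ℂ) (f l) := fun ε hε => by
  refine (IsBigO.of_bound 1 (Eventually.of_forall fun l => ?_)).trans (hf ε hε)
  rw [RCLike.norm_conj, one_mul]

end SubPow

/-! ### A calculus of logarithmic expansions with their derivatives -/

section LogAsymp

/-- `g = μ + ν log l + O(l^{1/2-})` as `l → 0+`, with the corresponding derivative bound. -/
structure LogAsymp (μ ν : ℂ) (g g' : ℝ → ℂ) : Prop where
  hasDerivAt : ∀ l > 0, HasDerivAt g (g' l) l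
  sub : SubPow (1 / 2) fun l => g l - (μ + ν * Real.log l)
  sub_deriv : SubPow (-(1 / 2)) fun l => g' l - ν * (l : ℂ)⁻¹

/-- `u = 1 + O(l^{1-})`, resp. `O(l^{1-})`, with bounded derivative. -/
structure NearConst (z : ℂ) (u u' : ℝ → ℂ) : Prop where
  hasDerivAt : ∀ l > 0, HasDerivAt u (u' l) l
  sub : SubPow 1 fun l => u l - z
  sub_deriv : SubPow 0 u'

variable {μ ν μ₂ ν₂ z w : ℂ} {g g' g₂ g₂' u u' v v' : ℝ → ℂ}

theorem LogAsymp.subPow (h : LogAsymp μ ν g g') : SubPow 0 g :=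
  ((h.sub.mono (by norm_num)).add
    ((subPow_const μ).add (subPow_log.const_mul ν))).congr fun l _ => by ring

theorem LogAsymp.subPow_deriv (h : LogAsymp μ ν g g') : SubPow (-1) g' :=
  ((h.sub_deriv.mono (by norm_num)).add (subPow_inv.const_mul ν)).congr fun l _ => by ring

theorem NearConst.subPow (h : NearConst z u u') : SubPow 0 u :=
  ((h.sub.mono (by norm_num)).add (subPow_const z)).congr fun l _ => by ring

theorem NearConst.mul (h : NearConst z u u') (h₂ : NearConst w v v') :
    NearConst (z * w) (fun l => u l * v l) fun l => u' l * v l + u l * v' l where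
  hasDerivAt := fun l hl => (h.hasDerivAt l hl).mul (h₂.hasDerivAt l hl)
  sub := by
    have h1 := h.sub.mul h₂.subPow
    rw [add_zero] at h1
    exact (h1.add (h₂.sub.const_mul z)).congr fun l _ => by ring
  sub_deriv := by
    have h1 := h.sub_deriv.mul h₂.subPow
    have h2 := h.subPow.mul h₂.sub_deriv
    rw [add_zero] at h1 h2
    exact h1.add h2

/-- In the derivative the term `(u - z) g'` is harmless: `g'` has the size of `1/l`, but `u - z`
vanishes to first order. -/
theorem LogAsymp.nearConst_mul (h : LogAsymp μ ν g g') (hu : NearConst z u u') :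
    LogAsymp (z * μ) (z * ν) (fun l => u l * g l) fun l => u' l * g l + u l * g' l where
  hasDerivAt := fun l hl => (hu.hasDerivAt l hl).mul (h.hasDerivAt l hl)
  sub := by
    have h1 := (hu.sub.mul h.subPow).mono (q' := 1 / 2) (by norm_num)
    exact (h1.add (h.sub.const_mul z)).congr fun l _ => by ring
  sub_deriv := by
    have h1 := (hu.sub_deriv.mul h.subPow).mono (q' := -(1 / 2)) (by norm_num)
    have h2 := (hu.sub.mul h.subPow_deriv).mono (q' := -(1 / 2)) (by norm_num)
    exact ((h1.add h2).add (h.sub_deriv.const_mul z)).congr fun l _ => by ring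

theorem LogAsymp.add (h : LogAsymp μ ν g g') (h₂ : LogAsymp μ₂ ν₂ g₂ g₂') :
    LogAsymp (μ + μ₂) (ν + ν₂) (fun l => g l + g₂ l) fun l => g' l + g₂' l where
  hasDerivAt := fun l hl => (h.hasDerivAt l hl).add (h₂.hasDerivAt l hl)
  sub := (h.sub.add h₂.sub).congr fun l _ => by ring
  sub_deriv := (h.sub_deriv.add h₂.sub_deriv).congr fun l _ => by ring

theorem LogAsymp.conj (h : LogAsymp μ ν g g') :
    LogAsymp ((starRingEnd ℂ) μ) ((starRingEnd ℂ) ν) (fun l => (starRingEnd ℂ) (g l))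
      fun l => (starRingEnd ℂ) (g' l) where
  hasDerivAt := fun l hl => hasDerivAt_conj (h.hasDerivAt l hl)
  sub := h.sub.conj.congr fun l _ => by simp
  sub_deriv := h.sub_deriv.conj.congr fun l _ => by simp

theorem LogAsymp.const_mul (h : LogAsymp μ ν g g') (z : ℂ) :
    LogAsymp (z * μ) (z * ν) (fun l => z * g l) fun l => z * g' l where
  hasDerivAt := fun l hl => (h.hasDerivAt l hl).const_mul z
  sub := (h.sub.const_mul z).congr fun l _ => by ring
  sub_deriv := (h.sub_deriv.const_mul z).congr fun l _ => by ring

theorem hasDerivAt_sqrt_mul {l : ℝ} {y : ℂ} (hl : 0 < l) (h : HasDerivAt g y l) :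
    HasDerivAt (fun l => (√l : ℂ) * g l) ((√l : ℂ)⁻¹ / 2 * g l + √l * y) l := by
  refine ((Real.hasDerivAt_sqrt hl.ne').ofReal_comp.mul h).congr_deriv ?_
  push_cast
  ring

theorem LogAsymp.sqrt_mul_sub (h : LogAsymp μ ν g g') :
    SubPow 1 fun l => √l * g l - √l * (μ + ν * Real.log l) := by
  have h1 := subPow_sqrt.mul h.sub
  norm_num at h1
  exact h1.congr fun l _ => by ring

/-- Differentiating `√l` contributes half of `μ + ν log l`, and `√l · ν / l` contributes another `ν
/ √l`. This is where the summand `2 i c₁` in `a'` originates. -/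
theorem LogAsymp.deriv_sqrt_mul_sub (h : LogAsymp μ ν g g') :
    SubPow 0 fun l => deriv (fun l => (√l : ℂ) * g l) l -
      (√l : ℂ)⁻¹ * (μ / 2 + ν + ν / 2 * Real.log l) := by
  have h1 := (subPow_inv_sqrt.mul h.sub).const_mul (1 / 2)
  have h2 := subPow_sqrt.mul h.sub_deriv
  norm_num at h1 h2
  refine (h1.add h2).congr fun l hl => ?_
  rw [(hasDerivAt_sqrt_mul hl (h.hasDerivAt l hl)).deriv]
  have hs : (√l : ℂ) ≠ 0 := by exact_mod_cast (Real.sqrt_pos.2 hl).ne'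
  have e2 : (√l : ℂ) ^ 2 = l := by exact_mod_cast Real.sq_sqrt hl.le
  have e3 : (√l : ℂ) * (l : ℂ)⁻¹ = (√l : ℂ)⁻¹ := by
    rw [← e2]
    field_simp
  linear_combination -ν * e3

end LogAsymp

/-! ### Low energy expansion of the coefficients at one end -/

section EndCoefficients

theorem q_pos : 0 < q := Real.rpow_pos_of_pos two_pos _

theorem q_sq : q ^ 2 = √2 := by
  rw [q, ← Real.rpow_natCast, ← Real.rpow_mul two_pos.le, Real.sqrt_eq_rpow]
  norm_num

/-- The low energy asymptotics of the coefficients belonging to one end. -/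
structure EndAsymptotics (A B : ℝ → ℂ) (κ : ℝ) : Prop where
  diff_fst : ∀ l > 0, DifferentiableAt ℝ A l
  diff_snd : ∀ l > 0, DifferentiableAt ℝ B l
  fst : SubPow 1 fun l => A l - q * c₀ * (√l : ℂ) *
    (1 + Complex.I * c₁ * (Real.log l : ℂ) + Complex.I * κ)
  snd : SubPow 1 fun l => B l - Complex.I * (q : ℂ)⁻¹ * c₀ * c₁ * (√l : ℂ)
  fst_deriv : SubPow 0 fun l => deriv A l - 1 / 2 * q * c₀ * (√l : ℂ)⁻¹ *
    (1 + Complex.I * κ + 2 * Complex.I * c₁ + Complex.I * c₁ * (Real.log l : ℂ))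
  snd_deriv : SubPow 0 fun l => deriv B l -
    Complex.I / 2 * (q : ℂ)⁻¹ * c₀ * c₁ * (√l : ℂ)⁻¹

/-- The coefficient of the first zero energy solution. -/
def endFst (c : ℝ → ℝ → ℂ × ℂ) (z₀ m l : ℝ) : ℂ :=
  √l * (q * (Complex.exp (-(Complex.I * m * l)) * (c l 0).1 * hankel 0 (l * z₀) +
    Complex.exp (-(Complex.I * m * l)) * (c l 0).2 * (starRingEnd ℂ) (hankel 0 (l * z₀))))

/-- The coefficient of the second zero energy solution. -/
def endSnd (c : ℝ → ℝ → ℂ × ℂ) (z₀ m l : ℝ) : ℂ :=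
  √l * ((q : ℂ)⁻¹ * (Complex.exp (-(Complex.I * m * l)) * (c l 0).1 *
      ((l * z₀ : ℝ) * hankel 1 (l * z₀)) +
    Complex.exp (-(Complex.I * m * l)) * (c l 0).2 *
      (starRingEnd ℂ) ((l * z₀ : ℝ) * hankel 1 (l * z₀))))

theorem nearConst_exp (m : ℝ) : NearConst 1 (fun l : ℝ => Complex.exp (-(Complex.I * m * l)))
    fun l : ℝ => Complex.exp (-(Complex.I * m * l)) * -(Complex.I * m) where
  hasDerivAt := fun l _ => by
    have h : HasDerivAt (fun l : ℝ => -(Complex.I * m * l)) (-(Complex.I * m)) l := by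
      exact ((Complex.ofRealCLM.hasDerivAt (x := l)).const_mul (Complex.I * m)).neg.congr_deriv
        (by simp)
    exact h.cexp
  sub := by
    refine subPow_of_norm_le (K := |m|) one_pos fun l hl _ => ?_
    have e : -(Complex.I * m * l) = Complex.I * ((-(m * l) : ℝ) : ℂ) := by push_cast; ring
    rw [e]
    refine Real.norm_exp_I_mul_ofReal_sub_one_le.trans_eq ?_
    rw [norm_neg, Real.norm_eq_abs, abs_mul, abs_of_pos hl, Real.rpow_one]
  sub_deriv := by
    refine subPow_of_norm_le (K := |m|) one_pos fun l hl _ => ?_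
    have e : -(Complex.I * m * l) = Complex.I * ((-(m * l) : ℝ) : ℂ) := by push_cast; ring
    rw [e, norm_mul, norm_exp_I_mul]
    simp

theorem logAsymp_hankel_zero {κ z₀ : ℝ} (hz₀ : 0 < z₀)
    (hκ : ∀ s : ℝ, 0 < s → s < 1 →
      ‖hankel 0 s - c₀ * (1 + Complex.I * κ + Complex.I * c₁ * Real.log s)‖ ≤ 8 * √s) :
    LogAsymp (c₀ * (1 + Complex.I * (κ + c₁ * Real.log z₀ : ℝ))) (Complex.I * c₀ * c₁)
      (fun l => hankel 0 (l * z₀)) fun l => z₀ * hankel 1 (l * z₀) where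
  hasDerivAt := fun l hl => by
    have h := (hasDerivAt_hankel 0 (mul_pos hl hz₀)).scomp l ((hasDerivAt_id l).mul_const z₀)
    simpa [Complex.real_smul, Function.comp_def] using h
  sub := by
    refine subPow_of_norm_le (K := 8 * √z₀) (inv_pos.2 hz₀) fun l hl hl1 => ?_
    have h1 := hκ (l * z₀) (mul_pos hl hz₀) (by
      calc l * z₀ < z₀⁻¹ * z₀ := by gcongr
        _ = 1 := inv_mul_cancel₀ hz₀.ne')
    rw [Real.log_mul hl.ne' hz₀.ne', Real.sqrt_mul hl.le] at h1
    have e : 8 * √z₀ * l ^ (1 / 2 : ℝ) = 8 * (√l * √z₀) := by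
      rw [← Real.sqrt_eq_rpow]
      ring
    rw [e]
    refine le_trans (le_of_eq ?_) h1
    congr 1
    push_cast
    ring
  sub_deriv := by
    refine subPow_of_norm_le (K := 4 * √z₀) (inv_pos.2 hz₀) fun l hl hl1 => ?_
    have h1 := norm_mul_hankel_one_sub_le (mul_pos hl hz₀) (by
      calc l * z₀ ≤ z₀⁻¹ * z₀ := by gcongr
        _ = 1 := inv_mul_cancel₀ hz₀.ne')
    rw [hankelBeta_eq, Real.sqrt_mul hl.le] at h1
    have hlc : (l : ℂ) ≠ 0 := by exact_mod_cast hl.ne'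
    have e : z₀ * hankel 1 (l * z₀) - Complex.I * c₀ * c₁ * (l : ℂ)⁻¹ =
        (l : ℂ)⁻¹ * (((l * z₀ : ℝ) : ℂ) * hankel 1 (l * z₀) - Complex.I * c₀ * c₁) := by
      push_cast
      field_simp
    rw [e, norm_mul, norm_inv, Complex.norm_real, Real.norm_of_nonneg hl.le]
    have e2 : l ^ (-(1 / 2) : ℝ) = l⁻¹ * √l := by
      rw [Real.sqrt_eq_rpow, ← Real.rpow_neg_one, ← Real.rpow_add hl]
      norm_num
    rw [e2]
    calc _ ≤ l⁻¹ * (4 * (√l * √z₀)) := by gcongr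
      _ = _ := by ring

/-- No logarithm appears: by Bessel's equation the derivative of `s H'` is `-s H`, which is `O(√s)`.
-/
theorem logAsymp_mul_hankel_one {z₀ : ℝ} (hz₀ : 0 < z₀) :
    LogAsymp (Complex.I * c₀ * c₁) 0 (fun l => ((l * z₀ : ℝ) : ℂ) * hankel 1 (l * z₀))
      fun l => -(z₀ * ((l * z₀ : ℝ) * hankel 0 (l * z₀))) where
  hasDerivAt := fun l hl => by
    have h := (hasDerivAt_mul_hankel_one (mul_pos hl hz₀)).scomp l ((hasDerivAt_id l).mul_const z₀)
    simpa [Complex.real_smul, Function.comp_def] using h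
  sub := by
    refine subPow_of_norm_le (K := 4 * √z₀) (inv_pos.2 hz₀) fun l hl hl1 => ?_
    have h1 := norm_mul_hankel_one_sub_le (mul_pos hl hz₀) (by
      calc l * z₀ ≤ z₀⁻¹ * z₀ := by gcongr
        _ = 1 := inv_mul_cancel₀ hz₀.ne')
    rw [hankelBeta_eq, Real.sqrt_mul hl.le] at h1
    have e : 4 * √z₀ * l ^ (1 / 2 : ℝ) = 4 * (√l * √z₀) := by
      rw [← Real.sqrt_eq_rpow]
      ring
    rw [e, zero_mul, add_zero]
    exact h1
  sub_deriv := by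
    refine SubPow.mono (p := 1 / 2) ?_ (by norm_num)
    refine subPow_of_norm_le (K := z₀ * √z₀) (inv_pos.2 hz₀) fun l hl hl1 => ?_
    have hs : 0 < l * z₀ := mul_pos hl hz₀
    have h1 := norm_hankel_zero_le hs
    rw [zero_mul, sub_zero, norm_neg, norm_mul, norm_mul, Complex.norm_real, Complex.norm_real,
      Real.norm_of_nonneg hz₀.le, Real.norm_of_nonneg hs.le, ← Real.sqrt_eq_rpow]
    calc _ ≤ z₀ * (l * z₀ * (1 / √(l * z₀))) := by gcongr
      _ = z₀ * √(l * z₀) := by rw [mul_one_div, Real.div_sqrt]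
      _ = _ := by rw [Real.sqrt_mul hl.le]; ring

/-- Including the phase, the first coefficient is `1 + O(l)` and the second is `O(l)`, so only the
terms with `H` and `s H'` at `s = l z₀` survive. Since `log (l z₀) = log l + log z₀`, the constant
of the Hankel function is shifted by `c₁ log z₀`. -/
theorem endAsymptotics {c : ℝ → ℝ → ℂ × ℂ} {d : ℝ → ℂ × ℂ} {κ z₀ K l₁ : ℝ} (m : ℝ) (hz₀ : 0 < z₀)
    (hκ : ∀ s : ℝ, 0 < s → s < 1 →
      ‖hankel 0 s - c₀ * (1 + Complex.I * κ + Complex.I * c₁ * Real.log s)‖ ≤ 8 * √s)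
    (hcd : ∀ l > 0, HasDerivAt (fun l => c l 0) (d l) l) (hl₁ : 0 < l₁)
    (hK : ∀ l, 0 < l → l < l₁ → ‖c l 0 - (1, 0)‖ ≤ K * l ∧ ‖d l‖ ≤ K) :
    EndAsymptotics (endFst c z₀ m) (endSnd c z₀ m) (κ + c₁ * Real.log z₀) := by
  have hu : NearConst 1 (fun l => (c l 0).1) fun l => (d l).1 :=
    { hasDerivAt := fun l hl =>
        (ContinuousLinearMap.fst ℝ ℂ ℂ).hasFDerivAt.comp_hasDerivAt l (hcd l hl)
      sub := subPow_of_norm_le (K := K) hl₁ fun l hl hl1 => by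
        rw [Real.rpow_one]
        exact (norm_fst_le (c l 0 - (1, 0))).trans (hK l hl hl1).1
      sub_deriv := subPow_of_norm_le (K := K) hl₁ fun l hl hl1 => by
        rw [Real.rpow_zero, mul_one]
        exact (norm_fst_le _).trans (hK l hl hl1).2 }
  have hv : NearConst 0 (fun l => (c l 0).2) fun l => (d l).2 :=
    { hasDerivAt := fun l hl =>
        (ContinuousLinearMap.snd ℝ ℂ ℂ).hasFDerivAt.comp_hasDerivAt l (hcd l hl)
      sub := subPow_of_norm_le (K := K) hl₁ fun l hl hl1 => by
        rw [Real.rpow_one]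
        exact (norm_snd_le (c l 0 - (1, 0))).trans (hK l hl hl1).1
      sub_deriv := subPow_of_norm_le (K := K) hl₁ fun l hl hl1 => by
        rw [Real.rpow_zero, mul_one]
        exact (norm_snd_le _).trans (hK l hl hl1).2 }
  have hA := logAsymp_hankel_zero hz₀ hκ
  have hB := logAsymp_mul_hankel_one hz₀
  have hA' := ((hA.nearConst_mul ((nearConst_exp m).mul hu)).add
    (hA.conj.nearConst_mul ((nearConst_exp m).mul hv))).const_mul (q : ℂ)
  have hB' := ((hB.nearConst_mul ((nearConst_exp m).mul hu)).add
    (hB.conj.nearConst_mul ((nearConst_exp m).mul hv))).const_mul (q : ℂ)⁻¹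
  constructor
  · exact fun l hl => (hasDerivAt_sqrt_mul hl (hA'.hasDerivAt l hl)).differentiableAt
  · exact fun l hl => (hasDerivAt_sqrt_mul hl (hB'.hasDerivAt l hl)).differentiableAt
  · refine hA'.sqrt_mul_sub.congr fun l _ => ?_
    rw [endFst]
    ring
  · refine hB'.sqrt_mul_sub.congr fun l _ => ?_
    rw [endSnd]
    ring
  · refine hA'.deriv_sqrt_mul_sub.congr fun l _ => ?_
    change _ = deriv (fun l => endFst c z₀ m l) l - _
    simp only [endFst]
    ring
  · refine hB'.deriv_sqrt_mul_sub.congr fun l _ => ?_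
    change _ = deriv (fun l => endSnd c z₀ m l) l - _
    simp only [endSnd]
    ring

end EndCoefficients

/-! ### The coordinate in which a conical end becomes an exact cone -/

section ConicalRadius

/-- The slope `1 / √2` of the radius of a right-angled cone as a function of arclength. -/
def coneSlope : ℝ := (√2)⁻¹

theorem coneSlope_pos : 0 < coneSlope := by unfold coneSlope; positivity

/-- `q` is the inverse square root of the slope. It normalises `√ϱ g` when `ϱ ~ coneSlope · Z`, and
becomes `q⁻¹` in the conormal derivative, where `ϱ ∂` brings out one factor of the slope. -/
theorem q_mul_coneSlope : q * coneSlope = q⁻¹ := by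
  have := q_pos
  rw [coneSlope, ← q_sq]
  field_simp

theorem q_mul_sqrt_coneSlope : q * √coneSlope = 1 := by
  rw [coneSlope, ← q_sq, Real.sqrt_inv, Real.sqrt_sq q_pos.le, mul_inv_cancel₀ q_pos.ne']

/-- A radius as a function of arclength, conical at `+∞`. -/
structure IsConicalRadius (ϱ ϱ₁ : ℝ → ℝ) : Prop where
  hasDerivAt : ∀ ξ, HasDerivAt ϱ (ϱ₁ ξ) ξ
  continuous : Continuous ϱ₁
  exists_le : ∃ δ > 0, ∀ ξ, δ ≤ ϱ ξ
  abs_le : ∀ ξ, |ϱ₁ ξ| ≤ 1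
  slope : ∃ C, ∀ ξ ≥ 0, |ϱ₁ ξ - coneSlope| ≤ C / (1 + ξ) ^ 2

/-- The logarithmic coordinate `∫₀^ξ ϱ⁻¹`. -/
def logCoord (ϱ : ℝ → ℝ) (ξ : ℝ) : ℝ := ∫ η in (0 : ℝ)..ξ, (ϱ η)⁻¹

theorem logCoord_zero (ϱ : ℝ → ℝ) : logCoord ϱ 0 = 0 := intervalIntegral.integral_same

theorem hasDerivAt_logCoord {ϱ : ℝ → ℝ} (hc : Continuous ϱ) (hpos : ∀ ξ, 0 < ϱ ξ) (ξ : ℝ) :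
    HasDerivAt (logCoord ϱ) (ϱ ξ)⁻¹ ξ := by
  have hi : Continuous fun ξ => (ϱ ξ)⁻¹ := hc.inv₀ fun ξ => (hpos ξ).ne'
  exact intervalIntegral.integral_hasDerivAt_right (hi.intervalIntegrable _ _)
    (hi.stronglyMeasurableAtFilter _ _) hi.continuousAt

theorem logCoord_neg (ϱ : ℝ → ℝ) (ξ : ℝ) :
    logCoord ϱ (-ξ) = -logCoord (fun η => ϱ (-η)) ξ := by
  rw [logCoord, logCoord, intervalIntegral.integral_comp_neg fun η => (ϱ η)⁻¹, neg_zero,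
    intervalIntegral.integral_symm]

/-- The radius grows at most linearly, so the integral of its inverse dominates a logarithm. -/
theorem tendsto_logCoord {ϱ : ℝ → ℝ} {a : ℝ} (hc : Continuous ϱ) (hpos : ∀ ξ, 0 < ϱ ξ)
    (ha : 0 < a) (hle : ∀ ξ ≥ 0, ϱ ξ ≤ a + ξ) : Tendsto (logCoord ϱ) atTop atTop := by
  have h1 : Tendsto (fun ξ => Real.log (a + ξ) - Real.log a) atTop atTop :=
    tendsto_atTop_add_const_right _ _
      (Real.tendsto_log_atTop.comp (tendsto_atTop_add_const_left _ a tendsto_id))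
  refine tendsto_atTop_mono' _ ?_ h1
  filter_upwards [eventually_ge_atTop 0] with ξ hξ
  have hd : ∀ x ≥ 0, HasDerivAt (fun x => logCoord ϱ x - Real.log (a + x))
      ((ϱ x)⁻¹ - 1 / (a + x)) x := fun x hx =>
    (hasDerivAt_logCoord hc hpos x).sub
      (((hasDerivAt_id x).const_add a).log (by simp only [id]; positivity))
  have hm : MonotoneOn (fun x => logCoord ϱ x - Real.log (a + x)) (Ici 0) := by
    refine monotoneOn_of_deriv_nonneg (convex_Ici 0)
      (fun x hx => (hd x hx).continuousAt.continuousWithinAt)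
      (fun x hx => (hd x (interior_subset hx)).differentiableAt.differentiableWithinAt)
      fun x hx => ?_
    have hx' : 0 ≤ x := interior_subset hx
    rw [(hd x hx').deriv, sub_nonneg, one_div]
    exact inv_anti₀ (hpos x) (hle x hx')
  have := hm (mem_Ici.2 le_rfl) (mem_Ici.2 hξ) hξ
  simp only [logCoord_zero, add_zero] at this
  linarith

variable {ϱ ϱ₁ : ℝ → ℝ}

theorem IsConicalRadius.pos (h : IsConicalRadius ϱ ϱ₁) (ξ : ℝ) : 0 < ϱ ξ :=
  let ⟨_, hδ, hle⟩ := h.exists_le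
  hδ.trans_le (hle ξ)

theorem IsConicalRadius.cont (h : IsConicalRadius ϱ ϱ₁) : Continuous ϱ :=
  continuous_iff_continuousAt.2 fun ξ => (h.hasDerivAt ξ).continuousAt

theorem IsConicalRadius.le_add_abs (h : IsConicalRadius ϱ ϱ₁) (ξ : ℝ) : ϱ ξ ≤ ϱ 0 + |ξ| := by
  have := Convex.norm_image_sub_le_of_norm_hasDerivWithin_le (f := ϱ) (f' := ϱ₁) (C := 1)
    (s := univ) (x := 0) (y := ξ) (fun x _ => (h.hasDerivAt x).hasDerivWithinAt)
    (fun x _ => h.abs_le x) convex_univ (mem_univ _) (mem_univ _)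
  rw [Real.norm_eq_abs, Real.norm_eq_abs, one_mul, sub_zero] at this
  linarith [le_abs_self (ϱ ξ - ϱ 0)]

/-- The logarithmic coordinate as an order isomorphism of the line. -/
theorem IsConicalRadius.exists_orderIso (h : IsConicalRadius ϱ ϱ₁) :
    ∃ θ : ℝ ≃o ℝ, ∀ ξ, θ ξ = logCoord ϱ ξ := by
  have hd := hasDerivAt_logCoord h.cont h.pos
  have hm : StrictMono (logCoord ϱ) := strictMono_of_deriv_pos fun x => by
    rw [(hd x).deriv]
    exact inv_pos.2 (h.pos x)
  have htop : Tendsto (logCoord ϱ) atTop atTop :=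
    tendsto_logCoord h.cont h.pos (h.pos 0) fun ξ hξ => by
      simpa [abs_of_nonneg hξ] using h.le_add_abs ξ
  have hbot : Tendsto (logCoord ϱ) atBot atBot := by
    have h1 : Tendsto (logCoord fun η => ϱ (-η)) atTop atTop :=
      tendsto_logCoord (h.cont.comp continuous_neg) (fun ξ => h.pos _) (h.pos 0) fun ξ hξ => by
        simpa [abs_of_nonneg hξ] using h.le_add_abs (-ξ)
    have h2 := tendsto_neg_atTop_atBot.comp (h1.comp tendsto_neg_atBot_atTop)
    refine h2.congr fun ξ => ?_
    have := logCoord_neg ϱ (-ξ)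
    rw [neg_neg] at this
    exact this.symm
  have hs : Function.Surjective (logCoord ϱ) :=
    (continuous_iff_continuousAt.2 fun x => (hd x).continuousAt).surjective htop hbot
  exact ⟨StrictMono.orderIsoOfSurjective _ hm hs, fun ξ => rfl⟩

/-- The coordinate `Z ~ ξ`, in which the end is asymptotically an exact cone, and its inverse. -/
structure IsConeCoord (ϱ ϱ₁ Z Ξ : ℝ → ℝ) (m : ℝ) : Prop where
  pos : ∀ ξ, 0 < Z ξ
  hasDerivAt : ∀ ξ, HasDerivAt Z (coneSlope * Z ξ / ϱ ξ) ξ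
  lt : ∀ ξ > 0, Z 0 < Z ξ
  left_inv : ∀ ξ, Ξ (Z ξ) = ξ
  hasDerivAt_inv : ∀ z > Z 0, HasDerivAt Ξ (ϱ (Ξ z) / (coneSlope * z)) z
  tendsto : Tendsto Z atTop atTop
  tendsto_sub : Tendsto (fun ξ => Z ξ - ξ) atTop (𝓝 m)
  tendsto_div : Tendsto (fun ξ => ϱ ξ / (coneSlope * Z ξ)) atTop (𝓝 1)
  bound : ∃ C, 0 ≤ C ∧ ∀ z > Z 0, |1 - (ϱ (Ξ z) / (coneSlope * z)) ^ 2| ≤ C / z ^ 2 ∧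
    |2 * ϱ (Ξ z) ^ 2 * (ϱ₁ (Ξ z) - coneSlope) / (coneSlope ^ 3 * z ^ 3)| ≤ C / z ^ 3

/-- The derivative is `(ϱ₁ - coneSlope) / ϱ`, which is integrable. The limit fixes the
multiplicative constant in `Z`. -/
theorem IsConicalRadius.exists_tendsto_log (h : IsConicalRadius ϱ ϱ₁) :
    ∃ L, Tendsto (fun ξ => Real.log (ϱ ξ) - coneSlope * logCoord ϱ ξ) atTop (𝓝 L) := by
  obtain ⟨C, hC⟩ := h.slope
  have hd : ∀ ξ, HasDerivAt (fun ξ => Real.log (ϱ ξ) - coneSlope * logCoord ϱ ξ)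
      ((ϱ₁ ξ - coneSlope) / ϱ ξ) ξ := fun ξ => by
    refine (((h.hasDerivAt ξ).log (h.pos ξ).ne').sub
      ((hasDerivAt_logCoord h.cont h.pos ξ).const_mul coneSlope)).congr_deriv ?_
    have := (h.pos ξ).ne'
    field_simp
  obtain ⟨δ, hδ, hle⟩ := h.exists_le
  obtain ⟨L, hL, -⟩ := exists_tendsto_of_deriv_isBigO (n := 1) (x₀ := 0) (C := |C| / δ) one_pos
    le_rfl (fun x _ => hd x) fun x hx => by
      have hx : 0 < x := hx
      rw [norm_div, Real.norm_eq_abs, Real.norm_of_nonneg (h.pos x).le]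
      calc |ϱ₁ x - coneSlope| / ϱ x ≤ |C| / x ^ 2 / δ := by
            gcongr
            · refine (hC x hx.le).trans ?_
              gcongr
              · exact le_abs_self C
              · linarith
            · exact hle x
        _ = _ := by ring
  exact ⟨L, hL⟩

theorem IsConicalRadius.exists_isConeCoord (h : IsConicalRadius ϱ ϱ₁) :
    ∃ Z Ξ m, IsConeCoord ϱ ϱ₁ Z Ξ m := by
  obtain ⟨θ, hθ⟩ := h.exists_orderIso
  obtain ⟨L, hL⟩ := h.exists_tendsto_log
  obtain ⟨C, hC⟩ := h.slope
  have hk := coneSlope_pos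
  have hθd : ∀ ξ, HasDerivAt θ (ϱ ξ)⁻¹ ξ := fun ξ => by
    rw [funext hθ]
    exact hasDerivAt_logCoord h.cont h.pos ξ
  have hθ0 : θ 0 = 0 := by rw [hθ, logCoord_zero]
  -- Chosen so that `ϱ / (coneSlope · Z) = exp (log ϱ - coneSlope · θ - L) → 1`.
  set z₀ : ℝ := Real.exp L / coneSlope with hz₀
  have hz₀p : 0 < z₀ := by positivity
  set Z : ℝ → ℝ := fun ξ => z₀ * Real.exp (coneSlope * θ ξ) with hZ
  set Ξ : ℝ → ℝ := fun z => θ.symm (Real.log (z / z₀) / coneSlope) with hΞ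
  have hZpos : ∀ ξ, 0 < Z ξ := fun ξ => by positivity
  have hZ0 : Z 0 = z₀ := by simp [hZ, hθ0]
  have hZd : ∀ ξ, HasDerivAt Z (coneSlope * Z ξ / ϱ ξ) ξ := fun ξ => by
    refine (((hθd ξ).const_mul coneSlope).exp.const_mul z₀).congr_deriv ?_
    simp only [hZ]
    ring
  have hZm : StrictMono Z := fun x y hxy => by
    simp only [hZ]
    gcongr
  have hinv : ∀ ξ, Ξ (Z ξ) = ξ := fun ξ => by
    simp only [hΞ, hZ]
    rw [mul_div_cancel_left₀ _ hz₀p.ne', Real.log_exp, mul_div_cancel_left₀ _ hk.ne',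
      θ.symm_apply_apply]
  have hinv' : ∀ z > 0, Z (Ξ z) = z := fun z hz => by
    simp only [hΞ, hZ]
    rw [θ.apply_symm_apply, mul_div_cancel₀ _ hk.ne', Real.exp_log (by positivity),
      mul_div_cancel₀ _ hz₀p.ne']
  have hΞpos : ∀ z > z₀, 0 < Ξ z := fun z hz => by
    rw [← hZm.lt_iff_lt, hinv' z (hz₀p.trans hz), hZ0]
    exact hz
  have hΞc : ∀ z > 0, ContinuousAt Ξ z := fun z hz => by
    refine θ.symm.continuous.continuousAt.comp ?_
    exact ((Real.continuousAt_log (by positivity)).comp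
      (continuousAt_id.div_const _)).div_const _
  have hΞd : ∀ z > 0, HasDerivAt Ξ (ϱ (Ξ z) / (coneSlope * z)) z := fun z hz => by
    refine ((hZd (Ξ z)).of_local_left_inverse (hΞc z hz) ?_ ?_).congr_deriv ?_
    · rw [hinv' z hz]
      exact (div_pos (mul_pos hk hz) (h.pos _)).ne'
    · filter_upwards [lt_mem_nhds hz] with y hy using hinv' y hy
    · rw [hinv' z hz, inv_div]
  have hZt : Tendsto Z atTop atTop :=
    (Real.tendsto_exp_atTop.comp (θ.tendsto_atTop.const_mul_atTop hk)).const_mul_atTop hz₀p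
  have hdiv : Tendsto (fun ξ => ϱ ξ / (coneSlope * Z ξ)) atTop (𝓝 1) := by
    have h1 := ((Real.continuous_exp.tendsto L).comp hL).div_const (Real.exp L)
    rw [div_self (Real.exp_pos L).ne'] at h1
    refine h1.congr fun ξ => ?_
    simp only [Function.comp_apply, hZ, hz₀]
    rw [Real.exp_sub, Real.exp_log (h.pos ξ), ← hθ]
    field_simp
  have hΞt : Tendsto Ξ atTop atTop := by
    refine θ.symm.tendsto_atTop.comp (Tendsto.atTop_div_const hk (Real.tendsto_log_atTop.comp ?_))
    exact tendsto_id.atTop_div_const hz₀p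
  have hC0 : 0 ≤ C := by
    have := (abs_nonneg _).trans (hC 0 le_rfl)
    simpa using this
  set K : ℝ := 2 * ((1 + ϱ 0) ^ 2 * C) / coneSlope ^ 3 with hK
  have hϱ0 := h.pos 0
  have hb' : ∀ z > z₀, |2 * ϱ (Ξ z) ^ 2 * (ϱ₁ (Ξ z) - coneSlope) / (coneSlope ^ 3 * z ^ 3)| ≤
      K / z ^ 3 := fun z hz => by
    have hz' : 0 < z := hz₀p.trans hz
    have hx := hΞpos z hz
    have h1 := h.le_add_abs (Ξ z)
    rw [abs_of_pos hx] at h1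
    have h2 := h.pos (Ξ z)
    have h3 : ϱ (Ξ z) ^ 2 * |ϱ₁ (Ξ z) - coneSlope| ≤ (1 + ϱ 0) ^ 2 * C := by
      calc _ ≤ ((1 + ϱ 0) * (1 + Ξ z)) ^ 2 * (C / (1 + Ξ z) ^ 2) := by
            gcongr
            · nlinarith
            · exact hC _ hx.le
        _ = _ := by field_simp
    rw [abs_div, abs_mul, abs_mul, abs_of_pos (by positivity : 0 < coneSlope ^ 3 * z ^ 3),
      abs_of_pos (two_pos), abs_of_nonneg (sq_nonneg _), hK, div_div]
    gcongr ?_ / _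
    linarith
  -- The derivative of `1 - (ϱ/(coneSlope z))²` in `z` contains only the slope error `ϱ₁ -
  -- coneSlope` and is `O(z⁻³)`. Integrating from infinity, where the normalisation makes the
  -- function vanish, gives `O(z⁻²)`.
  have hbound : ∀ z > z₀, |1 - (ϱ (Ξ z) / (coneSlope * z)) ^ 2| ≤ K / 2 / z ^ 2 := by
    have hed : ∀ z > z₀, HasDerivAt (fun z => 1 - (ϱ (Ξ z) / (coneSlope * z)) ^ 2)
        (-(2 * ϱ (Ξ z) ^ 2 * (ϱ₁ (Ξ z) - coneSlope) / (coneSlope ^ 3 * z ^ 3))) z := fun z hz => by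
      have hz' : 0 < z := hz₀p.trans hz
      refine (((((h.hasDerivAt (Ξ z)).comp z (hΞd z hz')).div
        ((hasDerivAt_id z).const_mul coneSlope) (mul_pos hk hz').ne').pow 2).const_sub
          1).congr_deriv ?_
      simp only [Function.comp_apply, id, Pi.div_apply, Nat.add_one_sub_one, pow_one]
      have := hz'.ne'
      push_cast
      field_simp
    obtain ⟨M, hM, hb⟩ := exists_tendsto_of_deriv_isBigO (n := 2) (C := K) two_pos hz₀p.le hed
      fun z hz => by
        rw [Real.norm_eq_abs, abs_neg]
        exact hb' z hz
    have hM0 : M = 0 := by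
      refine tendsto_nhds_unique hM ?_
      have h1 : Tendsto (fun z => 1 - (ϱ (Ξ z) / (coneSlope * Z (Ξ z))) ^ 2) atTop (𝓝 0) := by
        simpa using ((hdiv.comp hΞt).pow 2).const_sub 1
      refine h1.congr' ?_
      filter_upwards [eventually_gt_atTop 0] with z hz
      rw [hinv' z hz]
    intro z hz
    have := hb z hz
    rw [hM0, sub_zero, Real.norm_eq_abs] at this
    exact_mod_cast this
  -- The derivative of `z - Ξ z` is `1 - w` with `w = ϱ/(coneSlope z) > 0`, and `|1 - w| ≤ |1 - w²|
  -- = O(z⁻²)`.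
  have hsub : ∃ m, Tendsto (fun ξ => Z ξ - ξ) atTop (𝓝 m) := by
    obtain ⟨M, hM, -⟩ := exists_tendsto_of_deriv_isBigO (n := 1) (C := K / 2) (x₀ := z₀)
      (f := fun z => z - Ξ z) one_pos hz₀p.le
      (fun z hz => (hasDerivAt_id z).sub (hΞd z (hz₀p.trans hz))) fun z hz => by
        have hz' : 0 < z := hz₀p.trans hz
        refine le_trans ?_ (hbound z hz)
        have hw : 0 < ϱ (Ξ z) / (coneSlope * z) := div_pos (h.pos _) (mul_pos hk hz')
        have e : 1 - (ϱ (Ξ z) / (coneSlope * z)) ^ 2 =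
          (1 - ϱ (Ξ z) / (coneSlope * z)) * (1 + ϱ (Ξ z) / (coneSlope * z)) := by ring
        rw [e, abs_mul, Real.norm_eq_abs]
        refine le_mul_of_one_le_right (abs_nonneg _) ?_
        rw [abs_of_pos (by positivity)]
        linarith
    refine ⟨M, (hM.comp hZt).congr fun ξ => ?_⟩
    simp only [Function.comp_apply, hinv]
  obtain ⟨m, hm⟩ := hsub
  have hK0 : 0 ≤ K := by positivity
  refine ⟨Z, Ξ, m, ⟨hZpos, hZd, fun ξ hξ => hZm hξ, hinv, ?_, hZt, hm, hdiv, K, hK0, ?_⟩⟩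
  · rw [hZ0]
    exact fun z hz => hΞd z (hz₀p.trans hz)
  · rw [hZ0]
    refine fun z hz => ⟨(hbound z hz).trans ?_, hb' z hz⟩
    gcongr
    linarith

end ConicalRadius

/-! ### The radial Laplace equation as a first order system -/

section RadialSystem

variable {ϱ ϱ₁ ϱ₂ V : ℝ → ℝ} {l : ℝ} {g p y Y : ℝ → ℂ}

/-- The Laplace equation `(ϱ ∂)² g = -l² ϱ² g` on the half line as a first order system. -/
structure IsRadialSystem (ϱ : ℝ → ℝ) (l : ℝ) (g p : ℝ → ℂ) : Prop where
  cont_fst : ContinuousOn g (Ici 0)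
  cont_snd : ContinuousOn p (Ici 0)
  deriv_fst : ∀ ξ > 0, HasDerivAt g (p ξ / ϱ ξ) ξ
  deriv_snd : ∀ ξ > 0, HasDerivAt p (-(l ^ 2 * ϱ ξ * g ξ)) ξ

/-- The equations hold only on the open half line, where the coefficients are differentiable.
Continuity at `0` carries the conservation law to the endpoint, where the data are read off. -/
theorem IsRadialSystem.wronskian_eq (h : IsRadialSystem ϱ l g p) (h' : IsRadialSystem ϱ l y Y)
    {ξ : ℝ} (hξ : 0 ≤ ξ) : g ξ * Y ξ - p ξ * y ξ = g 0 * Y 0 - p 0 * y 0 := by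
  have key := intervalIntegral.integral_eq_sub_of_hasDeriv_right (a := 0) (b := ξ)
    (f := fun ξ => g ξ * Y ξ - p ξ * y ξ) (f' := fun _ => 0) ?_ ?_ ?_
  · rw [intervalIntegral.integral_zero] at key
    exact (sub_eq_zero.1 key.symm)
  · rw [uIcc_of_le hξ]
    exact (((h.cont_fst.mul h'.cont_snd).sub (h.cont_snd.mul h'.cont_fst))).mono Icc_subset_Ici_self
  · intro x hx
    rw [min_eq_left hξ] at hx
    refine HasDerivAt.hasDerivWithinAt ?_
    refine (((h.deriv_fst x hx.1).mul (h'.deriv_snd x hx.1)).sub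
      ((h.deriv_snd x hx.1).mul (h'.deriv_fst x hx.1))).congr_deriv ?_
    ring
  · exact intervalIntegrable_const

/-- The hypothesis on `V` says `V = (√ϱ)''/√ϱ`, so `u = √ϱ g` satisfies `(ϱ g')' = -l² ϱ g`. The
second component is the conormal derivative `ϱ g'`. -/
theorem IsSolution.isRadialSystem {u : ℝ → ℝ} (hu : IsSolution V l u) (hpos : ∀ ξ, 0 < ϱ ξ)
    (h₁ : ∀ ξ, HasDerivAt ϱ (ϱ₁ ξ) ξ) (h₂ : ∀ ξ, HasDerivAt ϱ₁ (ϱ₂ ξ) ξ)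
    (hV : ∀ ξ, V ξ = ϱ₂ ξ / (2 * ϱ ξ) - ϱ₁ ξ ^ 2 / (4 * ϱ ξ ^ 2)) :
    IsRadialSystem ϱ l (fun ξ => ((u ξ / √(ϱ ξ) : ℝ) : ℂ))
      fun ξ => ((√(ϱ ξ) * deriv u ξ - u ξ * (ϱ₁ ξ / (2 * √(ϱ ξ))) : ℝ) : ℂ) := by
  have hs : ∀ ξ, HasDerivAt (fun ξ => √(ϱ ξ)) (ϱ₁ ξ / (2 * √(ϱ ξ))) ξ := fun ξ =>
    (h₁ ξ).sqrt (hpos ξ).ne'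
  have hsp : ∀ ξ, 0 < √(ϱ ξ) := fun ξ => Real.sqrt_pos.2 (hpos ξ)
  have hd1 : ∀ ξ, HasDerivAt (fun ξ => u ξ / √(ϱ ξ))
      ((√(ϱ ξ) * deriv u ξ - u ξ * (ϱ₁ ξ / (2 * √(ϱ ξ)))) / ϱ ξ) ξ := fun ξ => by
    refine ((hu.hasDerivAt ξ).div (hs ξ) (hsp ξ).ne').congr_deriv ?_
    rw [Real.sq_sqrt (hpos ξ).le]
    ring
  have hd2 : ∀ ξ, HasDerivAt (fun ξ => √(ϱ ξ) * deriv u ξ - u ξ * (ϱ₁ ξ / (2 * √(ϱ ξ))))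
      (-(l ^ 2 * ϱ ξ * (u ξ / √(ϱ ξ)))) ξ := fun ξ => by
    refine (((hs ξ).mul (hu.hasDerivAt_deriv ξ)).sub ((hu.hasDerivAt ξ).mul
      ((h₂ ξ).div ((hs ξ).const_mul 2) (by have := hsp ξ; positivity)))).congr_deriv ?_
    have h0 := (hsp ξ).ne'
    have e : ϱ ξ = √(ϱ ξ) ^ 2 := (Real.sq_sqrt (hpos ξ).le).symm
    rw [hV, smul_eq_mul, Pi.div_apply]
    set w := √(ϱ ξ)
    rw [e]
    field_simp
    ring
  refine ⟨?_, ?_, fun ξ _ => ?_, fun ξ _ => ?_⟩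
  · exact (continuous_iff_continuousAt.2 fun ξ => (hd1 ξ).ofReal_comp.continuousAt).continuousOn
  · exact (continuous_iff_continuousAt.2 fun ξ => (hd2 ξ).ofReal_comp.continuousAt).continuousOn
  · exact (hd1 ξ).ofReal_comp.congr_deriv (by push_cast; rfl)
  · exact (hd2 ξ).ofReal_comp.congr_deriv (by push_cast; rfl)

end RadialSystem

/-! ### The Jost solution of the radial equation at a conical end -/

section ConeJost

variable {ϱ ϱ₁ Z Ξ : ℝ → ℝ} {m l : ℝ} {c : ℝ → ℂ × ℂ}

/-- The Jost solution in terms of the variation of constants `c`. -/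
def coneFst (c : ℝ → ℂ × ℂ) (Z : ℝ → ℝ) (m l ξ : ℝ) : ℂ :=
  √l * (q * (Complex.exp (-(Complex.I * m * l)) * (c (l * Z ξ - l * Z 0)).1 * hankel 0 (l * Z ξ) +
    Complex.exp (-(Complex.I * m * l)) * (c (l * Z ξ - l * Z 0)).2 *
      (starRingEnd ℂ) (hankel 0 (l * Z ξ))))

/-- The conormal derivative of `coneFst`. -/
def coneSnd (c : ℝ → ℂ × ℂ) (Z : ℝ → ℝ) (m l ξ : ℝ) : ℂ :=
  √l * ((q : ℂ)⁻¹ * (Complex.exp (-(Complex.I * m * l)) * (c (l * Z ξ - l * Z 0)).1 *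
      ((l * Z ξ : ℝ) * hankel 1 (l * Z ξ)) +
    Complex.exp (-(Complex.I * m * l)) * (c (l * Z ξ - l * Z 0)).2 *
      (starRingEnd ℂ) ((l * Z ξ : ℝ) * hankel 1 (l * Z ξ))))

/-- Variation of constants: the coefficient system is chosen so that `x' H + y' H̄ = 0` and, by the
Wronskian `-2i`, `x' s H' + y' s H̄'` equals `e s g`. The first identity makes the conormal
derivative free of `x', y'`, the second produces the perturbation. -/
theorem isRadialSystem_cone (h : IsConicalRadius ϱ ϱ₁) (hZ : IsConeCoord ϱ ϱ₁ Z Ξ m) (hl : 0 < l)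
    (hc : Continuous c)
    (hcd : ∀ t > 0, HasDerivAt c (coeffMap ((1 - (ϱ (Ξ (Z 0 + t / l)) /
      (coneSlope * (Z 0 + t / l))) ^ 2) • hankelQuad (t + l * Z 0)) (c t)) t) :
    IsRadialSystem ϱ l (coneFst c Z m l) (coneSnd c Z m l) := by
  have hs : ∀ ξ, 0 < l * Z ξ := fun ξ => mul_pos hl (hZ.pos ξ)
  have hsd : ∀ ξ, HasDerivAt (fun ξ => l * Z ξ) (coneSlope * (l * Z ξ) / ϱ ξ) ξ := fun ξ =>
    ((hZ.hasDerivAt ξ).const_mul l).congr_deriv (by ring)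
  have hH : ∀ ξ, HasDerivAt (fun ξ => hankel 0 (l * Z ξ))
      (coneSlope / ϱ ξ * ((l * Z ξ : ℝ) * hankel 1 (l * Z ξ))) ξ := fun ξ => by
    refine ((hasDerivAt_hankel 0 (hs ξ)).scomp ξ (hsd ξ)).congr_deriv ?_
    rw [Complex.real_smul]
    push_cast
    ring
  have hH1 : ∀ ξ, HasDerivAt (fun ξ => ((l * Z ξ : ℝ) : ℂ) * hankel 1 (l * Z ξ))
      (-(coneSlope * l ^ 2 * Z ξ ^ 2 / ϱ ξ * hankel 0 (l * Z ξ))) ξ := fun ξ => by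
    refine ((hasDerivAt_mul_hankel_one (hs ξ)).scomp ξ (hsd ξ)).congr_deriv ?_
    rw [Complex.real_smul]
    push_cast
    ring
  have hσ : ∀ ξ, HasDerivAt (fun ξ => l * Z ξ - l * Z 0) (coneSlope * (l * Z ξ) / ϱ ξ) ξ :=
    fun ξ => (hsd ξ).sub_const _
  have hcc : Continuous fun ξ => c (l * Z ξ - l * Z 0) :=
    hc.comp (continuous_iff_continuousAt.2 fun ξ => (hσ ξ).continuousAt)
  have hHc : Continuous fun ξ => hankel 0 (l * Z ξ) :=
    continuous_iff_continuousAt.2 fun ξ => (hH ξ).continuousAt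
  have hH1c : Continuous fun ξ => ((l * Z ξ : ℝ) : ℂ) * hankel 1 (l * Z ξ) :=
    continuous_iff_continuousAt.2 fun ξ => (hH1 ξ).continuousAt
  have hcd' : ∀ ξ > 0, HasDerivAt (fun ξ => c (l * Z ξ - l * Z 0))
      ((coneSlope * (l * Z ξ) / ϱ ξ) • coeffMap ((1 - (ϱ ξ / (coneSlope * Z ξ)) ^ 2) •
        hankelQuad (l * Z ξ)) (c (l * Z ξ - l * Z 0))) ξ := fun ξ hξ => by
    have ht : 0 < l * Z ξ - l * Z 0 := sub_pos.2 (mul_lt_mul_of_pos_left (hZ.lt ξ hξ) hl)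
    have h1 := (hcd _ ht).scomp ξ (hσ ξ)
    have e : Z 0 + (l * Z ξ - l * Z 0) / l = Z ξ := by
      field_simp
      ring
    rw [e, hZ.left_inv, sub_add_cancel] at h1
    exact h1
  have hc1 := fun ξ hξ => (ContinuousLinearMap.fst ℝ ℂ ℂ).hasFDerivAt.comp_hasDerivAt ξ (hcd' ξ hξ)
  have hc2 := fun ξ hξ => (ContinuousLinearMap.snd ℝ ℂ ℂ).hasFDerivAt.comp_hasDerivAt ξ (hcd' ξ hξ)
  have hq0 : (q : ℂ) ≠ 0 := by exact_mod_cast q_pos.ne'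
  have hk0 : (coneSlope : ℂ) ≠ 0 := by exact_mod_cast coneSlope_pos.ne'
  have hqk : (q : ℂ) * coneSlope = (q : ℂ)⁻¹ := by exact_mod_cast q_mul_coneSlope
  have hconj : Continuous (starRingEnd ℂ) := Complex.continuous_conj
  refine ⟨?_, ?_, fun ξ hξ => ?_, fun ξ hξ => ?_⟩
  · refine Continuous.continuousOn ?_
    exact continuous_const.mul (continuous_const.mul (((continuous_const.mul hcc.fst).mul hHc).add
      ((continuous_const.mul hcc.snd).mul (hconj.comp hHc))))
  · refine Continuous.continuousOn ?_
    exact continuous_const.mul (continuous_const.mul (((continuous_const.mul hcc.fst).mul hH1c).add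
      ((continuous_const.mul hcc.snd).mul (hconj.comp hH1c))))
  · refine ((((hc1 ξ hξ).const_mul _).mul (hH ξ)).add
      (((hc2 ξ hξ).const_mul _).mul (hasDerivAt_conj (hH ξ)))).const_mul (q : ℂ) |>.const_mul
        (√l : ℂ) |>.congr_deriv ?_
    simp only [coneSnd, coeffMap_apply, hankelQuad, ContinuousLinearMap.coe_fst',
      ContinuousLinearMap.coe_snd', Function.comp_apply, Prod.smul_fst, Prod.smul_snd,
      Complex.real_smul, map_mul, map_div₀, Complex.conj_ofReal]
    push_cast
    set E := Complex.exp (-(Complex.I * m * l))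
    set H := hankel 0 (l * Z ξ)
    set H₁ := hankel 1 (l * Z ξ)
    set a := (c (l * Z ξ - l * Z 0)).1
    set b := (c (l * Z ξ - l * Z 0)).2
    linear_combination (√l * E / ϱ ξ * (a * (l * Z ξ * H₁) +
      b * (l * Z ξ * (starRingEnd ℂ) H₁))) * hqk
  · refine ((((hc1 ξ hξ).const_mul _).mul (hH1 ξ)).add
      (((hc2 ξ hξ).const_mul _).mul (hasDerivAt_conj (hH1 ξ)))).const_mul (q : ℂ)⁻¹ |>.const_mul
        (√l : ℂ) |>.congr_deriv ?_
    simp only [coneFst, coeffMap_apply, hankelQuad, ContinuousLinearMap.coe_fst',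
      ContinuousLinearMap.coe_snd', Function.comp_apply, Prod.smul_fst, Prod.smul_snd,
      Complex.real_smul, map_mul, map_div₀, map_neg, map_pow, Complex.conj_ofReal]
    push_cast
    have hW := hankel_wronskian (hs ξ)
    simp only [map_mul, Complex.conj_ofReal] at hW
    push_cast at hW
    set E := Complex.exp (-(Complex.I * m * l))
    set H := hankel 0 (l * Z ξ)
    set H₁ := hankel 1 (l * Z ξ)
    set a := (c (l * Z ξ - l * Z 0)).1
    set b := (c (l * Z ξ - l * Z 0)).2
    have hR : (ϱ ξ : ℂ) ≠ 0 := by exact_mod_cast (h.pos ξ).ne'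
    have hz : (Z ξ : ℂ) ≠ 0 := by exact_mod_cast (hZ.pos ξ).ne'
    have hII : Complex.I * Complex.I⁻¹ = 1 := mul_inv_cancel₀ Complex.I_ne_zero
    have hq2 : (q : ℂ)⁻¹ * (coneSlope : ℂ)⁻¹ = q := by
      rw [← hqk]
      field_simp
    -- The perturbation term is the difference between the weight of the exact cone and that of `ϱ`,
    -- so adding it replaces the former by the latter.
    have hT : coneSlope * (l * Z ξ) / ϱ ξ * (1 - (ϱ ξ / (coneSlope * Z ξ)) ^ 2) * (l * Z ξ) =
        coneSlope * l ^ 2 * Z ξ ^ 2 / ϱ ξ - (l ^ 2 * ϱ ξ / coneSlope : ℂ) := by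
      field_simp
    linear_combination (-(√l * E * (a * H + b * (starRingEnd ℂ) H)) * (q : ℂ)⁻¹ *
        (coneSlope * (l * Z ξ) / ϱ ξ * (1 - (ϱ ξ / (coneSlope * Z ξ)) ^ 2) * (l * Z ξ)) /
        (2 * Complex.I)) * hW +
      (√l * E * (a * H + b * (starRingEnd ℂ) H)) * (q : ℂ)⁻¹ *
        (coneSlope * (l * Z ξ) / ϱ ξ * (1 - (ϱ ξ / (coneSlope * Z ξ)) ^ 2) * (l * Z ξ)) * hII +
      (√l * E * (a * H + b * (starRingEnd ℂ) H)) * (q : ℂ)⁻¹ * hT -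
      (√l * E * (a * H + b * (starRingEnd ℂ) H)) * l ^ 2 * ϱ ξ * hq2

/-- The second coefficient tends to zero and kills the incoming wave. The amplitude is fixed by `ϱ /
(coneSlope · Z) → 1`, and the factor `e^{-iml}` compensates the phase shift due to `Z - ξ → m`. -/
theorem tendsto_coneFst (h : IsConicalRadius ϱ ϱ₁) (hZ : IsConeCoord ϱ ϱ₁ Z Ξ m) (hl : 0 < l)
    (hc : Tendsto c atTop (𝓝 (1, 0))) :
    Tendsto (fun ξ : ℝ => Complex.exp (-(Complex.I * l * ξ)) * (√(ϱ ξ) * coneFst c Z m l ξ)) atTop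
      (𝓝 1) := by
  have hst : Tendsto (fun ξ => l * Z ξ) atTop atTop := hZ.tendsto.const_mul_atTop hl
  have hσt : Tendsto (fun ξ => l * Z ξ - l * Z 0) atTop atTop :=
    tendsto_atTop_add_const_right _ _ hst
  have hH : Tendsto (fun s : ℝ => (√s : ℂ) * (Complex.exp (-(Complex.I * s)) * hankel 0 s)) atTop
      (𝓝 1) := by
    rw [tendsto_iff_norm_sub_tendsto_zero]
    have h1 : Tendsto (fun s : ℝ => 1 / (4 * s)) atTop (𝓝 0) :=
      (tendsto_id.const_mul_atTop (by norm_num : (0 : ℝ) < 4)).const_div_atTop 1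
    refine squeeze_zero' (Eventually.of_forall fun _ => norm_nonneg _) ?_ h1
    filter_upwards [eventually_gt_atTop 0] with s hs using norm_hankel_zero_sub_le hs
  have hHs := hH.comp hst
  have hca := (Continuous.tendsto continuous_fst _).comp (hc.comp hσt)
  have hcb := (Continuous.tendsto continuous_snd _).comp (hc.comp hσt)
  have hdiv : Tendsto (fun ξ => ((√(ϱ ξ / (coneSlope * Z ξ)) : ℝ) : ℂ)) atTop (𝓝 1) := by
    have := (Complex.continuous_ofReal.tendsto _).comp
      ((Real.continuous_sqrt.tendsto 1).comp hZ.tendsto_div)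
    simpa [Function.comp_def] using this
  have hexp : Tendsto (fun ξ : ℝ => Complex.exp (Complex.I * (l * (Z ξ - ξ - m) : ℝ))) atTop
      (𝓝 1) := by
    have h1 : Tendsto (fun ξ => l * (Z ξ - ξ - m)) atTop (𝓝 0) := by
      simpa using (hZ.tendsto_sub.sub_const m).const_mul l
    have h2 : Continuous fun x : ℝ => Complex.exp (Complex.I * x) := by fun_prop
    simpa [Function.comp_def] using (h2.tendsto 0).comp h1
  have hrem : Tendsto (fun ξ : ℝ => (c (l * Z ξ - l * Z 0)).2 *
      (Complex.exp (-(2 * Complex.I * (l * Z ξ : ℝ))) * (starRingEnd ℂ) ((√(l * Z ξ) : ℂ) *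
        (Complex.exp (-(Complex.I * (l * Z ξ : ℝ))) * hankel 0 (l * Z ξ))))) atTop (𝓝 0) := by
    rw [tendsto_zero_iff_norm_tendsto_zero]
    have h1 := hcb.norm.mul hHs.norm
    simp only [norm_zero, zero_mul] at h1
    refine h1.congr fun ξ => ?_
    have e : -(2 * Complex.I * (l * Z ξ : ℝ)) = Complex.I * ((-(2 * (l * Z ξ)) : ℝ) : ℂ) := by
      push_cast
      ring
    rw [norm_mul, norm_mul, e, norm_exp_I_mul, one_mul, RCLike.norm_conj]
    rfl
  have := (hdiv.mul hexp).mul ((hca.mul hHs).add hrem)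
  simp only [mul_one, add_zero] at this
  refine this.congr fun ξ => ?_
  have hs : 0 < l * Z ξ := mul_pos hl (hZ.pos ξ)
  have e1 : ((√(ϱ ξ / (coneSlope * Z ξ)) : ℝ) : ℂ) * (√(l * Z ξ) : ℂ) = √(ϱ ξ) * √l * q := by
    have : √(ϱ ξ / (coneSlope * Z ξ)) * √(l * Z ξ) = √(ϱ ξ) * √l * q := by
      have h1 := Real.sqrt_pos.2 coneSlope_pos
      have h2 := Real.sqrt_pos.2 (hZ.pos ξ)
      rw [Real.sqrt_div (h.pos ξ).le, Real.sqrt_mul coneSlope_pos.le, Real.sqrt_mul hl.le]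
      have h3 := q_mul_sqrt_coneSlope
      field_simp
      linear_combination -√(ϱ ξ) * h3
    exact_mod_cast this
  have e2 : Complex.exp (Complex.I * (l * (Z ξ - ξ - m) : ℝ)) *
      Complex.exp (-(Complex.I * (l * Z ξ : ℝ))) =
      Complex.exp (-(Complex.I * l * ξ)) * Complex.exp (-(Complex.I * m * l)) := by
    rw [← Complex.exp_add, ← Complex.exp_add]
    push_cast
    ring_nf
  have e3 : Complex.exp (-(2 * Complex.I * (l * Z ξ : ℝ))) *
      (starRingEnd ℂ) (Complex.exp (-(Complex.I * (l * Z ξ : ℝ)))) =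
      Complex.exp (-(Complex.I * (l * Z ξ : ℝ))) := by
    rw [← Complex.exp_conj, ← Complex.exp_add, map_neg, map_mul, Complex.conj_I,
      Complex.conj_ofReal]
    ring_nf
  simp only [Function.comp_apply, coneFst, map_mul, Complex.conj_ofReal]
  set E := Complex.exp (-(Complex.I * m * l))
  set E₁ := Complex.exp (Complex.I * (l * (Z ξ - ξ - m) : ℝ))
  set E₂ := Complex.exp (-(Complex.I * (l * Z ξ : ℝ)))
  set E₃ := Complex.exp (-(2 * Complex.I * (l * Z ξ : ℝ)))
  set E₄ := Complex.exp (-(Complex.I * l * ξ))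
  set H := hankel 0 (l * Z ξ)
  set a := (c (l * Z ξ - l * Z 0)).1
  set b := (c (l * Z ξ - l * Z 0)).2
  linear_combination (E₁ * (a * E₂ * H + b * E₃ * (starRingEnd ℂ) E₂ * (starRingEnd ℂ) H)) * e1 +
    √(ϱ ξ) * √l * q * (a * H + b * (starRingEnd ℂ) H) * e2 +
    √(ϱ ξ) * √l * q * E₁ * b * (starRingEnd ℂ) H * e3

end ConeJost

/-! ### The connection coefficients at one end -/

section EndTheorem

variable {ϱ ϱ₁ ϱ₂ V : ℝ → ℝ}

/-- At a conical end the Jost solution is a combination of the two solutions with the Cauchy data of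
the zero energy solutions, with coefficients of known low energy asymptotics. -/
theorem IsConicalRadius.exists_endAsymptotics (h : IsConicalRadius ϱ ϱ₁)
    (h₂ : ∀ ξ, HasDerivAt ϱ₁ (ϱ₂ ξ) ξ)
    (hV : ∀ ξ, V ξ = ϱ₂ ξ / (2 * ϱ ξ) - ϱ₁ ξ ^ 2 / (4 * ϱ ξ ^ 2)) :
    ∃ (A B : ℝ → ℂ) (κ : ℝ), EndAsymptotics A B κ ∧ ∀ l > 0, ∀ u v : ℝ → ℝ,
      IsSolution V l u → IsSolution V l v → u 0 = √(ϱ 0) → deriv u 0 = ϱ₁ 0 / (2 * √(ϱ 0)) →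
      v 0 = 0 → deriv v 0 = (√(ϱ 0))⁻¹ →
      Tendsto (fun ξ : ℝ => Complex.exp (-(Complex.I * l * ξ)) * (A l * u ξ + B l * v ξ)) atTop
        (𝓝 1) := by
  obtain ⟨Z, Ξ, m, hZ⟩ := h.exists_isConeCoord
  obtain ⟨C, hC, hb⟩ := hZ.bound
  have hz₀ := hZ.pos 0
  have hk := coneSlope_pos
  obtain ⟨c, d, hc, hcd, K, l₁, hl₁, hK⟩ := exists_jost_coeff (z₀ := Z 0) (C := C)
    (e := fun z => 1 - (ϱ (Ξ z) / (coneSlope * z)) ^ 2)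
    (e' := fun z => -(2 * ϱ (Ξ z) ^ 2 * (ϱ₁ (Ξ z) - coneSlope) / (coneSlope ^ 3 * z ^ 3)))
    hz₀ hC (fun z hz => by
      have hz' : 0 < z := hz₀.trans hz
      refine (((((h.hasDerivAt (Ξ z)).comp z (hZ.hasDerivAt_inv z hz)).div
        ((hasDerivAt_id z).const_mul coneSlope) (mul_pos hk hz').ne').pow 2).const_sub
          1).congr_deriv ?_
      simp only [Function.comp_apply, id, Pi.div_apply, Nat.add_one_sub_one, pow_one]
      have := hz'.ne'
      push_cast
      field_simp)
    (by
      have hΞ : ContinuousOn Ξ (Ioi (Z 0)) := fun z hz =>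
        (hZ.hasDerivAt_inv z hz).continuousAt.continuousWithinAt
      have h1 : ContinuousOn (fun z => ϱ (Ξ z)) (Ioi (Z 0)) := h.cont.comp_continuousOn hΞ
      have h2 : ContinuousOn (fun z => ϱ₁ (Ξ z)) (Ioi (Z 0)) := h.continuous.comp_continuousOn hΞ
      refine ContinuousOn.neg (ContinuousOn.div ?_ ?_ fun z hz => ?_)
      · exact (continuousOn_const.mul (h1.pow 2)).mul (h2.sub continuousOn_const)
      · fun_prop
      · have : 0 < z := hz₀.trans hz
        positivity)
    (fun z hz => (hb z hz).1) fun z hz => by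
      rw [abs_neg]
      exact (hb z hz).2
  obtain ⟨κ, hκ⟩ := exists_hankel_expansion
  refine ⟨endFst c (Z 0) m, endSnd c (Z 0) m, _, endAsymptotics m hz₀ hκ hcd hl₁ hK, ?_⟩
  intro l hl u v hu hv hu0 hu1 hv0 hv1
  obtain ⟨hcc, hct, hcD⟩ := hc l hl
  have hs := isRadialSystem_cone h hZ hl hcc hcD
  have hsu := hu.isRadialSystem h.pos h.hasDerivAt h₂ hV
  have hsv := hv.isRadialSystem h.pos h.hasDerivAt h₂ hV
  refine (tendsto_coneFst h hZ hl hct).congr' ?_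
  filter_upwards [eventually_ge_atTop 0] with ξ hξ
  congr 1
  -- At `ξ = 0` the systems of `u` and `v` have data `(1, 0)` and `(0, 1)`. The three conserved
  -- Wronskians therefore express the Jost solution through `u` and `v` by Cramer's rule, with its
  -- own data at `0` as coefficients.
  have w1 := hs.wronskian_eq hsu hξ
  have w2 := hs.wronskian_eq hsv hξ
  have w3 := hsu.wronskian_eq hsv hξ
  have hr0 : √(ϱ 0) ≠ 0 := (Real.sqrt_pos.2 (h.pos 0)).ne'
  have d1 : √(ϱ 0) * deriv u 0 - u 0 * (ϱ₁ 0 / (2 * √(ϱ 0))) = 0 := by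
    rw [hu0, hu1]
    ring
  have d2 : √(ϱ 0) * deriv v 0 - v 0 * (ϱ₁ 0 / (2 * √(ϱ 0))) = 1 := by
    rw [hv0, hv1, mul_inv_cancel₀ hr0]
    ring
  have d3 : u 0 / √(ϱ 0) = 1 := by rw [hu0, div_self hr0]
  have d4 : v 0 / √(ϱ 0) = 0 := by rw [hv0, zero_div]
  have g0 : coneFst (c l) Z m l 0 = endFst c (Z 0) m l := by simp only [coneFst, sub_self, endFst]
  have p0 : coneSnd (c l) Z m l 0 = endSnd c (Z 0) m l := by simp only [coneSnd, sub_self, endSnd]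
  simp only [d1, d2, d3, d4, g0, p0] at w1 w2 w3
  simp only [Complex.ofReal_zero, Complex.ofReal_one, mul_zero, mul_one, zero_sub,
    sub_zero] at w1 w2 w3
  have hr : (√(ϱ ξ) : ℂ) ≠ 0 := by exact_mod_cast (Real.sqrt_pos.2 (h.pos ξ)).ne'
  have eu : ((u ξ / √(ϱ ξ) : ℝ) : ℂ) * √(ϱ ξ) = u ξ := by
    push_cast
    field_simp
  have ev : ((v ξ / √(ϱ ξ) : ℝ) : ℂ) * √(ϱ ξ) = v ξ := by
    push_cast
    field_simp
  linear_combination (-(√(ϱ ξ) * coneFst (c l) Z m l ξ)) * w3 +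
    ((u ξ / √(ϱ ξ) : ℝ) : ℂ) * √(ϱ ξ) * w2 - ((v ξ / √(ϱ ξ) : ℝ) : ℂ) * √(ϱ ξ) * w1 +
    endFst c (Z 0) m l * eu + endSnd c (Z 0) m l * ev

end EndTheorem

/-! ### Uniqueness of Jost solutions -/

section Jost

variable {V : ℝ → ℝ} {l : ℝ} {f g : ℝ → ℂ}

theorem isJostPlus_iff : IsJostPlus V l f ↔ IsSolution V l f ∧
    Tendsto (fun ξ : ℝ => Complex.exp (-(Complex.I * l * ξ)) * f ξ) atTop (𝓝 1) := by
  refine and_congr_right fun _ => ?_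
  rw [isEquivalent_iff_tendsto_one (Eventually.of_forall fun ξ => Complex.exp_ne_zero _)]
  refine tendsto_congr fun ξ => ?_
  rw [Pi.div_apply, Complex.exp_neg]
  ring

theorem deriv_comp_neg_fun {E : Type*} [NormedAddCommGroup E] [NormedSpace ℝ E] (f : ℝ → E) :
    deriv (fun ξ => f (-ξ)) = fun ξ => -deriv f (-ξ) := funext fun ξ => deriv_comp_neg f ξ

theorem IsSolution.comp_neg {E : Type*} [NormedAddCommGroup E] [NormedSpace ℝ E] {f : ℝ → E}
    (h : IsSolution V l f) : IsSolution (fun ξ => V (-ξ)) l fun ξ => f (-ξ) := by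
  refine ⟨h.1.comp contDiff_neg, fun ξ => ?_⟩
  have e : deriv (fun ξ => -deriv f (-ξ)) ξ = deriv (deriv f) (-ξ) := by
    rw [deriv.fun_neg, deriv_comp_neg, neg_neg]
  rw [deriv_comp_neg_fun, e]
  exact h.2 (-ξ)

theorem isSolution_comp_neg_iff : IsSolution (fun ξ => V (-ξ)) l (fun ξ => f (-ξ)) ↔
    IsSolution V l f := by
  refine ⟨fun h => ?_, fun h => h.comp_neg⟩
  simpa only [neg_neg] using h.comp_neg

theorem isJostMinus_iff : IsJostMinus V l f ↔ IsJostPlus (fun ξ => V (-ξ)) l fun ξ => f (-ξ) := by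
  refine and_congr isSolution_comp_neg_iff.symm ⟨fun h => ?_, fun h => ?_⟩
  · refine (h.comp_tendsto tendsto_neg_atTop_atBot).congr_right (Eventually.of_forall fun ξ => ?_)
    simp
  · refine ((h.comp_tendsto tendsto_neg_atBot_atTop).congr_right
      (Eventually.of_forall fun ξ => ?_)).congr_left (Eventually.of_forall fun ξ => ?_)
    · simp
    · simp

/-- A periodic function that tends to zero vanishes identically. Phases `0` and `π` then give `α + β
= 0` and `α - β = 0`. -/
theorem eq_zero_of_tendsto_exp {α β : ℂ} (hl : 0 < l)
    (h : Tendsto (fun ξ : ℝ => α + β * Complex.exp (-(2 * Complex.I * l * ξ))) atTop (𝓝 0)) :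
    α = 0 ∧ β = 0 := by
  have key : ∀ t : ℝ, α + β * Complex.exp (-(Complex.I * t)) = 0 := fun t => by
    have hx : Tendsto (fun n : ℕ => (t + n * (2 * Real.pi)) / (2 * l)) atTop atTop :=
      (tendsto_atTop_add_const_left _ t ((tendsto_natCast_atTop_atTop (R := ℝ)).atTop_mul_const
        (by positivity))).atTop_div_const (by positivity)
    refine tendsto_nhds_unique ?_ (h.comp hx)
    refine tendsto_const_nhds.congr fun n => ?_
    have hlc : (l : ℂ) ≠ 0 := by exact_mod_cast hl.ne'
    have e : -(2 * Complex.I * l * (((t + n * (2 * Real.pi)) / (2 * l) : ℝ) : ℂ)) =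
        -(Complex.I * t) - n * (2 * Real.pi * Complex.I) := by
      push_cast
      field_simp
      ring
    rw [Function.comp_apply, e, Complex.exp_periodic.sub_nat_mul_eq]
  have h0 := key 0
  have h1 := key Real.pi
  have e : Complex.exp (-(Complex.I * Real.pi)) = -1 := by
    rw [Complex.exp_neg, mul_comm, Complex.exp_pi_mul_I]
    norm_num
  rw [e] at h1
  simp only [Complex.ofReal_zero, mul_zero, neg_zero, Complex.exp_zero, mul_one] at h0
  exact ⟨by linear_combination (h0 + h1) / 2, by linear_combination (h0 - h1) / 2⟩

theorem IsSolution.conj (h : IsSolution V l f) : IsSolution V l fun ξ => (starRingEnd ℂ) (f ξ) := by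
  have e : ∀ g : ℝ → ℂ, Differentiable ℝ g → deriv (fun ξ => (starRingEnd ℂ) (g ξ)) =
      fun ξ => (starRingEnd ℂ) (deriv g ξ) := fun g hg =>
    funext fun ξ => (hasDerivAt_conj (hg ξ).hasDerivAt).deriv
  refine ⟨Complex.conjCLE.contDiff.comp h.1, fun ξ => ?_⟩
  rw [e f fun ξ => (h.hasDerivAt ξ).differentiableAt,
    e (deriv f) fun ξ => (h.hasDerivAt_deriv ξ).differentiableAt]
  have := congrArg (starRingEnd ℂ) (h.2 ξ)
  simpa [Complex.real_smul] using this

theorem IsJostPlus.tendsto_comb (h : IsJostPlus V l f) (α β : ℂ) :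
    Tendsto (fun ξ : ℝ => Complex.exp (-(Complex.I * l * ξ)) *
      (α * f ξ + β * (starRingEnd ℂ) (f ξ)) -
      (α + β * Complex.exp (-(2 * Complex.I * l * ξ)))) atTop (𝓝 0) := by
  have h1 := (isJostPlus_iff.1 h).2
  have h2 : Tendsto (fun ξ : ℝ => Complex.exp (-(Complex.I * l * ξ)) * f ξ - 1) atTop (𝓝 0) := by
    simpa using h1.sub_const 1
  have h3 : Tendsto (fun ξ : ℝ => Complex.exp (-(2 * Complex.I * l * ξ)) *
      (starRingEnd ℂ) (Complex.exp (-(Complex.I * l * ξ)) * f ξ - 1)) atTop (𝓝 0) := by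
    rw [tendsto_zero_iff_norm_tendsto_zero] at h2 ⊢
    refine h2.congr fun ξ => ?_
    have e : -(2 * Complex.I * l * ξ) = Complex.I * ((-(2 * l * ξ) : ℝ) : ℂ) := by
      push_cast
      ring
    rw [norm_mul, e, norm_exp_I_mul, one_mul, RCLike.norm_conj]
  have := (h2.const_mul α).add (h3.const_mul β)
  simp only [mul_zero, add_zero] at this
  refine this.congr fun ξ => ?_
  have e : Complex.exp (-(2 * Complex.I * l * ξ)) *
      (starRingEnd ℂ) (Complex.exp (-(Complex.I * l * ξ))) = Complex.exp (-(Complex.I * l * ξ)) := by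
    rw [← Complex.exp_conj, ← Complex.exp_add]
    simp only [map_neg, map_mul, Complex.conj_I, Complex.conj_ofReal]
    ring_nf
  rw [map_sub, map_mul, map_one]
  linear_combination β * (starRingEnd ℂ) (f ξ) * e

theorem IsJostPlus.comb_eq_zero (h : IsJostPlus V l f) (hl : 0 < l) {α β : ℂ}
    (h0 : Tendsto (fun ξ : ℝ => Complex.exp (-(Complex.I * l * ξ)) *
      (α * f ξ + β * (starRingEnd ℂ) (f ξ))) atTop (𝓝 0)) : α = 0 ∧ β = 0 := by
  refine eq_zero_of_tendsto_exp hl ?_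
  have := h0.sub (h.tendsto_comb α β)
  rw [sub_zero] at this
  exact this.congr fun ξ => by ring

/-- A Jost solution and its conjugate form a basis of solutions, because no nontrivial combination
can decay. The difference of two Jost solutions decays, so both its coefficients vanish. -/
theorem IsJostPlus.unique (hV : Continuous V) (hl : 0 < l) (hf : IsJostPlus V l f)
    (hg : IsJostPlus V l g) : f = g := by
  have hfc := hf.1.conj
  have hfc1 : deriv (fun ξ => (starRingEnd ℂ) (f ξ)) 0 = (starRingEnd ℂ) (deriv f 0) :=
    (hasDerivAt_conj (hf.1.hasDerivAt 0)).deriv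
  have hcomb : ∀ α β : ℂ, IsSolution V l fun ξ => α * f ξ + β * (starRingEnd ℂ) (f ξ) :=
    fun α β => hf.1.smul_add_smul hfc α β
  have hcomb1 : ∀ α β : ℂ, deriv (fun ξ => α * f ξ + β * (starRingEnd ℂ) (f ξ)) 0 =
      α * deriv f 0 + β * (starRingEnd ℂ) (deriv f 0) := fun α β =>
    (((hf.1.hasDerivAt 0).const_mul α).add
      ((hasDerivAt_conj (hf.1.hasDerivAt 0)).const_mul β)).deriv
  have hzero : IsSolution V l fun _ => (0 : ℂ) := by
    simpa using hcomb 0 0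
  have hvanish : ∀ α β : ℂ, α * f 0 + β * (starRingEnd ℂ) (f 0) = 0 →
      α * deriv f 0 + β * (starRingEnd ℂ) (deriv f 0) = 0 → α = 0 ∧ β = 0 := fun α β h0 h1 => by
    have h2 := (hcomb α β).eq_of_cauchy hV hzero h0 (by rw [hcomb1, h1, deriv_const])
    refine hf.comb_eq_zero hl ?_
    refine tendsto_const_nhds.congr fun ξ => ?_
    rw [show α * f ξ + β * (starRingEnd ℂ) (f ξ) = 0 from congrFun h2 ξ, mul_zero]
  set W : ℂ := f 0 * (starRingEnd ℂ) (deriv f 0) - deriv f 0 * (starRingEnd ℂ) (f 0) with hW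
  -- If `W = 0`, independence applied to the combinations with coefficients from the data at `0`
  -- gives `f 0 = 0` and `f' 0 = 0`, and then the combination `1 · f` contradicts it.
  have hW0 : W ≠ 0 := fun h0 => by
    have h1 := (hvanish ((starRingEnd ℂ) (f 0)) (-f 0) (by ring)
      (by linear_combination -h0)).2
    have h2 := (hvanish ((starRingEnd ℂ) (deriv f 0)) (-deriv f 0) (by linear_combination h0)
      (by ring)).2
    have h3 := (hvanish 1 0 (by simpa using h1) (by simpa using h2)).1
    exact one_ne_zero h3
  have hd1 : deriv (fun ξ => 1 * f ξ + (-1) * g ξ) 0 = deriv f 0 - deriv g 0 :=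
    (((hf.1.hasDerivAt 0).const_mul 1).add
      ((hg.1.hasDerivAt 0).const_mul (-1))).deriv.trans (by ring)
  set x := f 0 - g 0 with hx
  set y := deriv f 0 - deriv g 0 with hy
  have hd : IsSolution V l fun ξ => 1 * f ξ + (-1) * g ξ := hf.1.smul_add_smul hg.1 (1 : ℂ) (-1)
  set α := (x * (starRingEnd ℂ) (deriv f 0) - y * (starRingEnd ℂ) (f 0)) / W with hα
  set β := (f 0 * y - deriv f 0 * x) / W with hβ
  have key := hd.eq_of_cauchy hV (hcomb α β)
    (by
      rw [hα, hβ]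
      field_simp
      rw [hW, hx]
      ring)
    (by
      rw [hd1, hcomb1, hα, hβ]
      field_simp
      rw [hW]
      ring)
  obtain ⟨h1, h2⟩ := hf.comb_eq_zero hl (α := α) (β := β) (by
    have := (isJostPlus_iff.1 hf).2.sub (isJostPlus_iff.1 hg).2
    rw [sub_self] at this
    refine this.congr fun ξ => ?_
    rw [← congrFun key ξ]
    ring)
  ext1 ξ
  have := congrFun key ξ
  simp only [h1, h2] at this
  linear_combination this

end Jost

/-! ### The radius and the potential in terms of the profile -/

section Profile

variable {r : ℝ → ℝ}

theorem IsConicalProfile.contDiff_deriv (hr : IsConicalProfile r) :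
    ContDiff ℝ (⊤ : ℕ∞) (deriv r) :=
  ((contDiff_infty_iff_deriv (𝕜 := ℝ)).1 hr.smooth).2

theorem IsConicalProfile.hasDerivAt (hr : IsConicalProfile r) (x : ℝ) :
    HasDerivAt r (deriv r x) x := (hr.smooth.differentiable (by simp) x).hasDerivAt

theorem IsConicalProfile.hasDerivAt_deriv (hr : IsConicalProfile r) (x : ℝ) :
    HasDerivAt (deriv r) (deriv (deriv r) x) x :=
  (hr.contDiff_deriv.differentiable (by simp) x).hasDerivAt

theorem IsConicalProfile.continuous_deriv (hr : IsConicalProfile r) : Continuous (deriv r) :=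
  hr.contDiff_deriv.continuous

theorem IsConicalProfile.continuous_deriv_deriv (hr : IsConicalProfile r) :
    Continuous (deriv (deriv r)) := hr.contDiff_deriv.continuous_deriv (by simp)

theorem sqrt_one_add_sq_pos (p : ℝ) : 0 < √(1 + p ^ 2) := Real.sqrt_pos.2 (by positivity)

theorem hasDerivAt_arcLength (hr : IsConicalProfile r) (x : ℝ) :
    HasDerivAt (arcLength r) (√(1 + deriv r x ^ 2)) x := by
  have hc : Continuous fun y => √(1 + deriv r y ^ 2) := by
    have := hr.continuous_deriv
    fun_prop
  exact intervalIntegral.integral_hasDerivAt_right (hc.intervalIntegrable _ _)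
    (hc.stronglyMeasurableAtFilter _ _) hc.continuousAt

theorem strictMono_arcLength (hr : IsConicalProfile r) : StrictMono (arcLength r) :=
  strictMono_of_deriv_pos fun x => by
    rw [(hasDerivAt_arcLength hr x).deriv]
    exact sqrt_one_add_sq_pos _

theorem arcLength_arcInv (hr : IsConicalProfile r) (ξ : ℝ) : arcLength r (arcInv r ξ) = ξ :=
  Function.rightInverse_invFun (arcLength_bijective hr).2 ξ

theorem continuous_arcInv (hr : IsConicalProfile r) : Continuous (arcInv r) := by
  let e := StrictMono.orderIsoOfSurjective _ (strictMono_arcLength hr) (arcLength_bijective hr).2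
  have : arcInv r = e.symm := funext fun ξ => by
    rw [eq_comm, OrderIso.symm_apply_eq]
    exact (arcLength_arcInv hr ξ).symm
  rw [this]
  exact e.symm.continuous

theorem hasDerivAt_arcInv (hr : IsConicalProfile r) (ξ : ℝ) :
    HasDerivAt (arcInv r) (√(1 + deriv r (arcInv r ξ) ^ 2))⁻¹ ξ :=
  (hasDerivAt_arcLength hr _).of_local_left_inverse (continuous_arcInv hr).continuousAt
    (sqrt_one_add_sq_pos _).ne' (Eventually.of_forall (arcLength_arcInv hr))

theorem hasDerivAt_radius (hr : IsConicalProfile r) (ξ : ℝ) :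
    HasDerivAt (radius r) (deriv r (arcInv r ξ) / √(1 + deriv r (arcInv r ξ) ^ 2)) ξ :=
  ((hr.hasDerivAt _).comp ξ (hasDerivAt_arcInv hr ξ)).congr_deriv (div_eq_mul_inv _ _).symm

theorem deriv_radius (hr : IsConicalProfile r) :
    deriv (radius r) = fun ξ => deriv r (arcInv r ξ) / √(1 + deriv r (arcInv r ξ) ^ 2) :=
  funext fun ξ => (hasDerivAt_radius hr ξ).deriv

theorem hasDerivAt_div_sqrt_one_add_sq (p : ℝ) :
    HasDerivAt (fun p : ℝ => p / √(1 + p ^ 2)) ((1 + p ^ 2) * √(1 + p ^ 2))⁻¹ p := by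
  have h0 := sqrt_one_add_sq_pos p
  have h2 : √(1 + p ^ 2) ^ 2 = 1 + p ^ 2 := Real.sq_sqrt (by positivity)
  have h1 : HasDerivAt (fun p : ℝ => √(1 + p ^ 2)) (2 * p / (2 * √(1 + p ^ 2))) p := by
    have := ((hasDerivAt_id p).pow 2).const_add 1
    refine (this.sqrt (by simp only [Pi.pow_apply, id]; positivity)).congr_deriv ?_
    simp
  refine ((hasDerivAt_id p).div h1 h0.ne').congr_deriv ?_
  have h3 : (1 + p ^ 2 : ℝ) ≠ 0 := by positivity
  rw [h2, id]
  field_simp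
  rw [h2]
  ring

theorem hasDerivAt_deriv_radius (hr : IsConicalProfile r) (ξ : ℝ) :
    HasDerivAt (deriv (radius r))
      (deriv (deriv r) (arcInv r ξ) / (1 + deriv r (arcInv r ξ) ^ 2) ^ 2) ξ := by
  rw [deriv_radius hr]
  refine ((hasDerivAt_div_sqrt_one_add_sq _).comp ξ
    ((hr.hasDerivAt_deriv _).comp ξ (hasDerivAt_arcInv hr ξ))).congr_deriv ?_
  have h0 := sqrt_one_add_sq_pos (deriv r (arcInv r ξ))
  have h2 : √(1 + deriv r (arcInv r ξ) ^ 2) ^ 2 = 1 + deriv r (arcInv r ξ) ^ 2 :=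
    Real.sq_sqrt (by positivity)
  simp only [Function.comp_apply]
  field_simp
  rw [h2]

theorem deriv_deriv_radius (hr : IsConicalProfile r) : deriv (deriv (radius r)) = fun ξ =>
    deriv (deriv r) (arcInv r ξ) / (1 + deriv r (arcInv r ξ) ^ 2) ^ 2 :=
  funext fun ξ => (hasDerivAt_deriv_radius hr ξ).deriv

theorem radius_pos (hr : IsConicalProfile r) (ξ : ℝ) : 0 < radius r ξ :=
  let ⟨_, hδ, hle⟩ := hr.pos
  hδ.trans_le (hle _)

theorem potential_eq (hr : IsConicalProfile r) (ξ : ℝ) :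
    potential r ξ = deriv (deriv (radius r)) ξ / (2 * radius r ξ) -
      deriv (radius r) ξ ^ 2 / (4 * radius r ξ ^ 2) := by
  have h0 := (radius_pos hr ξ).ne'
  have h1 := (hasDerivAt_radius hr ξ).differentiableAt.hasDerivAt
  have h2 := (hasDerivAt_deriv_radius hr ξ).differentiableAt.hasDerivAt
  have h3 := ((h2.div h1 h0).const_mul (1 / 2)).deriv
  have h4 : deriv (rho r) ξ = _ := h3
  rw [potential, h4, rho]
  field_simp
  ring

theorem continuous_radius (hr : IsConicalProfile r) : Continuous (radius r) :=
  hr.smooth.continuous.comp (continuous_arcInv hr)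

theorem continuous_deriv_radius (hr : IsConicalProfile r) : Continuous (deriv (radius r)) :=
  continuous_iff_continuousAt.2 fun ξ => (hasDerivAt_deriv_radius hr ξ).continuousAt

theorem continuous_potential (hr : IsConicalProfile r) : Continuous (potential r) := by
  rw [funext (potential_eq hr), deriv_deriv_radius hr]
  have h1 := continuous_arcInv hr
  have h2 := hr.continuous_deriv.comp h1
  have h3 := hr.continuous_deriv_deriv.comp h1
  have h4 := continuous_radius hr
  have h5 := continuous_deriv_radius hr
  have h6 := radius_pos hr
  refine Continuous.sub (Continuous.div (Continuous.div h3 (by fun_prop) fun ξ => by positivity)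
    (by fun_prop) fun ξ => ?_) (Continuous.div (by fun_prop) (by fun_prop) fun ξ => ?_)
  · have := h6 ξ
    positivity
  · have := h6 ξ
    positivity

end Profile

/-! ### Decay of slope, curvature and potential at the right end -/

section Asymptotics

variable {r : ℝ → ℝ}

theorem bounded_of_isBigO_one {f : ℝ → ℝ} (hf : Continuous f) (h : f =O[atTop] fun _ => (1 : ℝ)) :
    ∃ C, ∀ x ≥ 0, |f x| ≤ C := by
  obtain ⟨K, hK⟩ := h.bound
  obtain ⟨X, hX⟩ := eventually_atTop.1 hK
  obtain ⟨K', hK'⟩ := isCompact_Icc.exists_bound_of_continuousOn (hf.continuousOn (s := Icc 0 X))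
  refine ⟨max K K', fun x hx => ?_⟩
  rcases le_total X x with h | h
  · have := hX x h
    rw [norm_one, mul_one] at this
    exact this.trans (le_max_left _ _)
  · exact (hK' x ⟨hx, h⟩).trans (le_max_right _ _)

/-- Near infinity `h = r/x - 1` is smooth, so `r' = 1 + h + x h'` and `r'' = 2 h' + x h''` there.
Only the bounds with `k ≤ 2` enter. -/
theorem HasConicalEnd.deriv_isBigO (hr : IsConicalProfile r) :
    ((fun x => deriv r x - 1) =O[atTop] fun x : ℝ => x ^ (-2 : ℤ)) ∧
      (fun x => deriv (deriv r) x) =O[atTop] fun x : ℝ => x ^ (-3 : ℤ) := by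
  obtain ⟨h, hrh, hO⟩ := hr.right
  have habs : ∀ n : ℤ, (fun x : ℝ => |x| ^ n) =ᶠ[atTop] fun x => x ^ n := fun n => by
    filter_upwards [eventually_ge_atTop 0] with x hx
    rw [abs_of_nonneg hx]
  have hid : ∀ n : ℤ, (fun x : ℝ => x * x ^ n) =ᶠ[atTop] fun x => x ^ (n + 1) := fun n => by
    filter_upwards [eventually_gt_atTop 0] with x hx
    rw [zpow_add_one₀ hx.ne', mul_comm]
  have h0 : h =O[atTop] fun x : ℝ => x ^ (-2 : ℤ) := by
    simpa using (hO 0).trans_eventuallyEq (habs _)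
  have h1 : deriv h =O[atTop] fun x : ℝ => x ^ (-3 : ℤ) := by
    have := (hO 1).trans_eventuallyEq (habs _)
    norm_num at this
    simpa using this
  have h2 : deriv (deriv h) =O[atTop] fun x : ℝ => x ^ (-4 : ℤ) := by
    have := (hO 2).trans_eventuallyEq (habs _)
    rw [iteratedDeriv_succ, iteratedDeriv_one] at this
    norm_num at this
    exact this
  have hev : ∀ᶠ x in atTop, 0 < x ∧ h =ᶠ[𝓝 x] (fun x => r x / x - 1) ∧
      r =ᶠ[𝓝 x] fun x => x * (1 + h x) := by
    obtain ⟨X, hX⟩ := eventually_atTop.1 (hrh.and (eventually_gt_atTop 0))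
    filter_upwards [eventually_gt_atTop X] with x hx
    have hn : ∀ᶠ y in 𝓝 x, X < y := lt_mem_nhds hx
    refine ⟨(hX x hx.le).2, ?_, ?_⟩
    · filter_upwards [hn] with y hy
      obtain ⟨e, hy0⟩ := hX y hy.le
      rw [e, abs_of_pos hy0]
      field_simp
      ring
    · filter_upwards [hn] with y hy
      obtain ⟨e, hy0⟩ := hX y hy.le
      rw [e, abs_of_pos hy0]
  have hsm : ∀ᶠ x in atTop, ContDiffAt ℝ 2 h x := by
    filter_upwards [hev] with x hx
    refine ContDiffAt.congr_of_eventuallyEq ?_ hx.2.1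
    exact (((contDiff_infty.1 hr.smooth 2).contDiffAt).div contDiffAt_id hx.1.ne').sub
      contDiffAt_const
  have hd : ∀ᶠ x in atTop, deriv r =ᶠ[𝓝 x] (fun x => 1 + h x + x * deriv h x) := by
    filter_upwards [hev, hsm] with x hx hs
    filter_upwards [hx.2.2.eventuallyEq_nhds, hs.eventually (by simp)] with y hy hys
    rw [hy.deriv_eq]
    have hhd := (hys.differentiableAt (by norm_num)).hasDerivAt
    refine (((hasDerivAt_id y).mul (hhd.const_add 1)).deriv).trans ?_
    simp
  have hdd : ∀ᶠ x in atTop, deriv (deriv r) x = 2 * deriv h x + x * deriv (deriv h) x := by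
    filter_upwards [hd, hsm] with x hx hs
    rw [hx.deriv_eq]
    have hhd := (hs.differentiableAt (by norm_num)).hasDerivAt
    have hhdd : HasDerivAt (deriv h) (deriv (deriv h) x) x := by
      have : ContDiffAt ℝ 1 (deriv h) x :=
        (hs.fderiv_right (m := 1) (by norm_num)).clm_apply contDiffAt_const
      exact (this.differentiableAt (by norm_num)).hasDerivAt
    refine (((hhd.const_add 1).add ((hasDerivAt_id x).mul hhdd)).deriv).trans ?_
    simp only [id]
    ring
  constructor
  · have := h0.add (((isBigO_refl (fun x : ℝ => x) atTop).mul h1).trans_eventuallyEq (hid _))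
    refine this.congr' ?_ (EventuallyEq.refl _ _)
    filter_upwards [hd] with x hx
    rw [hx.eq_of_nhds]
    ring
  · have := (h1.const_mul_left 2).add
      (((isBigO_refl (fun x : ℝ => x) atTop).mul h2).trans_eventuallyEq (hid _))
    refine this.congr' ?_ (EventuallyEq.refl _ _)
    filter_upwards [hdd] with x hx
    rw [hx]

/-- Since `r'` is bounded on the right half line, arclength is at most a multiple of `x`. Decay in
`x` thus becomes decay in `ξ`. -/
theorem exists_mul_arcInv_ge (hr : IsConicalProfile r) :
    ∃ M > 0, ∀ ξ ≥ 0, ξ ≤ M * arcInv r ξ := by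
  have hO : deriv r =O[atTop] fun _ => (1 : ℝ) := by
    have h1 : (fun x : ℝ => x ^ (-2 : ℤ)) =O[atTop] fun _ => (1 : ℝ) :=
      (tendsto_zpow_atTop_zero (by norm_num)).isBigO_one ℝ
    have := ((HasConicalEnd.deriv_isBigO hr).1.trans h1).add (isBigO_refl (fun _ => (1 : ℝ)) _)
    simpa using this
  obtain ⟨C, hC⟩ := bounded_of_isBigO_one hr.continuous_deriv hO
  have hC0 : 0 ≤ C := (abs_nonneg _).trans (hC 0 le_rfl)
  refine ⟨1 + C, by positivity, fun ξ hξ => ?_⟩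
  have hL0 : arcLength r 0 = 0 := by simp [arcLength]
  have hx : 0 ≤ arcInv r ξ := by
    rw [← (strictMono_arcLength hr).le_iff_le, arcLength_arcInv hr, hL0]
    exact hξ
  have hm : MonotoneOn (fun x => (1 + C) * x - arcLength r x) (Ici 0) := by
    have hd : ∀ x, HasDerivAt (fun x => (1 + C) * x - arcLength r x)
        ((1 + C) * 1 - √(1 + deriv r x ^ 2)) x := fun x =>
      ((hasDerivAt_id x).const_mul (1 + C)).sub (hasDerivAt_arcLength hr x)
    refine monotoneOn_of_deriv_nonneg (convex_Ici 0)
      (fun x _ => (hd x).continuousAt.continuousWithinAt)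
      (fun x _ => (hd x).differentiableAt.differentiableWithinAt) fun x hx => ?_
    rw [(hd x).deriv, mul_one, sub_nonneg]
    refine Real.sqrt_le_iff.2 ⟨by positivity, ?_⟩
    have h1 := hC x (interior_subset hx)
    have h2 : deriv r x ^ 2 ≤ C ^ 2 := sq_le_sq' (abs_le.1 h1).1 (abs_le.1 h1).2
    nlinarith
  have := hm (mem_Ici.2 le_rfl) (mem_Ici.2 hx) hx
  simp only [hL0, arcLength_arcInv hr] at this
  linarith

theorem tendsto_arcInv (hr : IsConicalProfile r) : Tendsto (arcInv r) atTop atTop := by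
  obtain ⟨M, hM, h⟩ := exists_mul_arcInv_ge hr
  refine tendsto_atTop_mono' _ ?_ (tendsto_id.atTop_div_const hM)
  filter_upwards [eventually_ge_atTop 0] with ξ hξ
  rw [id, div_le_iff₀' hM]
  exact h ξ hξ

theorem arcInv_zpow_isBigO (hr : IsConicalProfile r) (n : ℕ) :
    (fun ξ => arcInv r ξ ^ (-n : ℤ)) =O[atTop] fun ξ : ℝ => ξ ^ (-n : ℤ) := by
  obtain ⟨M, hM, h⟩ := exists_mul_arcInv_ge hr
  refine IsBigO.of_bound (M ^ n) ?_
  filter_upwards [eventually_gt_atTop 0] with ξ hξ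
  have hx : 0 < arcInv r ξ := (mul_pos_iff_of_pos_left hM).1 (hξ.trans_le (h ξ hξ.le))
  rw [zpow_neg, zpow_neg, zpow_natCast, zpow_natCast, norm_inv, norm_inv,
    Real.norm_of_nonneg (by positivity), Real.norm_of_nonneg (by positivity), ← div_eq_mul_inv,
    inv_eq_one_div, div_le_div_iff₀ (by positivity) (by positivity), one_mul, ← mul_pow]
  gcongr
  exact h ξ hξ.le

/-- The map `p ↦ p/√(1 + p²)` is 1-Lipschitz and takes `p = 1` to `1/√2`, so the slope in arclength
inherits the rate of `r' - 1`. -/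
theorem deriv_radius_sub_isBigO (hr : IsConicalProfile r) :
    (fun ξ => deriv (radius r) ξ - coneSlope) =O[atTop] fun ξ : ℝ => ξ ^ (-2 : ℤ) := by
  have h1 := ((HasConicalEnd.deriv_isBigO hr).1.comp_tendsto (tendsto_arcInv hr)).trans
    (arcInv_zpow_isBigO hr 2)
  refine IsBigO.trans (IsBigO.of_bound 1 (Eventually.of_forall fun ξ => ?_)) h1
  rw [deriv_radius hr, one_mul, Function.comp_apply]
  have := Convex.norm_image_sub_le_of_norm_hasDerivWithin_le (f := fun p : ℝ => p / √(1 + p ^ 2))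
    (f' := fun p => ((1 + p ^ 2) * √(1 + p ^ 2))⁻¹) (C := 1)
    (s := univ) (x := 1) (y := deriv r (arcInv r ξ))
    (fun p _ => (hasDerivAt_div_sqrt_one_add_sq p).hasDerivWithinAt)
    (fun p _ => by
      have h2 : 1 ≤ 1 + p ^ 2 := by nlinarith [sq_nonneg p]
      have h3 : 1 ≤ √(1 + p ^ 2) := Real.one_le_sqrt.2 h2
      rw [norm_inv, Real.norm_of_nonneg (by positivity)]
      exact inv_le_one_of_one_le₀ (one_le_mul_of_one_le_of_one_le h2 h3)) convex_univ (mem_univ _)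
      (mem_univ _)
  rw [one_mul] at this
  refine le_trans (le_of_eq ?_) this
  rw [coneSlope, one_pow, one_add_one_eq_two, one_div]

theorem deriv_deriv_radius_isBigO (hr : IsConicalProfile r) :
    (deriv (deriv (radius r))) =O[atTop] fun ξ : ℝ => ξ ^ (-3 : ℤ) := by
  have h1 := ((HasConicalEnd.deriv_isBigO hr).2.comp_tendsto (tendsto_arcInv hr)).trans
    (arcInv_zpow_isBigO hr 3)
  refine IsBigO.trans (IsBigO.of_bound 1 (Eventually.of_forall fun ξ => ?_)) h1
  rw [deriv_deriv_radius hr, one_mul, norm_div, Function.comp_apply]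
  refine div_le_self (norm_nonneg _) ?_
  rw [Real.norm_of_nonneg (by positivity)]
  exact one_le_pow₀ (by nlinarith [sq_nonneg (deriv r (arcInv r ξ))])

theorem isConicalRadius (hr : IsConicalProfile r) :
    IsConicalRadius (radius r) (deriv (radius r)) where
  hasDerivAt := fun ξ => (hasDerivAt_radius hr ξ).differentiableAt.hasDerivAt
  continuous := continuous_deriv_radius hr
  exists_le := let ⟨δ, hδ, hle⟩ := hr.pos; ⟨δ, hδ, fun _ => hle _⟩
  abs_le := fun ξ => by
    rw [deriv_radius hr, abs_div, abs_of_pos (sqrt_one_add_sq_pos _),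
      div_le_one (sqrt_one_add_sq_pos _)]
    refine Real.abs_le_sqrt ?_
    linarith
  slope := by
    have h1 : (fun ξ : ℝ => (1 + ξ) ^ 2) =O[atTop] fun ξ : ℝ => ξ ^ (2 : ℤ) := by
      refine IsBigO.of_bound 4 ?_
      filter_upwards [eventually_ge_atTop 1] with ξ hξ
      rw [Real.norm_of_nonneg (by positivity), Real.norm_of_nonneg (by positivity)]
      norm_cast
      nlinarith
    have h2 := (deriv_radius_sub_isBigO hr).mul h1
    have h3 : (fun ξ : ℝ => ξ ^ (-2 : ℤ) * ξ ^ (2 : ℤ)) =ᶠ[atTop] fun _ => (1 : ℝ) := by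
      filter_upwards [eventually_gt_atTop 0] with ξ hξ
      rw [← zpow_add₀ hξ.ne']
      norm_num
    have hc : Continuous fun ξ => (deriv (radius r) ξ - coneSlope) * (1 + ξ) ^ 2 := by
      have := continuous_deriv_radius hr
      fun_prop
    obtain ⟨C, hC⟩ := bounded_of_isBigO_one hc (h2.trans_eventuallyEq h3)
    refine ⟨C, fun ξ hξ => ?_⟩
    have := hC ξ hξ
    rw [abs_mul, abs_of_nonneg (by positivity : 0 ≤ (1 + ξ) ^ 2)] at this
    rwa [le_div_iff₀ (by positivity)]

theorem IsConicalRadius.sub_isBigO {ϱ ϱ₁ : ℝ → ℝ} (h : IsConicalRadius ϱ ϱ₁) :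
    (fun ξ => ϱ ξ - coneSlope * ξ) =O[atTop] fun _ => (1 : ℝ) := by
  obtain ⟨C, hC⟩ := h.slope
  obtain ⟨L, hL, -⟩ := exists_tendsto_of_deriv_isBigO (n := 1) (x₀ := 0) (C := |C|)
    (f := fun ξ => ϱ ξ - coneSlope * ξ) (f' := fun ξ => ϱ₁ ξ - coneSlope * 1) one_pos
    le_rfl (fun x _ => (h.hasDerivAt x).sub ((hasDerivAt_id x).const_mul coneSlope)) fun x hx => by
      have hx : 0 < x := hx
      rw [mul_one]
      refine (hC x hx.le).trans ?_
      gcongr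
      · exact le_abs_self C
      · linarith
  exact hL.isBigO_one ℝ

/-- The term `ϱ''/(2ϱ)` is `O(ξ⁻³)`. The rest is `(ϱ - ξϱ')(ϱ + ξϱ')/(4 ϱ² ξ²)`, in which the first
factor is bounded because the slope cancels, the second is `O(ξ)`, and `ϱ` grows linearly. -/
theorem potential_add_isBigO (hr : IsConicalProfile r) :
    (fun ξ : ℝ => potential r ξ + 1 / (4 * ξ ^ 2)) =O[atTop] fun ξ : ℝ => |ξ| ^ (-3 : ℤ) := by
  have habs : (fun x : ℝ => |x| ^ (-3 : ℤ)) =ᶠ[atTop] fun x => x ^ (-3 : ℤ) := by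
    filter_upwards [eventually_ge_atTop 0] with x hx
    rw [abs_of_nonneg hx]
  refine IsBigO.trans_eventuallyEq ?_ habs.symm
  have hk := coneSlope_pos
  have hid : (fun ξ : ℝ => ξ) =O[atTop] fun ξ : ℝ => ξ := isBigO_refl _ _
  have hone : (fun _ => (1 : ℝ)) =O[atTop] fun ξ : ℝ => ξ := (isLittleO_const_id_atTop 1).isBigO
  have ha := (isConicalRadius hr).sub_isBigO
  have hsl : (fun ξ => (deriv (radius r) ξ - coneSlope) * ξ) =O[atTop] fun _ => (1 : ℝ) := by
    refine ((deriv_radius_sub_isBigO hr).mul hid).trans ?_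
    have h1 : (fun ξ : ℝ => ξ ^ (-1 : ℤ)) =O[atTop] fun _ => (1 : ℝ) :=
      (tendsto_zpow_atTop_zero (by norm_num)).isBigO_one ℝ
    refine EventuallyEq.trans_isBigO ?_ h1
    filter_upwards [eventually_gt_atTop 0] with ξ hξ
    rw [← zpow_add_one₀ hξ.ne']
    norm_num
  have hminus : (fun ξ => radius r ξ - deriv (radius r) ξ * ξ) =O[atTop] fun _ => (1 : ℝ) :=
    (ha.sub hsl).congr_left fun ξ => by ring
  have hplus : (fun ξ => radius r ξ + deriv (radius r) ξ * ξ) =O[atTop] fun ξ : ℝ => ξ :=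
    (((ha.add hsl).trans hone).add (hid.const_mul_left (2 * coneSlope))).congr_left fun ξ => by ring
  have hinv : (fun ξ => (radius r ξ)⁻¹) =O[atTop] fun ξ : ℝ => ξ⁻¹ := by
    refine IsBigO.inv_rev ?_ ((eventually_gt_atTop 0).mono fun ξ hξ h0 => absurd h0 hξ.ne')
    have h1 : (fun ξ : ℝ => coneSlope * ξ) ~[atTop] radius r := by
      refine IsEquivalent.symm (IsLittleO.isEquivalent ?_)
      refine ha.trans_isLittleO ?_
      exact (isLittleO_const_id_atTop 1).const_mul_right hk.ne'
    exact ((isBigO_refl (fun ξ : ℝ => ξ) atTop).const_mul_right hk.ne').trans h1.isBigO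
  have hinv1 : (fun ξ => (radius r ξ)⁻¹) =O[atTop] fun _ => (1 : ℝ) :=
    hinv.trans (tendsto_inv_atTop_zero.isBigO_one ℝ)
  have e1 : (fun ξ => deriv (deriv (radius r)) ξ * (radius r ξ)⁻¹) =O[atTop]
      fun ξ : ℝ => ξ ^ (-3 : ℤ) := by
    simpa using (deriv_deriv_radius_isBigO hr).mul hinv1
  have e2 : (fun ξ => (radius r ξ - deriv (radius r) ξ * ξ) *
      (radius r ξ + deriv (radius r) ξ * ξ) * ((radius r ξ)⁻¹ * (radius r ξ)⁻¹) * (ξ⁻¹ * ξ⁻¹))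
      =O[atTop] fun ξ : ℝ => ξ ^ (-3 : ℤ) := by
    refine (((hminus.mul hplus).mul (hinv.mul hinv)).mul
      (isBigO_refl (fun ξ : ℝ => ξ⁻¹ * ξ⁻¹) atTop)).trans_eventuallyEq ?_
    filter_upwards [eventually_gt_atTop 0] with ξ hξ
    rw [zpow_neg]
    norm_cast
    field_simp
  refine ((e1.const_mul_left (1 / 2)).add (e2.const_mul_left (1 / 4))).congr' ?_
    (EventuallyEq.refl _ _)
  filter_upwards [eventually_gt_atTop 0] with ξ hξ
  have h0 := (radius_pos hr ξ).ne'
  rw [potential_eq hr]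
  field_simp
  ring

end Asymptotics

/-! ### Reflection exchanges the two ends -/

section Reflection

variable {r : ℝ → ℝ}

theorem HasConicalEnd.comp_neg {l l' : Filter ℝ} (h : HasConicalEnd r l)
    (hl : Tendsto (fun x : ℝ => -x) l' l) : HasConicalEnd (fun x => r (-x)) l' := by
  obtain ⟨h, hrh, hO⟩ := h
  refine ⟨fun x => h (-x), ?_, fun k => ?_⟩
  · filter_upwards [hl.eventually hrh] with x hx
    rw [hx, abs_neg]
  · have h1 : iteratedDeriv k (fun x => h (-x)) =
        fun x => (-1 : ℝ) ^ k • iteratedDeriv k h (-x) := funext fun x => iteratedDeriv_comp_neg k h x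
    rw [h1]
    have h2 := ((hO k).comp_tendsto hl).const_mul_left ((-1 : ℝ) ^ k)
    simpa [Function.comp_def] using h2

theorem IsConicalProfile.comp_neg (hr : IsConicalProfile r) :
    IsConicalProfile fun x => r (-x) where
  smooth := hr.smooth.comp contDiff_neg
  pos := let ⟨δ, hδ, hle⟩ := hr.pos; ⟨δ, hδ, fun _ => hle _⟩
  right := hr.left.comp_neg tendsto_neg_atTop_atBot
  left := hr.right.comp_neg tendsto_neg_atBot_atTop

theorem arcLength_comp_neg (r : ℝ → ℝ) (x : ℝ) :
    arcLength (fun x => r (-x)) x = -arcLength r (-x) := by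
  have e : (fun y => √(1 + deriv (fun x => r (-x)) y ^ 2)) =
      fun y => √(1 + deriv r (-y) ^ 2) := funext fun y => by
    rw [deriv_comp_neg, neg_sq]
  rw [arcLength, e, intervalIntegral.integral_comp_neg fun y => √(1 + deriv r y ^ 2), neg_zero,
    intervalIntegral.integral_symm, arcLength]

theorem radius_comp_neg (hr : IsConicalProfile r) :
    radius (fun x => r (-x)) = fun ξ => radius r (-ξ) := funext fun ξ => by
  have h1 : arcInv (fun x => r (-x)) ξ = -arcInv r (-ξ) := by
    apply (arcLength_bijective hr.comp_neg).1
    rw [arcLength_arcInv hr.comp_neg, arcLength_comp_neg, neg_neg, arcLength_arcInv hr, neg_neg]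
  rw [radius, h1, neg_neg, radius]

theorem potential_comp_neg (hr : IsConicalProfile r) :
    potential (fun x => r (-x)) = fun ξ => potential r (-ξ) := funext fun ξ => by
  rw [potential_eq hr.comp_neg, potential_eq hr, radius_comp_neg hr, deriv_comp_neg_fun,
    deriv.fun_neg, deriv_comp_neg, neg_neg, neg_sq]

end Reflection

/-! ### Jost solutions in terms of the perturbed zero energy solutions -/

section Perturbation

variable {r : ℝ → ℝ}

theorem existsUnique_isPerturbation {V : ℝ → ℝ} (hV : Continuous V) (l : ℝ) (u : ℝ → ℝ) :
    ∃! v, IsPerturbation V l u v := by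
  obtain ⟨v, hv, h0, h1⟩ := exists_isSolution hV l (u 0) (deriv u 0)
  exact ⟨v, ⟨hv, h0, h1⟩, fun w hw => hw.1.eq_of_cauchy hV hv (hw.2.1.trans h0.symm)
    (hw.2.2.trans h1.symm)⟩

theorem deriv_uZero (hr : IsConicalProfile r) :
    deriv (uZero r) 0 = deriv (radius r) 0 / (2 * √(radius r 0)) :=
  (((isConicalRadius hr).hasDerivAt 0).sqrt (radius_pos hr 0).ne').deriv

theorem uOne_zero (r : ℝ → ℝ) : uOne r 0 = 0 := by simp [uOne]

theorem deriv_uOne (hr : IsConicalProfile r) : deriv (uOne r) 0 = (√(radius r 0))⁻¹ := by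
  have h0 := radius_pos hr 0
  have h1 := (((isConicalRadius hr).hasDerivAt 0).sqrt h0.ne').mul
    (hasDerivAt_logCoord (continuous_radius hr) (radius_pos hr) 0)
  have h2 : deriv (uOne r) 0 = _ := h1.deriv
  have h3 : √(radius r 0) ≠ 0 := (Real.sqrt_pos.2 h0).ne'
  rw [h2, logCoord_zero, mul_zero, zero_add]
  nth_rewrite 2 [← Real.sq_sqrt h0.le]
  field_simp

/-- The Jost solution at the right end in terms of the perturbed zero energy solutions. -/
theorem exists_jostPlus_eq (hr : IsConicalProfile r) :
    ∃ (A B : ℝ → ℂ) (κ : ℝ), EndAsymptotics A B κ ∧ ∀ l > 0, ∀ u v : ℝ → ℝ,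
      IsPerturbation (potential r) l (uZero r) u → IsPerturbation (potential r) l (uOne r) v →
      IsJostPlus (potential r) l fun ξ => A l * u ξ + B l * v ξ := by
  obtain ⟨A, B, κ, h, hJ⟩ := (isConicalRadius hr).exists_endAsymptotics
    (fun ξ => (hasDerivAt_deriv_radius hr ξ).differentiableAt.hasDerivAt) (potential_eq hr)
  refine ⟨A, B, κ, h, fun l hl u v hu hv => isJostPlus_iff.2
    ⟨hu.1.ofReal.smul_add_smul hv.1.ofReal (A l) (B l), hJ l hl u v hu.1 hv.1 hu.2.1 ?_ ?_ ?_⟩⟩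
  · rw [hu.2.2, deriv_uZero hr]
  · rw [hv.2.1, uOne_zero]
  · rw [hv.2.2, deriv_uOne hr]

/-- The Jost solution at the left end in terms of the perturbed zero energy solutions. -/
theorem exists_jostMinus_eq (hr : IsConicalProfile r) {A B : ℝ → ℂ}
    (h : ∀ l > 0, ∀ u v : ℝ → ℝ,
      IsPerturbation (potential fun x => r (-x)) l (uZero fun x => r (-x)) u →
      IsPerturbation (potential fun x => r (-x)) l (uOne fun x => r (-x)) v →
      IsJostPlus (potential fun x => r (-x)) l fun ξ => A l * u ξ + B l * v ξ)
    {l : ℝ} (hl : 0 < l) {u v : ℝ → ℝ} (hu : IsPerturbation (potential r) l (uZero r) u)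
    (hv : IsPerturbation (potential r) l (uOne r) v) :
    IsJostMinus (potential r) l fun ξ => A l * u ξ + -B l * v ξ := by
  rw [isJostMinus_iff, ← potential_comp_neg hr]
  have hr0 : radius (fun x => r (-x)) 0 = radius r 0 := by
    simp only [radius_comp_neg hr, neg_zero]
  -- Reflection sends `u₀` to that of the reflected profile but `u₁` to its negative, whence `-B`.
  -- The zero summand only fits the form of `IsSolution.smul_add_smul`.
  have h1 := h l hl (fun ξ => u (-ξ)) (fun ξ => (-1 : ℝ) • v (-ξ) + (0 : ℝ) • v (-ξ)) ?_ ?_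
  · refine (congrArg (IsJostPlus _ l) (funext fun ξ => ?_)).mp h1
    push_cast [smul_eq_mul]
    ring
  · rw [potential_comp_neg hr]
    refine ⟨hu.1.comp_neg, ?_, ?_⟩
    · simp only [neg_zero]
      rw [hu.2.1, uZero, uZero, hr0]
    · rw [deriv_comp_neg_fun, deriv_uZero hr.comp_neg, hr0, radius_comp_neg hr,
        deriv_comp_neg_fun]
      simp only [neg_zero]
      rw [hu.2.2, deriv_uZero hr, neg_div]
  · rw [potential_comp_neg hr]
    refine ⟨hv.1.comp_neg.smul_add_smul hv.1.comp_neg (-1 : ℝ) (0 : ℝ), ?_, ?_⟩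
    · simp only [neg_zero]
      rw [hv.2.1, uOne_zero, uOne_zero]
      simp
    · have hd := hv.1.comp_neg.hasDerivAt 0
      refine ((hd.const_smul (-1 : ℝ)).add (hd.const_smul (0 : ℝ))).deriv.trans ?_
      rw [deriv_uOne hr.comp_neg, hr0, deriv_comp_neg_fun]
      simp only [neg_zero]
      rw [hv.2.2, deriv_uOne hr]
      simp

end Perturbation

/-! ### Asymptotics of the Wronskian -/

section Wronskian

variable {A B A₂ B₂ : ℝ → ℂ} {κ κ₂ : ℝ}

theorem q_mul_q_inv : (q : ℂ) * (q : ℂ)⁻¹ = 1 :=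
  mul_inv_cancel₀ (by exact_mod_cast q_pos.ne')

theorem c₀_sq_mul : c₀ ^ 2 * Complex.I * c₁ = -1 := by
  have h2 : (√Real.pi : ℂ) ^ 2 = Real.pi := by exact_mod_cast Real.sq_sqrt Real.pi_pos.le
  have h1 : (Real.pi : ℂ) ≠ 0 := by exact_mod_cast Real.pi_pos.ne'
  have hI := Complex.I_sq
  rw [c₀_eq, c₁]
  push_cast
  rw [div_pow, mul_pow, h2]
  field_simp
  linear_combination (Complex.I + 2) * hI

theorem sqrt_mul_sqrt_ofReal {l : ℝ} (hl : 0 < l) : (√l : ℂ) * (√l : ℂ) = l := by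
  exact_mod_cast Real.mul_self_sqrt hl.le

theorem sqrt_mul_inv_sqrt {l : ℝ} (hl : 0 < l) : (√l : ℂ) * (√l : ℂ)⁻¹ = 1 :=
  mul_inv_cancel₀ (by exact_mod_cast (Real.sqrt_pos.2 hl).ne')

/-- The model for the coefficient of the first zero energy solution. -/
def modelFst (κ l : ℝ) : ℂ :=
  q * c₀ * (√l : ℂ) * (1 + Complex.I * c₁ * (Real.log l : ℂ) + Complex.I * κ)

/-- The model for the coefficient of the second zero energy solution. -/
def modelSnd (l : ℝ) : ℂ := Complex.I * (q : ℂ)⁻¹ * c₀ * c₁ * (√l : ℂ)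

/-- The derivative of `modelFst`. -/
def modelFstDeriv (κ l : ℝ) : ℂ :=
  1 / 2 * q * c₀ * (√l : ℂ)⁻¹ *
    (1 + Complex.I * κ + 2 * Complex.I * c₁ + Complex.I * c₁ * (Real.log l : ℂ))

/-- The derivative of `modelSnd`. -/
def modelSndDeriv (l : ℝ) : ℂ := Complex.I / 2 * (q : ℂ)⁻¹ * c₀ * c₁ * (√l : ℂ)⁻¹

theorem subPow_modelFst (κ : ℝ) : SubPow (1 / 2) (modelFst κ) := by
  have h := (subPow_sqrt.const_mul (q * c₀)).mul
    (((subPow_const 1).add (subPow_log.const_mul (Complex.I * c₁))).add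
      (subPow_const (Complex.I * κ)))
  rw [add_zero] at h
  exact h

theorem subPow_modelSnd : SubPow (1 / 2) modelSnd :=
  subPow_sqrt.const_mul (Complex.I * (q : ℂ)⁻¹ * c₀ * c₁)

theorem subPow_modelFstDeriv (κ : ℝ) : SubPow (-(1 / 2)) (modelFstDeriv κ) := by
  have h := (subPow_inv_sqrt.const_mul (1 / 2 * q * c₀)).mul
    ((subPow_const (1 + Complex.I * κ + 2 * Complex.I * c₁)).add
      (subPow_log.const_mul (Complex.I * c₁)))
  rw [add_zero] at h
  exact h

theorem subPow_modelSndDeriv : SubPow (-(1 / 2)) modelSndDeriv :=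
  subPow_inv_sqrt.const_mul (Complex.I / 2 * (q : ℂ)⁻¹ * c₀ * c₁)

/-- The product of quantities close to their models. -/
theorem SubPow.mul_sub_mul {p p₂ e e₂ s : ℝ} {f g a b : ℝ → ℂ} (hf : SubPow e fun l => f l - a l)
    (hg : SubPow e₂ fun l => g l - b l) (ha : SubPow p a) (hb : SubPow p₂ b) (h₁ : s ≤ e + p₂)
    (h₂ : s ≤ p + e₂) (h₃ : s ≤ e + e₂) : SubPow s fun l => f l * g l - a l * b l :=
  (((hf.mul hb).mono h₁).add (((ha.mul hg).mono h₂).add ((hf.mul hg).mono h₃))).congr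
    fun l _ => by ring

/-- Each product of models is `-l (1 + i c₁ log l + iκ)`, as `q` cancels and `c₀² i c₁ = -1`; the
two add up, and the constants average. A model of order `1/2` times an error of order `1` gives the
exponent `3/2`. -/
theorem EndAsymptotics.subPow_wronskian (h : EndAsymptotics A B κ) (h' : EndAsymptotics A₂ B₂ κ₂) :
    SubPow (3 / 2) fun l => (A₂ l * B l - -B₂ l * A l) -
      -2 * (l : ℂ) * (1 + Complex.I * (((κ + κ₂) / 2 : ℝ) : ℂ) +
        Complex.I * ((2 / Real.pi : ℝ) : ℂ) * (Real.log l : ℂ)) := by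
  have k1 := SubPow.mul_sub_mul (s := 3 / 2) (a := modelFst κ₂) (b := modelSnd)
    h'.fst h.snd (subPow_modelFst κ₂) subPow_modelSnd
    (by norm_num) (by norm_num) (by norm_num)
  have k2 := SubPow.mul_sub_mul (s := 3 / 2) (a := modelSnd) (b := modelFst κ)
    h'.snd h.fst subPow_modelSnd (subPow_modelFst κ)
    (by norm_num) (by norm_num) (by norm_num)
  refine (k1.add k2).congr fun l hl => ?_
  have hs := sqrt_mul_sqrt_ofReal hl
  have e1 := q_mul_q_inv
  have e2 := c₀_sq_mul
  have key : ∀ κ : ℝ, modelFst κ l * modelSnd l =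
      -(l * (1 + Complex.I * c₁ * (Real.log l : ℂ) + Complex.I * κ)) := fun κ => by
    rw [modelFst, modelSnd]
    linear_combination (1 + Complex.I * c₁ * (Real.log l : ℂ) + Complex.I * κ) *
      (c₀ ^ 2 * Complex.I * c₁ * (√l * √l) * e1 + (√l * √l) * e2 - hs)
  rw [key κ₂, mul_comm (modelSnd l), key κ, c₁]
  push_cast
  ring

/-- By the product rule every error is an error of order `0` times a model of order `1/2`, or of
order `1` times a model derivative of order `-1/2`, up to products of errors. -/
theorem EndAsymptotics.subPow_deriv_wronskian (h : EndAsymptotics A B κ)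
    (h' : EndAsymptotics A₂ B₂ κ₂) :
    SubPow (1 / 2) fun l => deriv (fun l => A₂ l * B l - -B₂ l * A l) l -
      -2 * (1 + Complex.I * (((κ + κ₂) / 2 : ℝ) : ℂ) + Complex.I * ((2 / Real.pi : ℝ) : ℂ) +
        Complex.I * ((2 / Real.pi : ℝ) : ℂ) * (Real.log l : ℂ)) := by
  have k1 := SubPow.mul_sub_mul (s := 1 / 2) (a := modelFstDeriv κ₂) (b := modelSnd)
    h'.fst_deriv h.snd (subPow_modelFstDeriv κ₂)
    subPow_modelSnd (by norm_num) (by norm_num) (by norm_num)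
  have k2 := SubPow.mul_sub_mul (s := 1 / 2) (a := modelFst κ₂) (b := modelSndDeriv)
    h'.fst h.snd_deriv (subPow_modelFst κ₂)
    subPow_modelSndDeriv (by norm_num) (by norm_num) (by norm_num)
  have k3 := SubPow.mul_sub_mul (s := 1 / 2) (a := modelFstDeriv κ) (b := modelSnd)
    h.fst_deriv h'.snd (subPow_modelFstDeriv κ)
    subPow_modelSnd (by norm_num) (by norm_num) (by norm_num)
  have k4 := SubPow.mul_sub_mul (s := 1 / 2) (a := modelFst κ) (b := modelSndDeriv)
    h.fst h'.snd_deriv (subPow_modelFst κ)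
    subPow_modelSndDeriv (by norm_num) (by norm_num) (by norm_num)
  refine ((k1.add k2).add (k3.add k4)).congr fun l hl => ?_
  have hs := sqrt_mul_inv_sqrt hl
  have e1 := q_mul_q_inv
  have e2 := c₀_sq_mul
  have hd := (((h'.diff_fst l hl).hasDerivAt.mul (h.diff_snd l hl).hasDerivAt).sub
    ((h'.diff_snd l hl).hasDerivAt.neg.mul (h.diff_fst l hl).hasDerivAt)).deriv
  have hd' : deriv (fun l => A₂ l * B l - -B₂ l * A l) l = _ := hd
  have key : ∀ κ : ℝ, modelFstDeriv κ l * modelSnd l + modelFst κ l * modelSndDeriv l =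
      -(1 + Complex.I * c₁ * (Real.log l : ℂ) + Complex.I * κ + Complex.I * c₁) := fun κ => by
    rw [modelFst, modelSnd, modelFstDeriv, modelSndDeriv]
    linear_combination (1 + Complex.I * c₁ * (Real.log l : ℂ) + Complex.I * κ + Complex.I * c₁) *
      (c₀ ^ 2 * Complex.I * c₁ * (√l * (√l : ℂ)⁻¹) * e1 + (√l * (√l : ℂ)⁻¹) * e2 - hs)
  rw [hd']
  simp only [Pi.neg_apply]
  have key1 := key κ
  have key2 := key κ₂
  rw [c₁] at key1 key2
  push_cast at key1 key2 ⊢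
  linear_combination -key1 - key2

end Wronskian

end ConicalJost

end

/-! ### The low energy theorem for both ends -/

theorem corollary7 (r : ℝ → ℝ) (hr : ConicalJost.IsConicalProfile r) :
    -- the potential behaves like an attractive inverse square at both ends
    (fun ξ : ℝ => ConicalJost.potential r ξ + 1 / (4 * ξ ^ 2)) =O[atTop]
      (fun ξ : ℝ => |ξ| ^ (-3 : ℤ)) ∧
    (fun ξ : ℝ => ConicalJost.potential r ξ + 1 / (4 * ξ ^ 2)) =O[atBot]
      (fun ξ : ℝ => |ξ| ^ (-3 : ℤ)) ∧
    -- the Jost solutions and the perturbed zero energy solutions exist and are unique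
    (∀ lam : ℝ, 0 < lam → ∃! f, ConicalJost.IsJostPlus (ConicalJost.potential r) lam f) ∧
    (∀ lam : ℝ, 0 < lam → ∃! f, ConicalJost.IsJostMinus (ConicalJost.potential r) lam f) ∧
    (∀ lam : ℝ, ∃! v,
      ConicalJost.IsPerturbation (ConicalJost.potential r) lam (ConicalJost.uZero r) v) ∧
    (∀ lam : ℝ, ∃! v,
      ConicalJost.IsPerturbation (ConicalJost.potential r) lam (ConicalJost.uOne r) v) ∧
    -- for these solutions:
    ∀ (fp fm : ℝ → ℝ → ℂ) (u₀ u₁ : ℝ → ℝ → ℝ),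
      (∀ lam, 0 < lam → ConicalJost.IsJostPlus (ConicalJost.potential r) lam (fp lam)) →
      (∀ lam, 0 < lam → ConicalJost.IsJostMinus (ConicalJost.potential r) lam (fm lam)) →
      (∀ lam, ConicalJost.IsPerturbation (ConicalJost.potential r) lam
        (ConicalJost.uZero r) (u₀ lam)) →
      (∀ lam, ConicalJost.IsPerturbation (ConicalJost.potential r) lam
        (ConicalJost.uOne r) (u₁ lam)) →
      -- the (unique) coefficients and the Wronskian, which does not depend on `ξ`
      ∃ ap bp am bm W : ℝ → ℂ,
        (∀ lam, 0 < lam →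
          (∀ ξ, fp lam ξ = ap lam * (u₀ lam ξ : ℂ) + bp lam * (u₁ lam ξ : ℂ)) ∧
          (∀ ξ, fm lam ξ = am lam * (u₀ lam ξ : ℂ) + bm lam * (u₁ lam ξ : ℂ)) ∧
          (∀ ξ, ConicalJost.wronskian (fm lam) (fp lam) ξ = W lam) ∧
          DifferentiableAt ℝ ap lam ∧ DifferentiableAt ℝ bp lam ∧
          DifferentiableAt ℝ am lam ∧ DifferentiableAt ℝ bm lam ∧
          DifferentiableAt ℝ W lam) ∧
        -- one real constant for each end (they agree if the profile is even)
        ∃ cp cm : ℝ, ((∀ x, r (-x) = r x) → cp = cm) ∧ ∀ ε : ℝ, 0 < ε →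
          ((fun lam : ℝ => ap lam - ConicalJost.q * ConicalJost.c₀ * (Real.sqrt lam : ℂ) *
              (1 + Complex.I * ConicalJost.c₁ * (Real.log lam : ℂ) + Complex.I * cp))
            =O[𝓝[>] 0] fun lam : ℝ => lam ^ (1 - ε)) ∧
          ((fun lam : ℝ => bp lam -
              Complex.I * (ConicalJost.q : ℂ)⁻¹ * ConicalJost.c₀ * ConicalJost.c₁ *
                (Real.sqrt lam : ℂ))
            =O[𝓝[>] 0] fun lam : ℝ => lam ^ (1 - ε)) ∧
          ((fun lam : ℝ => am lam - ConicalJost.q * ConicalJost.c₀ * (Real.sqrt lam : ℂ) *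
              (1 + Complex.I * ConicalJost.c₁ * (Real.log lam : ℂ) + Complex.I * cm))
            =O[𝓝[>] 0] fun lam : ℝ => lam ^ (1 - ε)) ∧
          ((fun lam : ℝ => bm lam +
              Complex.I * (ConicalJost.q : ℂ)⁻¹ * ConicalJost.c₀ * ConicalJost.c₁ *
                (Real.sqrt lam : ℂ))
            =O[𝓝[>] 0] fun lam : ℝ => lam ^ (1 - ε)) ∧
          ((fun lam : ℝ => deriv ap lam -
              1 / 2 * ConicalJost.q * ConicalJost.c₀ * (Real.sqrt lam : ℂ)⁻¹ *
                (1 + Complex.I * cp + 2 * Complex.I * ConicalJost.c₁ +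
                  Complex.I * ConicalJost.c₁ * (Real.log lam : ℂ)))
            =O[𝓝[>] 0] fun lam : ℝ => lam ^ (-ε)) ∧
          ((fun lam : ℝ => deriv bp lam -
              Complex.I / 2 * (ConicalJost.q : ℂ)⁻¹ * ConicalJost.c₀ * ConicalJost.c₁ *
                (Real.sqrt lam : ℂ)⁻¹)
            =O[𝓝[>] 0] fun lam : ℝ => lam ^ (-ε)) ∧
          ((fun lam : ℝ => deriv am lam -
              1 / 2 * ConicalJost.q * ConicalJost.c₀ * (Real.sqrt lam : ℂ)⁻¹ *
                (1 + Complex.I * cm + 2 * Complex.I * ConicalJost.c₁ +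
                  Complex.I * ConicalJost.c₁ * (Real.log lam : ℂ)))
            =O[𝓝[>] 0] fun lam : ℝ => lam ^ (-ε)) ∧
          ((fun lam : ℝ => deriv bm lam +
              Complex.I / 2 * (ConicalJost.q : ℂ)⁻¹ * ConicalJost.c₀ * ConicalJost.c₁ *
                (Real.sqrt lam : ℂ)⁻¹)
            =O[𝓝[>] 0] fun lam : ℝ => lam ^ (-ε)) ∧
          ((fun lam : ℝ => W lam -
              -2 * (lam : ℂ) * (1 + Complex.I * (((cp + cm) / 2 : ℝ) : ℂ) +
                Complex.I * ((2 / Real.pi : ℝ) : ℂ) * (Real.log lam : ℂ)))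
            =O[𝓝[>] 0] fun lam : ℝ => lam ^ (3 / 2 - ε)) ∧
          ((fun lam : ℝ => deriv W lam -
              -2 * (1 + Complex.I * (((cp + cm) / 2 : ℝ) : ℂ) +
                Complex.I * ((2 / Real.pi : ℝ) : ℂ) +
                Complex.I * ((2 / Real.pi : ℝ) : ℂ) * (Real.log lam : ℂ)))
            =O[𝓝[>] 0] fun lam : ℝ => lam ^ (1 / 2 - ε)) := by
  have hr' := hr.comp_neg
  have hVc := ConicalJost.continuous_potential hr
  obtain ⟨A, B, κ, hAB, hJ⟩ := ConicalJost.exists_jostPlus_eq hr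
  have hminus : ∃ (A₂ B₂ : ℝ → ℂ) (κ₂ : ℝ), ((∀ x, r (-x) = r x) → κ = κ₂) ∧
      ConicalJost.EndAsymptotics A₂ B₂ κ₂ ∧ ∀ l > 0, ∀ u v : ℝ → ℝ,
        ConicalJost.IsPerturbation (ConicalJost.potential r) l (ConicalJost.uZero r) u →
        ConicalJost.IsPerturbation (ConicalJost.potential r) l (ConicalJost.uOne r) v →
        ConicalJost.IsJostMinus (ConicalJost.potential r) l fun ξ => A₂ l * u ξ + -B₂ l * v ξ := by
    -- The constants come from an existence statement, so for an even profile the data of the right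
    -- end are reused at the left; this makes the two constants literally equal.
    by_cases he : ∀ x, r (-x) = r x
    · refine ⟨A, B, κ, fun _ => rfl, hAB, fun l hl u v hu hv =>
        ConicalJost.exists_jostMinus_eq hr ?_ hl hu hv⟩
      rw [show (fun x => r (-x)) = r from funext he]
      exact hJ
    · obtain ⟨A₂, B₂, κ₂, hAB₂, hJ₂⟩ := ConicalJost.exists_jostPlus_eq hr'
      exact ⟨A₂, B₂, κ₂, fun h => absurd h he, hAB₂, fun l hl u v hu hv =>
        ConicalJost.exists_jostMinus_eq hr hJ₂ hl hu hv⟩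
  obtain ⟨A₂, B₂, κ₂, hκ, hAB₂, hJ₂⟩ := hminus
  have huniq₀ := fun l => ConicalJost.existsUnique_isPerturbation hVc l (ConicalJost.uZero r)
  have huniq₁ := fun l => ConicalJost.existsUnique_isPerturbation hVc l (ConicalJost.uOne r)
  have hplus : ∀ l : ℝ, 0 < l → ∀ f g, ConicalJost.IsJostPlus (ConicalJost.potential r) l f →
      ConicalJost.IsJostPlus (ConicalJost.potential r) l g → f = g := fun l hl f g hf hg =>
    hf.unique hVc hl hg
  have hneg : ∀ l : ℝ, 0 < l → ∀ f g, ConicalJost.IsJostMinus (ConicalJost.potential r) l f →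
      ConicalJost.IsJostMinus (ConicalJost.potential r) l g → f = g := fun l hl f g hf hg => by
    have h1 := (ConicalJost.isJostMinus_iff.1 hf).unique (hVc.comp continuous_neg) hl
      (ConicalJost.isJostMinus_iff.1 hg)
    funext ξ
    simpa using congrFun h1 (-ξ)
  refine ⟨ConicalJost.potential_add_isBigO hr, ?_, fun l hl => ?_, fun l hl => ?_, huniq₀, huniq₁,
    fun fp fm u₀ u₁ hfp hfm hu₀ hu₁ => ?_⟩
  · have h1 := (ConicalJost.potential_add_isBigO hr').comp_tendsto tendsto_neg_atBot_atTop
    rw [ConicalJost.potential_comp_neg hr] at h1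
    refine (h1.congr_left fun ξ => ?_).congr_right fun ξ => ?_
    · simp
    · simp
  · obtain ⟨u, hu, -⟩ := huniq₀ l
    obtain ⟨v, hv, -⟩ := huniq₁ l
    exact ⟨_, hJ l hl u v hu hv, fun g hg => hplus l hl _ _ hg (hJ l hl u v hu hv)⟩
  · obtain ⟨u, hu, -⟩ := huniq₀ l
    obtain ⟨v, hv, -⟩ := huniq₁ l
    exact ⟨_, hJ₂ l hl u v hu hv, fun g hg => hneg l hl _ _ hg (hJ₂ l hl u v hu hv)⟩
  have efp : ∀ l, 0 < l → fp l = fun ξ => A l * u₀ l ξ + B l * u₁ l ξ := fun l hl =>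
    hplus l hl _ _ (hfp l hl) (hJ l hl _ _ (hu₀ l) (hu₁ l))
  have efm : ∀ l, 0 < l → fm l = fun ξ => A₂ l * u₀ l ξ + -B₂ l * u₁ l ξ := fun l hl =>
    hneg l hl _ _ (hfm l hl) (hJ₂ l hl _ _ (hu₀ l) (hu₁ l))
  refine ⟨A, B, A₂, fun l => -B₂ l, fun l => A₂ l * B l - -B₂ l * A l, fun l hl => ?_, κ, κ₂, hκ,
    fun ε hε => ?_⟩
  · refine ⟨fun ξ => congrFun (efp l hl) ξ, fun ξ => congrFun (efm l hl) ξ, fun ξ => ?_,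
      hAB.diff_fst l hl, hAB.diff_snd l hl, hAB₂.diff_fst l hl, (hAB₂.diff_snd l hl).neg,
      ((hAB₂.diff_fst l hl).mul (hAB.diff_snd l hl)).sub
        ((hAB₂.diff_snd l hl).neg.mul (hAB.diff_fst l hl))⟩
    rw [(hfm l hl).1.wronskian_eq (hfp l hl).1 ξ, efp l hl, efm l hl]
    have hd : ∀ a b : ℂ, deriv (fun ξ => a * (u₀ l ξ : ℂ) + b * (u₁ l ξ : ℂ)) 0 =
        a * ((deriv (u₀ l) 0 : ℝ) : ℂ) + b * ((deriv (u₁ l) 0 : ℝ) : ℂ) := fun a b =>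
      ((((hu₀ l).1.hasDerivAt 0).ofReal_comp.const_mul a).add
        (((hu₁ l).1.hasDerivAt 0).ofReal_comp.const_mul b)).deriv
    -- The Wronskian of the two perturbed solutions is `1`, evaluated at `0` where `u₁` vanishes.
    have hW : u₀ l 0 * deriv (u₁ l) 0 = 1 := by
      rw [(hu₀ l).2.1, (hu₁ l).2.2, ConicalJost.deriv_uOne hr, ConicalJost.uZero]
      exact mul_inv_cancel₀ (Real.sqrt_pos.2 (ConicalJost.radius_pos hr 0)).ne'
    have hW' : (u₀ l 0 : ℂ) * ((deriv (u₁ l) 0 : ℝ) : ℂ) = 1 := by exact_mod_cast hW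
    have h0 : u₁ l 0 = 0 := (hu₁ l).2.1.trans (ConicalJost.uOne_zero r)
    rw [ConicalJost.wronskian, hd, hd, h0, Complex.ofReal_zero]
    linear_combination (A₂ l * B l + B₂ l * A l) * hW'
  · have hnd : (fun l => deriv (fun l => -B₂ l) l) = fun l => -deriv B₂ l :=
      funext fun l => deriv.fun_neg
    refine ⟨hAB.fst ε hε, hAB.snd ε hε, hAB₂.fst ε hε, ?_, ?_, ?_, ?_, ?_,
      hAB.subPow_wronskian hAB₂ ε hε, hAB.subPow_deriv_wronskian hAB₂ ε hε⟩
    · exact (hAB₂.snd.neg.congr fun l _ => by ring) ε hε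
    · simpa only [zero_sub] using hAB.fst_deriv ε hε
    · simpa only [zero_sub] using hAB.snd_deriv ε hε
    · simpa only [zero_sub] using hAB₂.fst_deriv ε hε
    · have h1 := (hAB₂.snd_deriv.neg.congr (g := fun l => deriv (fun l => -B₂ l) l +
        Complex.I / 2 * (ConicalJost.q : ℂ)⁻¹ * ConicalJost.c₀ * ConicalJost.c₁ *
          (Real.sqrt l : ℂ)⁻¹) fun l _ => by rw [congrFun hnd l]; ring) ε hε
      simpa only [zero_sub] using h1
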